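/- Let $D_1,D_2\subset\mathbb C$ be bounded simply connected domains whose boundaries $\Gamma_j=\partial D_j$ ($j=1,2$) are Jordan curves of class $C^1$ (with a regular $C^1$ parametrization), let $\overline{D_2}\subset D_1$, let $\alpha\in\mathbb R$, $\alpha\neq1$, and let $\omega_0=\chi_{D_1}+(\alpha-1)\chi_{D_2}$. Let $\omega_t$, $t\ge0$, be the weak solution, bounded in time with values in $L^1\cap L^\infty$, of the planar Euler vorticity equation $$\partial_t\omega+u\cdot\nabla\omega=0,\qquad u(t,z)=\frac{i}{2\pi}\int_{\mathbb C}\frac{\omega_t(\xi)}{\overline{z-\xi}}\,dA(\xi),$$ with initial datum $\omega_0$ (it exists and is unique by Yudovich's theorem). Assume that $\omega_t$ rotates uniformly, that is, there are a point $c\in\mathbb C$ and a number $\Omega\in\mathbb R$ such that, for every $t\ge0$, $\omega_t(z)=\omega_0\big(c+e^{-it\Omega}(z-c)\big)$ for almost every $z\in\mathbb C$. If $\Gamma_1$ or $\Gamma_2$ is a circle, then the other curve is a circle with the same center. Consequently $D_1\setminus\overline{D_2}$ is an annulus: there are $z_0\in\mathbb C$ and $0<r_2<r_1$ with $\Gamma_j=\{|z-z_0|=r_j\}$,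 $j=1,2$, and $D_1\setminus\overline{D_2}=\{r_2<|z-z_0|<r_1\}$. -/

import Mathlib

open MeasureTheory

/-- A Jordan curve of class `C¹` in the plane: the image of a `1`-periodic, continuously
differentiable, regular parametrization that is injective on a period. -/
def IsC1JordanCurve (Γ : Set ℂ) : Prop :=
  ∃ γ : ℝ → ℂ, ContDiff ℝ 1 γ ∧ Function.Periodic γ 1 ∧ Set.InjOn γ (Set.Ico 0 1) ∧
    (∀ s, deriv γ s ≠ 0) ∧ Set.range γ = Γ

/-- A bounded simply connected planar domain whose boundary is a Jordan curve of class `C¹`. -/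
structure IsC1JordanDomain (D : Set ℂ) : Prop where
  isOpen : IsOpen D
  isBounded : Bornology.IsBounded D
  simplyConnected : IsSimplyConnected D
  boundary : IsC1JordanCurve (frontier D)

/-- A (nondegenerate) circle in the plane. -/
def IsCircle (Γ : Set ℂ) : Prop :=
  ∃ (c : ℂ) (r : ℝ), 0 < r ∧ Γ = Metric.sphere c r

/-- The vorticity `χ_{D₁} + (α - 1) χ_{D₂}`. -/
noncomputable def twoPatch (D₁ D₂ : Set ℂ) (α : ℝ) (z : ℂ) : ℝ :=
  D₁.indicator 1 z + (α - 1) * D₂.indicator 1 z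

/-- The velocity field of the vorticity `ω` (Biot-Savart law),
`u(z) = (1 / 2π) ∫ (z - ξ)^⊥ / |z - ξ|² ω(ξ) dA(ξ)`; in complex notation
`w^⊥ / |w|² = i w / |w|² = i / conj w`. -/
noncomputable def velocity (ω : ℂ → ℝ) (z : ℂ) : ℂ :=
  Complex.I / (2 * Real.pi) * ∫ ξ : ℂ, (ω ξ : ℂ) / (starRingEnd ℂ) (z - ξ)

/-- `ω` is a global weak solution, bounded in time with values in `L¹ ∩ L^∞` (the class in which
Yudovich's theorem gives existence and uniqueness), of the vorticity equation
`∂_t ω + u · ∇ω = 0` with initial datum `ω₀`, where `u(t, ·)` is the velocity field of `ω(t, ·)`.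
For a test function `φ`, the number `fderiv ℝ φ (t, z) (1, u)` is `∂_t φ + u · ∇φ`. -/
structure IsVorticitySolution (ω₀ : ℂ → ℝ) (ω : ℝ → ℂ → ℝ) : Prop where
  measurable : AEStronglyMeasurable (fun p : ℝ × ℂ => ω p.1 p.2)
    (volume.restrict (Set.Ioi 0 ×ˢ Set.univ))
  bounded : ∃ M : NNReal, ∀ᵐ t ∂(volume.restrict (Set.Ioi (0 : ℝ))),
    eLpNorm (ω t) 1 volume ≤ M ∧ eLpNorm (ω t) ⊤ volume ≤ M
  weak : ∀ φ : ℝ × ℂ → ℝ, ContDiff ℝ (⊤ : ℕ∞) φ → HasCompactSupport φ →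
    (∫ t in Set.Ioi (0 : ℝ), ∫ z : ℂ, ω t z * fderiv ℝ φ (t, z) (1, velocity (ω t) z))
      + ∫ z : ℂ, ω₀ z * φ (0, z) = 0

/-- `ω` is the uniform rotation of `ω₀`, with some constant angular velocity `Ω` about some
point `c`: at each time `t ≥ 0`, `ω(t, z) = ω₀(c + e^{-iΩt} (z - c))` for almost every `z`. -/
def RotatesUniformly (ω₀ : ℂ → ℝ) (ω : ℝ → ℂ → ℝ) : Prop :=
  ∃ (c : ℂ) (Ω : ℝ), ∀ t : ℝ, 0 ≤ t →
    ω t =ᵐ[volume] fun z => ω₀ (c + Complex.exp (-(Complex.I * Ω * t)) * (z - c))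

/-!
# Uniformly rotating doubly connected patches with one circular boundary

Write `C_D(z) = π⁻¹ ∫_D dA(ξ) / (z - ξ)`, so that `∂C_D/∂z̄ = χ_D`. In the frame that rotates with
the patch the velocity is `V = (i / 2) conj Q`, with
`Q = C_{D₁} + (α - 1) C_{D₂} - 2 Ω conj (z - c)` (`relField`).

**Tangency.** Testing the vorticity equation with functions carried along by the rotation shows that
`χ_{D₁} + (α - 1) χ_{D₂}` is a stationary weak solution for `V`
(`integral_relVelocity_eq_zero`). As `∂Q/∂z̄` is real, `V` is also weakly divergence free; as
`α ≠ 1` and `closure D₂ ⊆ D₁`, a cutoff separates the two boundaries, and `∫_{D_j} ∇f · V = 0` for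
all smooth `f` and `j = 1, 2` (`isWeaklyTangent_relField`).

**Circular flows.** If `Q(z) = q(|z - a|) conj (z - a)` in `D ∋ a`, tangency says that the integrals
`∫_D q(|z - a|) g` do not change when `g` is rotated about `a`. So a circle about `a` through an
exterior point on which `q ≠ 0` cannot meet `D`; since the exterior is adherent to the whole of
`∂D`, and `q` has at most one zero there, `D` is a disc about `a`
(`IsC1JordanDomain.eq_ball_of_tangent_circular`).

**Circular inner boundary**, `D₂ = B(a, r)`. Testing on `D₂` with powers of `conj (z - a)` gives the
moments `∫_{D₁ \ D₂} (ξ - a)⁻ⁿ`, and these say that `C_{D₁ \ D₂}` is constant on `D₂`. By the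
identity theorem `C_{D₁}` is `conj z` plus a constant on all of `D₁`, which makes `Q` circular
there.

**Circular outer boundary**, `D₁ = B(a, R)`. The same tests on `D₁` give
`m_n = ∫_{D₂} (ξ - a)ⁿ = 0` for `n ≥ 2`. The exterior of `D₂` is connected, as a `C¹` Jordan curve
has only two sides, so `(z - a)² C_{D₂} = (m₀ (z - a) + m₁) / π` throughout the complement of `D₂`.
Let `K` be the difference of the two sides. It vanishes off `D₂` and `∂K/∂z̄ = (z - a)² χ_{D₂}`;
hence, with `B = (z - a)² conj (z - a)`, the functions `Bᵏ - (B - K)ᵏ` vanish off `D₂`, and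
integrating their `∂/∂z̄` derivatives evaluates enough of the moments
`∫_{D₂} (z - a)^j conj (z - a)^k` to conclude from the test function `(z - a)⁶ conj (z - a)²` that
`m₁ = 0` (`firstMoment_eq_zero`). Then `a ∈ D₂`, and for the test functions `|z - a|⁴ g` with real
`g` the contribution of `K` drops out, being the imaginary part of a real number: what is left is a
circular flow on `D₂`.

Products of continuous functions with bounded weak `∂/∂z̄` derivatives, and the Cauchy–Pompeiu
formula for them, are provided by `HasWeakDbar`.
-/

/-! ### Regular `C¹` Jordan curves have two sides -/

/-- Two parameters of the same point of a Jordan curve differ by an integer. -/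
theorem exists_int_of_eq_of_injOn_Ico {γ : ℝ → ℂ} (hp : Function.Periodic γ 1)
    (hinj : Set.InjOn γ (Set.Ico 0 1)) {s t : ℝ} (h : γ s = γ t) : ∃ n : ℤ, s - t = n := by
  have key : ∀ x, γ (Int.fract x) = γ x := fun x => by
    have := hp.sub_int_mul_eq (x := x) ⌊x⌋
    rwa [mul_one] at this
  have h1 := hinj ⟨Int.fract_nonneg s, Int.fract_lt_one s⟩
    ⟨Int.fract_nonneg t, Int.fract_lt_one t⟩ (by rw [key, key, h])
  exact Int.fract_eq_fract.1 h1

/-- The two-sidedness of a regular `C¹` Jordan curve: near each of its points the complement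
consists of two connected pieces, and each of the two adheres to the whole nearby arc. -/
theorem IsC1JordanCurve.exists_two_sides {Γ : Set ℂ} (hΓ : IsC1JordanCurve Γ) {p : ℂ}
    (hpΓ : p ∈ Γ) :
    ∃ N L R : Set ℂ, IsOpen N ∧ p ∈ N ∧ IsPreconnected L ∧ IsPreconnected R ∧
      Disjoint L Γ ∧ Disjoint R Γ ∧ N ⊆ L ∪ R ∪ Γ ∧ N ∩ Γ ⊆ closure L ∧ N ∩ Γ ⊆ closure R := by
  obtain ⟨γ, hC, hper, hinj, hreg, rfl⟩ := hΓ
  obtain ⟨s₀, rfl⟩ := hpΓ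
  -- Flatten the curve near `γ s₀`: the real axis goes to the curve.
  set Φ : ℂ → ℂ := fun w => γ w.re + w.im * (Complex.I * deriv γ s₀) with hΦ
  have hΦre : ∀ s : ℝ, Φ s = γ s := fun s => by simp [hΦ]
  let e : ℂ ≃L[ℝ] ℂ :=
    (ContinuousLinearEquiv.smulLeft (Units.mk0 _ (hreg s₀)) : ℂ ≃L[ℂ] ℂ).restrictScalars ℝ
  have hder : HasStrictFDerivAt Φ (e : ℂ →L[ℝ] ℂ) (s₀ : ℂ) := by
    have h1 : HasStrictDerivAt γ (deriv γ s₀) ((s₀ : ℂ).re) := by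
      simpa using (hC.contDiffAt.hasStrictDerivAt (by simp) : HasStrictDerivAt γ (deriv γ s₀) s₀)
    have h2 := h1.hasStrictFDerivAt.comp (s₀ : ℂ) (Complex.reCLM.hasStrictFDerivAt)
    have h3 : HasStrictFDerivAt (fun w : ℂ => (w.im : ℂ) * (Complex.I * deriv γ s₀))
        ((Complex.ofRealCLM.comp Complex.imCLM).smulRight (Complex.I * deriv γ s₀)) (s₀ : ℂ) := by
      exact ((Complex.ofRealCLM.comp Complex.imCLM).smulRight
        (Complex.I * deriv γ s₀)).hasStrictFDerivAt (x := (s₀ : ℂ))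
    refine (h2.add h3).congr_fderiv ?_
    ext w
    have he : e w = deriv γ s₀ * w := rfl
    simp only [add_apply, ContinuousLinearMap.comp_apply,
      ContinuousLinearMap.toSpanSingleton_apply, ContinuousLinearMap.smulRight_apply,
      Complex.reCLM_apply, Complex.imCLM_apply, Complex.ofRealCLM_apply, Complex.real_smul,
      smul_eq_mul, ContinuousLinearEquiv.coe_coe, he]
    conv_rhs => rw [← Complex.re_add_im w]
    ring
  set E := hder.toOpenPartialHomeomorph Φ with hE
  have hEc : (E : ℂ → ℂ) = Φ := hder.toOpenPartialHomeomorph_coe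
  obtain ⟨ε, hε, hball⟩ := Metric.isOpen_iff.1 E.open_source _
    hder.mem_toOpenPartialHomeomorph_source
  have hcont : Continuous Φ := by
    have := hC.continuous
    fun_prop
  -- The part of the curve with parameters away from `s₀` stays away from `γ s₀`.
  obtain ⟨η, hη, hfar⟩ : ∃ η > 0, ∀ s ∈ Set.Icc (s₀ + ε / 2) (s₀ + 1 - ε / 2),
      γ s ∉ Metric.ball (γ s₀) η := by
    have hK : IsClosed (γ '' Set.Icc (s₀ + ε / 2) (s₀ + 1 - ε / 2)) :=
      (isCompact_Icc.image hC.continuous).isClosed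
    have hnot : γ s₀ ∈ (γ '' Set.Icc (s₀ + ε / 2) (s₀ + 1 - ε / 2))ᶜ := by
      rintro ⟨s, hs, hss⟩
      obtain ⟨n, hn⟩ := exists_int_of_eq_of_injOn_Ico hper hinj hss
      have h1 : (0 : ℝ) < n := by rw [← hn]; linarith [hs.1]
      have h2 : (n : ℝ) < 1 := by rw [← hn]; linarith [hs.2]
      norm_cast at h1 h2
      omega
    obtain ⟨η, hη, h⟩ := Metric.isOpen_iff.1 hK.isOpen_compl _ hnot
    exact ⟨η, hη, fun s hs hb => h hb ⟨s, hs, rfl⟩⟩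
  obtain ⟨δ, hδ, hδη⟩ := Metric.continuousAt_iff.1 (hcont.continuousAt (x := (s₀ : ℂ))) η hη
  rw [hΦre] at hδη
  set B : Set ℂ := Metric.ball (s₀ : ℂ) (min ε δ) with hB
  have hBε : B ⊆ E.source := (Metric.ball_subset_ball (min_le_left _ _)).trans hball
  have hflat : ∀ w ∈ B, Φ w ∈ Set.range γ → w.im = 0 := by
    intro w hw hr
    obtain ⟨s, hs⟩ := hr
    obtain ⟨s', hs', hss'⟩ := hper.exists_mem_Ico one_pos s (s₀ - ε / 2)
    rw [hss'] at hs
    by_cases hlt : s' < s₀ + ε / 2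
    · have hmem : ((s' : ℝ) : ℂ) ∈ Metric.ball (s₀ : ℂ) ε := by
        rw [Metric.mem_ball, Complex.dist_eq, ← Complex.ofReal_sub, Complex.norm_real,
          Real.norm_eq_abs, abs_lt]
        constructor <;> linarith [hs'.1]
      have := E.injOn (hball hmem) (hBε hw) (by rw [hEc, hΦre, hs])
      rw [← this]; simp
    · exfalso
      refine hfar s' ⟨by linarith, by linarith [hs'.2]⟩ ?_
      rw [hs]
      exact hδη (lt_of_lt_of_le hw (min_le_right _ _))
  have hBo : IsOpen B := Metric.isOpen_ball
  have hBc : Convex ℝ B := convex_ball _ _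
  have hB0 : 0 < min ε δ := lt_min hε hδ
  -- The points of the flat arc are limits of points on either side of it.
  have hclos : ∀ σ : ℝ, σ ≠ 0 → ∀ w ∈ B, w.im = 0 →
      Φ w ∈ closure (Φ '' (B ∩ {w | 0 < σ * w.im})) := by
    intro σ hσ w hw hw0
    refine image_closure_subset_closure_image hcont ⟨w, ?_, rfl⟩
    have hT : Filter.Tendsto (fun t : ℝ => w + t * (σ * Complex.I)) (nhdsWithin 0 (Set.Ioi 0))
        (nhds w) := by
      have : Continuous (fun t : ℝ => w + t * (σ * Complex.I)) := by fun_prop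
      simpa using (this.tendsto 0).mono_left nhdsWithin_le_nhds
    refine mem_closure_of_tendsto hT ?_
    filter_upwards [hT (hBo.mem_nhds hw), self_mem_nhdsWithin] with t ht htp
    refine ⟨ht, ?_⟩
    have : 0 < σ * σ := mul_self_pos.2 hσ
    simp only [Set.mem_Ioi] at htp
    have h2 : 0 < t * (σ * σ) := by positivity
    simp [hw0]; nlinarith
  have hside : ∀ σ : ℝ, IsPreconnected (Φ '' (B ∩ {w | 0 < σ * w.im})) := by
    intro σ
    refine (Convex.isPreconnected (hBc.inter ?_)).image _ hcont.continuousOn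
    have : {w : ℂ | 0 < σ * w.im} = {w : ℂ | 0 < (σ • Complex.imLm) w} := by ext; simp
    rw [this]
    exact convex_halfSpace_gt (LinearMap.isLinear _) 0
  have hdisj : ∀ σ : ℝ, Disjoint (Φ '' (B ∩ {w | 0 < σ * w.im})) (Set.range γ) := by
    intro σ
    rw [Set.disjoint_left]
    rintro _ ⟨w, ⟨hw, hw'⟩, rfl⟩ hr
    simp [hflat w hw hr] at hw'
  have harc : ∀ σ : ℝ, σ ≠ 0 →
      Φ '' B ∩ Set.range γ ⊆ closure (Φ '' (B ∩ {w | 0 < σ * w.im})) := by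
    rintro σ hσ _ ⟨⟨w, hw, rfl⟩, hr⟩
    exact hclos σ hσ w hw (hflat w hw hr)
  refine ⟨Φ '' B, _, _, ?_, ⟨s₀, Metric.mem_ball_self hB0, hΦre s₀⟩, hside 1, hside (-1), hdisj 1,
    hdisj (-1), ?_, harc 1 (by norm_num), harc (-1) (by norm_num)⟩
  · rw [← hEc]
    exact E.isOpen_image_of_subset_source hBo hBε
  · rintro _ ⟨w, hw, rfl⟩
    rcases lt_trichotomy w.im 0 with h | h | h
    · exact Or.inl (Or.inr ⟨w, ⟨hw, by simpa using h⟩, rfl⟩)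
    · refine Or.inr ⟨w.re, ?_⟩
      rw [← hΦre, show ((w.re : ℝ) : ℂ) = w from Complex.ext (by simp) (by simp [h])]
    · exact Or.inl (Or.inl ⟨w, ⟨hw, by simpa using h⟩, rfl⟩)

/-- A preconnected set that misses the frontier of an open set `A` and meets `A` lies in `A`. -/
theorem IsPreconnected.subset_of_disjoint_frontier {X : Type*} [TopologicalSpace X] {s A Γ : Set X}
    (hs : IsPreconnected s) (hA : IsOpen A) (hAΓ : frontier A ⊆ Γ) (hsΓ : Disjoint s Γ)
    (h : (s ∩ A).Nonempty) : s ⊆ A := by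
  refine hs.subset_of_closure_inter_subset hA h ?_
  rintro x ⟨hx, hxs⟩
  by_contra hxA
  exact Set.disjoint_left.1 hsΓ hxs (hAΓ ⟨hx, by rwa [hA.interior_eq]⟩)

/-- Every complementary region of a `C¹` Jordan curve is bounded by the whole curve: the set of
boundary points is closed, and open in the curve because of the two sides. -/
theorem IsC1JordanCurve.frontier_eq {Γ A : Set ℂ} (hΓ : IsC1JordanCurve Γ) (hA : IsOpen A)
    (hne : A.Nonempty) (hAΓ : Disjoint A Γ) (hfr : frontier A ⊆ Γ) : frontier A = Γ := by
  have hconn : IsPreconnected Γ := by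
    obtain ⟨γ, hC, -, -, -, rfl⟩ := hΓ
    exact isPreconnected_range hC.continuous
  have hΓne : Γ.Nonempty := by
    obtain ⟨γ, hC, -, -, -, rfl⟩ := hΓ
    exact Set.range_nonempty γ
  have hfne : (frontier A).Nonempty := by
    refine nonempty_frontier_iff.2 ⟨hne, ?_⟩
    rintro rfl
    obtain ⟨p, hp⟩ := hΓne
    exact Set.disjoint_left.1 hAΓ (Set.mem_univ p) hp
  have hnhd : ∀ p ∈ frontier A, ∃ N : Set ℂ, IsOpen N ∧ p ∈ N ∧ N ∩ Γ ⊆ frontier A := by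
    intro p hp
    obtain ⟨N, L, R, hN, hpN, hL, hR, hLΓ, hRΓ, hcov, hcL, hcR⟩ := hΓ.exists_two_sides (hfr hp)
    refine ⟨N, hN, hpN, fun x hx => ?_⟩
    obtain ⟨y, hyN, hyA⟩ := mem_closure_iff.1 (frontier_subset_closure hp) N hN hpN
    have hxA : x ∉ interior A := fun h =>
      Set.disjoint_left.1 hAΓ (interior_subset h) hx.2
    refine ⟨?_, hxA⟩
    rcases hcov hyN with (hy | hy) | hy
    · exact closure_mono (hL.subset_of_disjoint_frontier hA hfr hLΓ ⟨y, hy, hyA⟩) (hcL hx)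
    · exact closure_mono (hR.subset_of_disjoint_frontier hA hfr hRΓ ⟨y, hy, hyA⟩) (hcR hx)
    · exact absurd hy (Set.disjoint_left.1 hAΓ hyA)
  choose! N hN hpN hsub using hnhd
  refine hfr.antisymm fun x hx => ?_
  have hcov : Γ ⊆ (⋃ p ∈ frontier A, N p) ∪ (frontier A)ᶜ := fun y _ => by
    by_cases hy : y ∈ frontier A
    · exact Or.inl (Set.mem_iUnion₂.2 ⟨y, hy, hpN y hy⟩)
    · exact Or.inr hy
  have hsub' : ∀ y ∈ Γ, y ∈ (⋃ p ∈ frontier A, N p) → y ∈ frontier A := by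
    intro y hy hyV
    obtain ⟨p, hp, hyp⟩ := Set.mem_iUnion₂.1 hyV
    exact hsub p hp ⟨hyp, hy⟩
  rcases isPreconnected_iff_subset_of_disjoint.1 hconn _ _ (isOpen_biUnion hN)
    isClosed_frontier.isOpen_compl hcov
    (Set.eq_empty_of_forall_notMem fun y hy => hy.2.2 (hsub' y hy.1 hy.2.1)) with h | h
  · exact hsub' x hx (h hx)
  · obtain ⟨p, hp⟩ := hfne
    exact absurd hp (h (hfr hp))

/-- A `C¹` Jordan curve does not bound three disjoint regions, as it has only two sides. -/
theorem IsC1JordanCurve.not_three_regions {Γ : Set ℂ} (hΓ : IsC1JordanCurve Γ) (A : Fin 3 → Set ℂ)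
    (hA : ∀ i, IsOpen (A i)) (hne : ∀ i, (A i).Nonempty) (hAΓ : ∀ i, Disjoint (A i) Γ)
    (hfr : ∀ i, frontier (A i) ⊆ Γ) (hdisj : ∀ i j, i ≠ j → Disjoint (A i) (A j)) : False := by
  have hΓne : Γ.Nonempty := by
    obtain ⟨γ, hC, -, -, -, rfl⟩ := hΓ
    exact Set.range_nonempty γ
  obtain ⟨p, hp⟩ := hΓne
  obtain ⟨N, L, R, hN, hpN, hL, hR, hLΓ, hRΓ, hcov, hcL, hcR⟩ := hΓ.exists_two_sides hp
  have hside : ∀ i, L ⊆ A i ∨ R ⊆ A i := by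
    intro i
    have hpf : p ∈ frontier (A i) := by
      rw [hΓ.frontier_eq (hA i) (hne i) (hAΓ i) (hfr i)]; exact hp
    obtain ⟨y, hyN, hyA⟩ := mem_closure_iff.1 (frontier_subset_closure hpf) N hN hpN
    rcases hcov hyN with (hy | hy) | hy
    · exact Or.inl (hL.subset_of_disjoint_frontier (hA i) (hfr i) hLΓ ⟨y, hy, hyA⟩)
    · exact Or.inr (hR.subset_of_disjoint_frontier (hA i) (hfr i) hRΓ ⟨y, hy, hyA⟩)
    · exact absurd hy (Set.disjoint_left.1 (hAΓ i) hyA)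
  obtain ⟨l, hl⟩ := closure_nonempty_iff.1 ⟨p, hcL ⟨hpN, hp⟩⟩
  obtain ⟨r, hr⟩ := closure_nonempty_iff.1 ⟨p, hcR ⟨hpN, hp⟩⟩
  have hLL : ∀ i j, i ≠ j → L ⊆ A i → L ⊆ A j → False := fun i j hij h h' =>
    Set.disjoint_left.1 (hdisj i j hij) (h hl) (h' hl)
  have hRR : ∀ i j, i ≠ j → R ⊆ A i → R ⊆ A j → False := fun i j hij h h' =>
    Set.disjoint_left.1 (hdisj i j hij) (h hr) (h' hr)
  rcases hside 0 with h0 | h0 <;> rcases hside 1 with h1 | h1 <;> rcases hside 2 with h2 | h2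
  all_goals first
    | exact hLL 0 1 (by decide) h0 h1
    | exact hLL 0 2 (by decide) h0 h2
    | exact hLL 1 2 (by decide) h1 h2
    | exact hRR 0 1 (by decide) h0 h1
    | exact hRR 0 2 (by decide) h0 h2
    | exact hRR 1 2 (by decide) h1 h2

/-! ### The exterior of a Jordan domain -/

/-- The exterior of a `C¹` Jordan domain is bounded by the whole curve. -/
theorem IsC1JordanDomain.frontier_exterior {D : Set ℂ} (hD : IsC1JordanDomain D) :
    frontier (closure D)ᶜ = frontier D := by
  refine hD.boundary.frontier_eq isClosed_closure.isOpen_compl ?_ ?_ ?_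
  · rw [Set.nonempty_compl]
    intro h
    exact NormedSpace.unbounded_univ ℝ ℂ (h ▸ hD.isBounded.closure)
  · exact Set.disjoint_left.2 fun x hx hx' => hx (frontier_subset_closure hx')
  · rw [frontier_compl]; exact frontier_closure_subset

/-- The exterior of a `C¹` Jordan domain is connected: a separation of it would make, with the
domain itself, three regions bounded by the curve. -/
theorem IsC1JordanDomain.isPreconnected_exterior {D : Set ℂ} (hD : IsC1JordanDomain D) :
    IsPreconnected (closure D)ᶜ := by
  rw [isPreconnected_iff_subset_of_disjoint]
  intro u v hu hv hcov hdisj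
  by_contra! hcon
  obtain ⟨h1, h2⟩ := hcon
  set U := (closure D)ᶜ with hU
  have hUo : IsOpen U := isClosed_closure.isOpen_compl
  have hUD : Disjoint U D := Set.disjoint_left.2 fun x hx hx' => hx (subset_closure hx')
  have hUf : Disjoint U (frontier D) :=
    Set.disjoint_left.2 fun x hx hx' => hx (frontier_subset_closure hx')
  have huv : Disjoint (U ∩ u) (U ∩ v) := Set.disjoint_left.2 fun x hx hx' =>
    (Set.eq_empty_iff_forall_notMem.1 hdisj x) ⟨hx.1, hx.2, hx'.2⟩
  have hfr : ∀ a b : Set ℂ, IsOpen a → IsOpen b → U ⊆ a ∪ b → Disjoint (U ∩ a) (U ∩ b) →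
      frontier (U ∩ a) ⊆ frontier D := by
    intro a b ha hb hab hd x hx
    have hxa : x ∉ U ∩ a := by
      have := hx.2; rwa [(hUo.inter ha).interior_eq] at this
    have hxb : x ∉ U ∩ b := fun h => by
      obtain ⟨y, hy, hy'⟩ := mem_closure_iff.1 hx.1 _ (hUo.inter hb) h
      exact Set.disjoint_left.1 hd hy' hy
    have hxD : x ∉ D := fun h => by
      obtain ⟨y, hy, hy'⟩ := mem_closure_iff.1 hx.1 _ hD.isOpen h
      exact Set.disjoint_left.1 hUD hy'.1 hy
    have hxU : x ∉ U := fun h => (hab h).elim (fun h' => hxa ⟨h, h'⟩) (fun h' => hxb ⟨h, h'⟩)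
    exact ⟨not_not.1 hxU, by rwa [hD.isOpen.interior_eq]⟩
  have hne : ∀ a b : Set ℂ, U ⊆ a ∪ b → ¬ U ⊆ a → (U ∩ b).Nonempty := by
    intro a b hab ha
    obtain ⟨x, hx, hxa⟩ := Set.not_subset.1 ha
    exact ⟨x, hx, (hab hx).resolve_left hxa⟩
  have hcov' : U ⊆ v ∪ u := by rwa [Set.union_comm]
  refine hD.boundary.not_three_regions ![D, U ∩ u, U ∩ v] ?_ ?_ ?_ ?_ ?_
  · intro i; fin_cases i
    exacts [hD.isOpen, hUo.inter hu, hUo.inter hv]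
  · intro i; fin_cases i
    exacts [hD.simplyConnected.nonempty, hne v u hcov' h2, hne u v hcov h1]
  · intro i; fin_cases i
    · exact Set.disjoint_left.2 fun x hx hx' => hx'.2 (by rwa [hD.isOpen.interior_eq])
    · exact hUf.mono_left Set.inter_subset_left
    · exact hUf.mono_left Set.inter_subset_left
  · intro i; fin_cases i
    · exact subset_rfl
    · exact hfr u v hu hv hcov huv
    · exact hfr v u hv hu hcov' huv.symm
  · intro i j hij
    have h01 : Disjoint D (U ∩ u) := (hUD.mono_left Set.inter_subset_left).symm
    have h02 : Disjoint D (U ∩ v) := (hUD.mono_left Set.inter_subset_left).symm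
    fin_cases i <;> fin_cases j <;> first
      | exact absurd rfl hij
      | exact h01
      | exact h01.symm
      | exact h02
      | exact h02.symm
      | exact huv
      | exact huv.symm

/-- A bounded nonempty open set whose boundary lies on a circle is the disc. -/
theorem eq_ball_of_frontier_subset_sphere {D : Set ℂ} (hD : IsOpen D) (hb : Bornology.IsBounded D)
    (hne : D.Nonempty) {a : ℂ} {R : ℝ} (hR : 0 < R) (h : frontier D ⊆ Metric.sphere a R) :
    D = Metric.ball a R := by
  have hout : IsPreconnected (Metric.closedBall a R)ᶜ := by
    have : (Metric.closedBall a R)ᶜ =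
        (fun p : ℝ × ℝ => a + p.1 * Complex.exp (p.2 * Complex.I)) '' (Set.Ioi R ×ˢ Set.univ) := by
      ext z
      simp only [Set.mem_compl_iff, Metric.mem_closedBall, not_le, Set.mem_image, Set.mem_prod,
        Set.mem_Ioi, Set.mem_univ, and_true, Prod.exists]
      constructor
      · intro hz
        refine ⟨‖z - a‖, Complex.arg (z - a), by rwa [← Complex.dist_eq], ?_⟩
        rw [Complex.norm_mul_exp_arg_mul_I]; ring
      · rintro ⟨r, θ, hr, rfl⟩
        rwa [Complex.dist_eq, add_sub_cancel_left, norm_mul, Complex.norm_exp_ofReal_mul_I, mul_one,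
          Complex.norm_real, Real.norm_of_nonneg (hR.trans hr).le]
    rw [this]
    exact (isPreconnected_Ioi.prod isPreconnected_univ).image _
      (Continuous.continuousOn (by fun_prop))
  have hdo : Disjoint (Metric.closedBall a R)ᶜ (Metric.sphere a R) :=
    Set.disjoint_left.2 fun x hx hx' => hx (Metric.sphere_subset_closedBall hx')
  have hdi : Disjoint (Metric.ball a R) (Metric.sphere a R) := by
    refine Set.disjoint_left.2 fun x hx hx' => ?_
    simp only [Metric.mem_ball, Metric.mem_sphere] at hx hx'
    exact hx.ne hx'
  have h1 : D ⊆ Metric.closedBall a R := by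
    intro x hx
    by_contra hxa
    have := hout.subset_of_disjoint_frontier hD h hdo ⟨x, hxa, hx⟩
    have hun := hb.subset this
    have := hun.union (Metric.isBounded_closedBall (x := a) (r := R))
    rw [Set.compl_union_self] at this
    exact NormedSpace.unbounded_univ ℝ ℂ this
  have h2 : D ⊆ Metric.ball a R := by
    have := interior_mono h1
    rwa [interior_closedBall _ hR.ne', hD.interior_eq] at this
  obtain ⟨x, hx⟩ := hne
  exact h2.antisymm ((convex_ball a R).isPreconnected.subset_of_disjoint_frontier hD h hdi
    ⟨x, h2 hx, hx⟩)

/-! ### The Cauchy kernel -/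

/-- The Wirtinger operator `∂/∂z̄ = (∂/∂x + i ∂/∂y) / 2`. -/
noncomputable def dbar (f : ℂ → ℂ) (z : ℂ) : ℂ :=
  (fderiv ℝ f z 1 + Complex.I * fderiv ℝ f z Complex.I) / 2

/-- The Cauchy transform of the set `D`, normalized so that `∂/∂z̄` of it is the indicator
function of `D`. -/
noncomputable def cauchyTransform (D : Set ℂ) (z : ℂ) : ℂ :=
  (Real.pi : ℂ)⁻¹ * ∫ ξ in D, (z - ξ)⁻¹

theorem locallyIntegrable_inv : LocallyIntegrable (fun z : ℂ => z⁻¹) := by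
  refine locallyIntegrable_of_norm_le_rpow (C := 1) (α := 1) (by simp) (by simp) ?_
    measurable_inv.aestronglyMeasurable
  filter_upwards with z
  rw [norm_inv, Real.rpow_neg_one, one_mul]

theorem integrableOn_inv_sub {D : Set ℂ} (hD : Bornology.IsBounded D) (z : ℂ) :
    IntegrableOn (fun ξ : ℂ => (z - ξ)⁻¹) D := by
  have h : LocallyIntegrable (fun ξ : ℂ => (z - ξ)⁻¹) := by
    intro x
    obtain ⟨s, hs, hint⟩ := locallyIntegrable_inv (z - x)
    have hcont : Continuous (fun ξ : ℂ => z - ξ) := by fun_prop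
    refine ⟨(fun ξ => z - ξ) ⁻¹' s, hcont.continuousAt hs, ?_⟩
    exact ((Measure.measurePreserving_sub_left volume z).integrableOn_comp_preimage
      (Homeomorph.subLeft z).measurableEmbedding).2 hint
  exact (h.integrableOn_isCompact hD.isCompact_closure).mono_set subset_closure

theorem exists_integral_norm_inv_sub_le (R : ℝ) : ∃ M, ∀ ξ ∈ Metric.closedBall (0 : ℂ) R,
    ∫ z in Metric.closedBall (0 : ℂ) R, ‖(z - ξ)⁻¹‖ ≤ M := by
  refine ⟨∫ w in Metric.closedBall (0 : ℂ) (R + R), ‖w⁻¹‖, fun ξ hξ => ?_⟩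
  have h1 : ∫ w in Metric.closedBall (0 : ℂ) (R + R), ‖w⁻¹‖ =
      ∫ z in (fun z => z - ξ) ⁻¹' Metric.closedBall (0 : ℂ) (R + R), ‖(z - ξ)⁻¹‖ :=
    ((measurePreserving_sub_right volume ξ).setIntegral_preimage_emb
      (Homeomorph.subRight ξ).measurableEmbedding (fun w => ‖w⁻¹‖) _).symm
  rw [h1]
  have hsub : (fun z => z - ξ) ⁻¹' Metric.closedBall (0 : ℂ) (R + R) =
      Metric.closedBall ξ (R + R) := by
    ext z; simp [dist_eq_norm]
  rw [hsub]
  refine setIntegral_mono_set ?_ (Filter.Eventually.of_forall fun z => norm_nonneg _) ?_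
  · have := (integrableOn_inv_sub (Metric.isBounded_closedBall (x := ξ) (r := R + R)) ξ).norm
    simpa only [IntegrableOn, norm_inv, norm_sub_rev] using this
  · refine Filter.Eventually.of_forall fun z hz => ?_
    simp only [Metric.mem_closedBall, dist_zero_right] at hξ
    have hz' : ‖z‖ ≤ R := mem_closedBall_zero_iff.1 hz
    change dist z ξ ≤ R + R
    rw [dist_eq_norm]
    exact (norm_sub_le _ _).trans (add_le_add hz' hξ)

/-- The Cauchy kernel is integrable on products of bounded sets. -/
theorem integrable_mul_inv_sub {E D : Set ℂ} (hE : Bornology.IsBounded E)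
    (hD : Bornology.IsBounded D) {h : ℂ → ℂ} (hh : Continuous h) :
    Integrable (fun p : ℂ × ℂ => h p.1 * (p.1 - p.2)⁻¹)
      ((volume.restrict E).prod (volume.restrict D)) := by
  obtain ⟨R, hR⟩ := (hE.union hD).subset_closedBall (0 : ℂ)
  obtain ⟨hER, hDR⟩ := Set.union_subset_iff.1 hR
  set B := Metric.closedBall (0 : ℂ) R
  have hB : IsCompact B := isCompact_closedBall _ _
  suffices H : Integrable (fun p : ℂ × ℂ => h p.1 * (p.1 - p.2)⁻¹)
      ((volume.restrict B).prod (volume.restrict B)) by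
    rw [Measure.prod_restrict] at H ⊢
    exact IntegrableOn.mono_set H (Set.prod_mono hER hDR)
  obtain ⟨K, hK⟩ := hB.exists_bound_of_continuousOn hh.continuousOn
  obtain ⟨M, hM⟩ := exists_integral_norm_inv_sub_le R
  have hmeas : Measurable (fun p : ℂ × ℂ => h p.1 * (p.1 - p.2)⁻¹) :=
    (hh.measurable.comp measurable_fst).mul (measurable_fst.sub measurable_snd).inv
  have hint : ∀ ξ : ℂ, IntegrableOn (fun z : ℂ => (z - ξ)⁻¹) B := fun ξ => by
    have := (integrableOn_inv_sub hB.isBounded ξ).neg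
    refine this.congr_fun (fun z _ => ?_) hB.measurableSet
    rw [Pi.neg_apply, ← inv_neg, neg_sub]
  have hint' : ∀ ξ : ℂ, IntegrableOn (fun z : ℂ => h z * (z - ξ)⁻¹) B := fun ξ =>
    (hint ξ).continuousOn_mul hh.continuousOn hB
  rw [integrable_prod_iff' hmeas.aestronglyMeasurable]
  refine ⟨Filter.Eventually.of_forall hint', ?_⟩
  have : IsFiniteMeasure (volume.restrict B) := ⟨by
    rw [Measure.restrict_apply_univ]; exact hB.measure_lt_top⟩
  refine Integrable.mono' (integrable_const (K * M)) ?_ ?_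
  · exact (hmeas.norm.stronglyMeasurable.integral_prod_left
      (μ := volume.restrict B)).aestronglyMeasurable
  · filter_upwards [ae_restrict_mem hB.measurableSet] with ξ hξ
    rw [Real.norm_of_nonneg (integral_nonneg fun _ => norm_nonneg _)]
    have hK0 : 0 ≤ K := (norm_nonneg _).trans (hK ξ hξ)
    calc ∫ z in B, ‖h z * (z - ξ)⁻¹‖ ≤ ∫ z in B, K * ‖(z - ξ)⁻¹‖ := by
          refine setIntegral_mono_on (hint' ξ).norm ((hint ξ).norm.const_mul K)
            hB.measurableSet fun z hz => ?_
          rw [norm_mul]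
          exact mul_le_mul_of_nonneg_right (hK z hz) (norm_nonneg _)
      _ ≤ K * M := by
          rw [integral_const_mul]
          exact mul_le_mul_of_nonneg_left (hM ξ hξ) hK0

/-- Fubini's theorem for the Cauchy kernel. -/
theorem integral_mul_cauchyTransform {E D : Set ℂ} (hE : Bornology.IsBounded E)
    (hD : Bornology.IsBounded D) {h : ℂ → ℂ} (hh : Continuous h) :
    ∫ z in E, h z * cauchyTransform D z =
      (Real.pi : ℂ)⁻¹ * ∫ ξ in D, ∫ z in E, h z * (z - ξ)⁻¹ := by
  rw [← integral_integral_swap (integrable_mul_inv_sub hE hD hh), ← integral_const_mul]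
  refine integral_congr_ae (Filter.Eventually.of_forall fun z => ?_)
  simp only [cauchyTransform]
  rw [integral_const_mul]; ring

/-- The Cauchy transform of a bounded set is continuous: it is the uniform limit of the integrals
with the kernel `1 / w` replaced by `conj w / max (|w| ^ 2) (ε ^ 2)`. -/
theorem continuous_cauchyTransform {D : Set ℂ} (hD : Bornology.IsBounded D) :
    Continuous (cauchyTransform D) := by
  refine continuous_const.mul ?_
  have hfin : IsFiniteMeasure (volume.restrict D) := ⟨by
    rw [Measure.restrict_apply_univ]; exact hD.measure_lt_top⟩
  have hloc : ∀ R, IntegrableOn (fun w : ℂ => ‖w⁻¹‖) (Metric.closedBall 0 R) := fun R =>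
    (locallyIntegrable_inv.integrableOn_isCompact (isCompact_closedBall _ _)).norm
  have hsmall : Filter.Tendsto (fun n : ℕ => ∫ w in Metric.closedBall (0 : ℂ) (1 / (n + 1)), ‖w⁻¹‖)
      Filter.atTop (nhds 0) := by
    have := tendsto_setIntegral_of_antitone (μ := volume) (f := fun w : ℂ => ‖w⁻¹‖)
      (s := fun n : ℕ => Metric.closedBall (0 : ℂ) (1 / ((n : ℝ) + 1)))
      (fun n => Metric.isClosed_closedBall.measurableSet)
      (fun m n hmn => Metric.closedBall_subset_closedBall
        (one_div_le_one_div_of_le (by positivity) (by simpa using hmn))) ⟨0, hloc _⟩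
    have h0 : ⋂ n : ℕ, Metric.closedBall (0 : ℂ) (1 / ((n : ℝ) + 1)) = {0} := by
      ext w
      simp only [Set.mem_iInter, Metric.mem_closedBall, dist_zero_right, Set.mem_singleton_iff]
      refine ⟨fun h =>
        norm_le_zero_iff.1 (ge_of_tendsto' tendsto_one_div_add_atTop_nhds_zero_nat h),
        fun h n => ?_⟩
      rw [h, norm_zero]; positivity
    rw [h0] at this
    simpa using this
  refine continuous_of_uniform_approx_of_continuous fun u hu => ?_
  obtain ⟨ε, hε, hεu⟩ := Metric.mem_uniformity_dist.1 hu
  obtain ⟨n, hn⟩ := (hsmall.eventually (gt_mem_nhds hε)).exists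
  set δ : ℝ := 1 / (n + 1) with hδ
  have hδ0 : 0 < δ := by positivity
  set K : ℂ → ℂ := fun w => (starRingEnd ℂ) w / ((max (‖w‖ ^ 2) (δ ^ 2) : ℝ) : ℂ) with hK
  have hmaxpos : ∀ w : ℂ, 0 < max (‖w‖ ^ 2) (δ ^ 2) := fun w => lt_max_of_lt_right (by positivity)
  have hKc : Continuous K := by
    refine Continuous.div (by fun_prop) (by fun_prop) fun w => ?_
    exact_mod_cast (hmaxpos w).ne'
  have hKn : ∀ w, ‖K w‖ = ‖w‖ / max (‖w‖ ^ 2) (δ ^ 2) := fun w => by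
    rw [hK]; simp only [norm_div, RCLike.norm_conj, Complex.norm_real,
      Real.norm_of_nonneg (hmaxpos w).le]
  have hKle : ∀ w, ‖K w‖ ≤ 1 / δ := fun w => by
    rw [hKn, div_le_div_iff₀ (hmaxpos w) hδ0, one_mul]
    rcases le_total ‖w‖ δ with h | h
    · refine le_trans ?_ (le_max_right _ _); nlinarith
    · refine le_trans ?_ (le_max_left _ _); nlinarith [norm_nonneg w]
  have hKout : ∀ w, δ ≤ ‖w‖ → K w = w⁻¹ := fun w hw => by
    rw [hK]; simp only
    rw [max_eq_left (by gcongr), Complex.inv_def, Complex.normSq_eq_norm_sq, div_eq_mul_inv,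
      Complex.ofReal_inv]
  have hKin : ∀ w, ‖w⁻¹ - K w‖ ≤ (Metric.closedBall (0 : ℂ) δ).indicator (fun w => ‖w⁻¹‖) w := by
    intro w
    by_cases hw : w ∈ Metric.closedBall (0 : ℂ) δ
    · rw [Set.indicator_of_mem hw]
      have hw' : ‖w‖ ≤ δ := by simpa using hw
      have hmax : max (‖w‖ ^ 2) (δ ^ 2) = δ ^ 2 := max_eq_right (by gcongr)
      rcases eq_or_ne w 0 with rfl | hw0
      · simp [hK]
      have hwpos : 0 < ‖w‖ := norm_pos_iff.2 hw0
      have h1 : w⁻¹ - K w = w⁻¹ * ((1 - ‖w‖ ^ 2 / δ ^ 2 : ℝ) : ℂ) := by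
        have hc : (starRingEnd ℂ) w = w⁻¹ * ((‖w‖ ^ 2 : ℝ) : ℂ) := by
          rw [Complex.ofReal_pow, ← Complex.mul_conj', ← mul_assoc, inv_mul_cancel₀ hw0, one_mul]
        simp only [hK, hmax, hc]
        push_cast
        ring
      rw [h1, norm_mul, Complex.norm_real, Real.norm_eq_abs]
      refine mul_le_of_le_one_right (norm_nonneg _) (abs_le.2 ⟨?_, ?_⟩)
      · have : ‖w‖ ^ 2 / δ ^ 2 ≤ 1 := (div_le_one (by positivity)).2 (by gcongr)
        linarith
      · have : 0 ≤ ‖w‖ ^ 2 / δ ^ 2 := by positivity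
        linarith
    · rw [Set.indicator_of_notMem hw]
      have hw' : δ ≤ ‖w‖ := by simpa using (not_le.1 (by simpa using hw)).le
      rw [hKout w hw', sub_self, norm_zero]
  refine ⟨fun z => ∫ ξ in D, K (z - ξ), ?_, fun z => hεu ?_⟩
  · refine continuous_of_dominated (bound := fun _ => 1 / δ)
      (fun z => (hKc.comp (continuous_const.sub continuous_id)).aestronglyMeasurable)
      (fun z => Filter.Eventually.of_forall fun ξ => hKle _) (integrable_const _)
      (Filter.Eventually.of_forall fun ξ => hKc.comp (continuous_id.sub continuous_const))
  · have hKi : IntegrableOn (fun ξ => K (z - ξ)) D :=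
      Integrable.mono' (integrable_const (1 / δ))
        (hKc.comp (continuous_const.sub continuous_id)).aestronglyMeasurable
        (Filter.Eventually.of_forall fun ξ => hKle _)
    rw [dist_eq_norm, ← integral_sub (integrableOn_inv_sub hD z) hKi]
    have hind : Integrable ((Metric.closedBall (0 : ℂ) δ).indicator (fun w : ℂ => ‖w⁻¹‖)) :=
      (integrable_indicator_iff Metric.isClosed_closedBall.measurableSet).2 (hloc δ)
    have hind' := hind.comp_sub_left z
    calc ‖∫ ξ in D, ((z - ξ)⁻¹ - K (z - ξ))‖
        ≤ ∫ ξ in D, (Metric.closedBall (0 : ℂ) δ).indicator (fun w => ‖w⁻¹‖) (z - ξ) :=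
          norm_integral_le_of_norm_le hind'.integrableOn
            (Filter.Eventually.of_forall fun ξ => hKin _)
      _ ≤ ∫ ξ, (Metric.closedBall (0 : ℂ) δ).indicator (fun w => ‖w⁻¹‖) (z - ξ) :=
          setIntegral_le_integral hind' (Filter.Eventually.of_forall fun ξ =>
            Set.indicator_nonneg (fun _ _ => norm_nonneg _) _)
      _ = ∫ w in Metric.closedBall (0 : ℂ) δ, ‖w⁻¹‖ := by
          rw [integral_sub_left_eq_self (fun w => (Metric.closedBall (0 : ℂ) δ).indicator
            (fun w => ‖w⁻¹‖) w) volume z,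
            integral_indicator Metric.isClosed_closedBall.measurableSet]
      _ < ε := hn

/-! ### The Cauchy–Pompeiu formula -/

theorem Complex.polarCoord_symm_eq_exp (p : ℝ × ℝ) :
    Complex.polarCoord.symm p = p.1 * Complex.exp (p.2 * Complex.I) := by
  rw [Complex.polarCoord_symm_apply, Complex.exp_mul_I]
  push_cast; ring

/-- Integration in polar coordinates as an iterated integral. -/
theorem integral_eq_integral_polar {f : ℂ → ℂ} (hf : Integrable f) (hm : Measurable f) :
    ∫ z, f z = ∫ r in Set.Ioi (0 : ℝ), ∫ θ in Set.Ioo (-Real.pi) Real.pi,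
      (r : ℂ) * f (r * Complex.exp (θ * Complex.I)) := by
  have hmeas : Measurable (fun p : ℝ × ℝ => p.1 • f (Complex.polarCoord.symm p)) := by
    refine measurable_fst.smul (hm.comp ?_)
    rw [show (Complex.polarCoord.symm : ℝ × ℝ → ℂ) =
      fun p => p.1 * Complex.exp (p.2 * Complex.I) from funext Complex.polarCoord_symm_eq_exp]
    fun_prop
  have hint : IntegrableOn (fun p : ℝ × ℝ => p.1 • f (Complex.polarCoord.symm p))
      polarCoord.target := by
    refine ⟨hmeas.aestronglyMeasurable, ?_⟩
    have h1 := hf.2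
    rw [hasFiniteIntegral_iff_enorm, ← Complex.lintegral_comp_polarCoord_symm] at h1
    rw [hasFiniteIntegral_iff_enorm]
    refine lt_of_le_of_lt (le_of_eq ?_) h1
    refine setLIntegral_congr_fun polarCoord.open_target.measurableSet fun p hp => ?_
    have hp0 : 0 < p.1 := hp.1
    simp only [enorm_smul, smul_eq_mul]
    rw [Real.enorm_of_nonneg hp0.le]
  rw [← Complex.integral_comp_polarCoord_symm]
  rw [polarCoord_target] at hint ⊢
  rw [Measure.volume_eq_prod, setIntegral_prod _ hint]
  simp only [Complex.polarCoord_symm_eq_exp, Complex.real_smul]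

theorem continuous_dbar {φ : ℂ → ℂ} (hφ : ContDiff ℝ 1 φ) : Continuous (dbar φ) := by
  have := hφ.continuous_fderiv (by simp)
  unfold dbar
  fun_prop

theorem dbar_eq_zero_of_notMem_tsupport {φ : ℂ → ℂ} {z : ℂ} (hz : z ∉ tsupport φ) :
    dbar φ z = 0 := by
  simp [dbar, fderiv_of_notMem_tsupport ℝ hz]

theorem hasCompactSupport_dbar {φ : ℂ → ℂ} (hφ : HasCompactSupport φ) :
    HasCompactSupport (dbar φ) :=
  HasCompactSupport.intro hφ fun _ hz => dbar_eq_zero_of_notMem_tsupport hz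

/-- The values of a real derivative, recombined along an orthonormal frame. -/
theorem dbar_mul_exp_neg (φ : ℂ → ℂ) (z : ℂ) (θ : ℝ) :
    dbar φ z * Complex.exp (-(θ * Complex.I)) = (fderiv ℝ φ z (Complex.exp (θ * Complex.I)) +
      Complex.I * fderiv ℝ φ z (Complex.I * Complex.exp (θ * Complex.I))) / 2 := by
  have h1 : Complex.exp (θ * Complex.I) = (Real.cos θ) • (1 : ℂ) + (Real.sin θ) • Complex.I := by
    rw [Complex.exp_mul_I]; simp
  have h2 : Complex.I * Complex.exp (θ * Complex.I) =
      (-Real.sin θ) • (1 : ℂ) + (Real.cos θ) • Complex.I := by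
    rw [h1]; simp only [Complex.real_smul]; push_cast
    linear_combination Complex.sin θ * Complex.I_mul_I
  have h3 : Complex.exp (-(θ * Complex.I)) = Real.cos θ - Real.sin θ * Complex.I := by
    rw [← neg_mul, Complex.exp_mul_I]; simp [sub_eq_add_neg]
  rw [h2, h1, h3, map_add, map_add, map_smul, map_smul, map_smul, map_smul, dbar]
  simp only [Complex.real_smul]
  push_cast
  linear_combination (-Complex.sin θ * fderiv ℝ φ z Complex.I / 2) * Complex.I_mul_I

/-- The Cauchy–Pompeiu formula for a compactly supported `C¹` function. -/
theorem integral_dbar_mul_inv {φ : ℂ → ℂ} (hφ : ContDiff ℝ 1 φ) (hc : HasCompactSupport φ) (a : ℂ) :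
    ∫ z, dbar φ z * (z - a)⁻¹ = -Real.pi * φ a := by
  have hcont := continuous_dbar hφ
  have hfd := hφ.continuous_fderiv (by simp)
  have hdiff : Differentiable ℝ φ := hφ.differentiable (by simp)
  obtain ⟨R, hR0, hR⟩ := (hc.isCompact.isBounded).exists_pos_norm_lt
  have hzero : ∀ z, R ≤ ‖z‖ → z ∉ tsupport φ := fun z hz h => absurd (hR z h) (not_lt.2 hz)
  set e : ℝ → ℂ := fun θ => Complex.exp (θ * Complex.I) with he
  have hec : Continuous e := by fun_prop
  have hen : ∀ θ, ‖e θ‖ = 1 := fun θ => Complex.norm_exp_ofReal_mul_I θ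
  have he' : ∀ θ : ℝ, HasDerivAt e (Complex.I * e θ) θ := fun θ => by
    have h := (((Complex.ofRealCLM.hasDerivAt (x := θ)).mul_const Complex.I).cexp)
    simp only [Complex.ofRealCLM_apply, Complex.ofReal_one, one_mul] at h
    rw [mul_comm]; exact h
  set A : ℝ → ℝ → ℂ := fun r θ => fderiv ℝ φ (a + r * e θ) (e θ) with hA
  set B : ℝ → ℝ → ℂ := fun r θ => fderiv ℝ φ (a + r * e θ) (Complex.I * e θ) with hB
  have hout : ∀ r θ, R + ‖a‖ ≤ r → a + r * e θ ∉ tsupport φ := fun r θ hr => by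
    refine hzero _ ?_
    have h1 : ‖(r : ℂ) * e θ‖ = r := by
      rw [norm_mul, hen, mul_one, Complex.norm_real,
        Real.norm_of_nonneg ((add_pos_of_pos_of_nonneg hR0 (norm_nonneg a)).le.trans hr)]
    have h2 := norm_sub_le (a + r * e θ) a
    rw [add_sub_cancel_left, h1] at h2
    linarith
  -- The angular derivative integrates to zero over a period.
  have hBint : ∀ r : ℝ, 0 < r → ∫ θ in Set.Ioo (-Real.pi) Real.pi, B r θ = 0 := by
    intro r hr
    have hd : ∀ θ ∈ Set.uIcc (-Real.pi) Real.pi,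
        HasDerivAt (fun θ => φ (a + r * e θ)) ((r : ℂ) * B r θ) θ := by
      intro θ _
      have h1 : HasDerivAt (fun θ => a + r * e θ) (r * (Complex.I * e θ)) θ :=
        ((he' θ).const_mul (r : ℂ)).const_add a
      have h2 := (hdiff (a + r * e θ)).hasFDerivAt.comp_hasDerivAt θ h1
      have h3 : (r : ℂ) * (Complex.I * e θ) = r • (Complex.I * e θ) := by simp
      rw [h3, map_smul, Complex.real_smul] at h2
      exact h2
    have hci : Continuous fun θ => (r : ℂ) * B r θ := by
      simp only [hB]; fun_prop
    have h := intervalIntegral.integral_eq_sub_of_hasDerivAt hd (hci.intervalIntegrable _ _)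
    have hends : e Real.pi = e (-Real.pi) := by
      simp only [he]
      rw [Complex.exp_pi_mul_I, Complex.ofReal_neg, neg_mul, Complex.exp_neg,
        Complex.exp_pi_mul_I]; norm_num
    simp only [hends, sub_self] at h
    rw [intervalIntegral.integral_const_mul, intervalIntegral.integral_of_le
      (by linarith [Real.pi_pos]), integral_Ioc_eq_integral_Ioo] at h
    exact (mul_eq_zero.1 h).resolve_left (by exact_mod_cast hr.ne')
  -- The radial derivative integrates to minus the value at the centre.
  have hAint : ∀ θ : ℝ, ∫ r in Set.Ioi (0 : ℝ), A r θ = -φ a := by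
    intro θ
    have hline : ContDiff ℝ 1 (fun r : ℝ => φ (a + r * e θ)) := by
      refine hφ.comp (contDiff_const.add (ContDiff.mul ?_ contDiff_const))
      exact Complex.ofRealCLM.contDiff
    have hder : ∀ r : ℝ, deriv (fun r : ℝ => φ (a + r * e θ)) r = A r θ := fun r => by
      have h1 : HasDerivAt (fun r : ℝ => a + r * e θ) (1 * e θ) r := by
        have := ((Complex.ofRealCLM.hasDerivAt (x := r)).mul_const (e θ)).const_add a
        simpa using this
      have h2 := (hdiff (a + r * e θ)).hasFDerivAt.comp_hasDerivAt r h1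
      rw [one_mul] at h2
      exact h2.deriv
    have hcs : HasCompactSupport (fun r : ℝ => φ (a + r * e θ)) := by
      refine HasCompactSupport.intro (isCompact_closedBall (0 : ℝ) (R + ‖a‖)) fun r hr => ?_
      refine image_eq_zero_of_notMem_tsupport (hzero _ ?_)
      have h1 : R + ‖a‖ < |r| := by simpa using hr
      have h2 := norm_sub_le (a + r * e θ) a
      rw [add_sub_cancel_left, norm_mul, hen, mul_one, Complex.norm_real, Real.norm_eq_abs] at h2
      linarith
    have h := hcs.integral_Ioi_deriv_eq hline 0
    simp only [hder] at h
    simpa using h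
  have hfm : Measurable (fun w : ℂ => dbar φ (a + w) * w⁻¹) :=
    (hcont.measurable.comp (measurable_const_add a)).mul measurable_inv
  have hfi : Integrable (fun w : ℂ => dbar φ (a + w) * w⁻¹) := by
    have := locallyIntegrable_inv.integrable_smul_left_of_hasCompactSupport
      (hcont.comp (continuous_const_add a))
      ((hasCompactSupport_dbar hc).comp_homeomorph (Homeomorph.addLeft a))
    simpa using this
  have hAprod : IntegrableOn (Function.uncurry A)
      (Set.Ioi (0 : ℝ) ×ˢ Set.Ioo (-Real.pi) Real.pi) (volume.prod volume) := by
    have hAc : Continuous (Function.uncurry A) := by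
      simp only [hA, Function.uncurry_def]; fun_prop
    have h1 : IntegrableOn (Function.uncurry A)
        (Set.Icc (0 : ℝ) (R + ‖a‖) ×ˢ Set.Icc (-Real.pi) Real.pi) (volume.prod volume) :=
      hAc.continuousOn.integrableOn_compact (isCompact_Icc.prod isCompact_Icc)
    refine IntegrableOn.of_forall_sdiff_eq_zero h1
      (measurableSet_Ioi.prod measurableSet_Ioo) ?_
    rintro ⟨r, θ⟩ ⟨⟨h2, h3⟩, h4⟩
    simp only [Set.mem_prod, Set.mem_Icc, Set.mem_Ioi, Set.mem_Ioo] at h2 h3 h4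
    have : R + ‖a‖ ≤ r := by
      by_contra hlt
      exact h4 ⟨⟨h2.le, (not_le.1 hlt).le⟩, h3.1.le, h3.2.le⟩
    simp only [Function.uncurry, hA]
    rw [fderiv_of_notMem_tsupport ℝ (hout r θ this)]; simp
  have hstep : ∀ r ∈ Set.Ioi (0 : ℝ), ∫ θ in Set.Ioo (-Real.pi) Real.pi,
      (r : ℂ) * (dbar φ (a + r * e θ) * ((r : ℂ) * e θ)⁻¹) =
      (1 / 2 : ℂ) * ∫ θ in Set.Ioo (-Real.pi) Real.pi, A r θ := by
    intro r hr
    have hr0 : (r : ℂ) ≠ 0 := by exact_mod_cast (Set.mem_Ioi.1 hr).ne'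
    have hc1 : IntegrableOn (A r) (Set.Ioo (-Real.pi) Real.pi) :=
      ((by simp only [hA]; fun_prop : Continuous (A r)).integrableOn_Icc).mono_set
        Set.Ioo_subset_Icc_self
    have hc2 : IntegrableOn (B r) (Set.Ioo (-Real.pi) Real.pi) :=
      ((by simp only [hB]; fun_prop : Continuous (B r)).integrableOn_Icc).mono_set
        Set.Ioo_subset_Icc_self
    have : ∀ θ : ℝ, (r : ℂ) * (dbar φ (a + r * e θ) * ((r : ℂ) * e θ)⁻¹) =
        (1 / 2 : ℂ) * (A r θ + Complex.I * B r θ) := by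
      intro θ
      have h := dbar_mul_exp_neg φ (a + r * e θ) θ
      rw [Complex.exp_neg] at h
      rw [mul_inv]
      calc (r : ℂ) * (dbar φ (a + r * e θ) * ((r : ℂ)⁻¹ * (e θ)⁻¹))
          = ((r : ℂ) * (r : ℂ)⁻¹) * (dbar φ (a + r * e θ) * (e θ)⁻¹) := by ring
        _ = _ := by rw [mul_inv_cancel₀ hr0, one_mul, h]; ring
    simp only [this]
    rw [integral_const_mul, integral_add hc1 (hc2.const_mul _), integral_const_mul, hBint r hr,
      mul_zero, add_zero]
  calc ∫ z, dbar φ z * (z - a)⁻¹ = ∫ w, dbar φ (a + w) * w⁻¹ := by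
        rw [← integral_add_left_eq_self _ a]; simp
    _ = ∫ r in Set.Ioi (0 : ℝ), ∫ θ in Set.Ioo (-Real.pi) Real.pi,
          (r : ℂ) * (dbar φ (a + r * e θ) * ((r : ℂ) * e θ)⁻¹) :=
        integral_eq_integral_polar hfi hfm
    _ = ∫ r in Set.Ioi (0 : ℝ), (1 / 2 : ℂ) * ∫ θ in Set.Ioo (-Real.pi) Real.pi, A r θ :=
        setIntegral_congr_fun measurableSet_Ioi hstep
    _ = (1 / 2 : ℂ) * ∫ θ in Set.Ioo (-Real.pi) Real.pi, ∫ r in Set.Ioi (0 : ℝ), A r θ := by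
        rw [integral_const_mul, integral_integral_swap]
        rw [Measure.prod_restrict]; exact hAprod
    _ = -Real.pi * φ a := by
        simp only [hAint]
        rw [setIntegral_const, measureReal_def, Real.volume_Ioo,
          ENNReal.toReal_ofReal (by linarith [Real.pi_pos]), Complex.real_smul]
        push_cast; ring

/-! ### Weak `∂/∂z̄` derivatives -/

section WeakDbar

open scoped ContDiff Convolution

theorem dbar_mul {f g : ℂ → ℂ} {z : ℂ} (hf : DifferentiableAt ℝ f z)
    (hg : DifferentiableAt ℝ g z) :
    dbar (fun w => f w * g w) z = f z * dbar g z + g z * dbar f z := by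
  have h : fderiv ℝ (fun w => f w * g w) z = f z • fderiv ℝ g z + g z • fderiv ℝ f z :=
    fderiv_mul hf hg
  simp only [dbar, h, add_apply, smul_apply, smul_eq_mul]
  ring

theorem dbar_eq_zero_of_differentiableAt {f : ℂ → ℂ} {z : ℂ} (hf : DifferentiableAt ℂ f z) :
    dbar f z = 0 := by
  rw [dbar, hf.fderiv_restrictScalars ℝ]
  have : fderiv ℂ f z Complex.I = Complex.I * fderiv ℂ f z 1 := by
    rw [← smul_eq_mul, ← map_smul, smul_eq_mul, mul_one]
  simp only [ContinuousLinearMap.coe_restrictScalars', this, ← mul_assoc, Complex.I_mul_I]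
  ring

theorem integral_dbar_eq_zero {φ : ℂ → ℂ} (hφ : ContDiff ℝ 1 φ) (hc : HasCompactSupport φ) :
    ∫ z, dbar φ z = 0 := by
  -- The Cauchy–Pompeiu formula at `0` for `z φ(z)`.
  have hd : Differentiable ℝ φ := hφ.differentiable (by simp)
  have h := integral_dbar_mul_inv (φ := fun z => z * φ z) (contDiff_id.mul hφ) hc.mul_left 0
  rw [zero_mul, mul_zero] at h
  rw [← h]
  refine integral_congr_ae ?_
  filter_upwards [Measure.ae_ne volume (0 : ℂ)] with z hz
  have h1 : DifferentiableAt ℝ (fun w : ℂ => w) z := differentiableAt_id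
  have h2 : DifferentiableAt ℂ (fun w : ℂ => w) z := differentiableAt_id
  rw [dbar_mul h1 (hd z), dbar_eq_zero_of_differentiableAt h2, mul_zero, add_zero, sub_zero]
  field_simp

/-- `F` is continuous, `f` is locally bounded, and `∂F/∂z̄ = f` in the sense of distributions. -/
structure HasWeakDbar (F f : ℂ → ℂ) : Prop where
  continuous : Continuous F
  aestronglyMeasurable : AEStronglyMeasurable f volume
  locallyBounded : ∀ R : ℝ, ∃ M : ℝ, ∀ z, ‖z‖ ≤ R → ‖f z‖ ≤ M
  integral_mul_dbar : ∀ φ : ℂ → ℂ, ContDiff ℝ ∞ φ → HasCompactSupport φ →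
    ∫ z, F z * dbar φ z = -∫ z, f z * φ z

theorem locallyIntegrable_of_locallyBounded {f : ℂ → ℂ} (hm : AEStronglyMeasurable f volume)
    (hb : ∀ R : ℝ, ∃ M : ℝ, ∀ z, ‖z‖ ≤ R → ‖f z‖ ≤ M) : LocallyIntegrable f := by
  intro x
  obtain ⟨M, hM⟩ := hb (‖x‖ + 1)
  refine ⟨Metric.closedBall x 1, Metric.closedBall_mem_nhds x one_pos, ?_⟩
  refine IntegrableOn.of_bound (C := M) measure_closedBall_lt_top hm.restrict ?_
  filter_upwards [ae_restrict_mem Metric.isClosed_closedBall.measurableSet] with z hz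
  refine hM z ?_
  have h1 : ‖z - x‖ ≤ 1 := by simpa [dist_eq_norm] using hz
  have h2 := norm_add_le x (z - x)
  rw [add_sub_cancel] at h2
  linarith

namespace HasWeakDbar

theorem locallyIntegrable {F f : ℂ → ℂ} (h : HasWeakDbar F f) : LocallyIntegrable f :=
  locallyIntegrable_of_locallyBounded h.aestronglyMeasurable h.locallyBounded

theorem integrable_mul {F f : ℂ → ℂ} (h : HasWeakDbar F f) {φ : ℂ → ℂ} (hφ : Continuous φ)
    (hc : HasCompactSupport φ) : Integrable (fun z => f z * φ z) :=
  h.locallyIntegrable.integrable_smul_right_of_hasCompactSupport hφ hc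

theorem integrable_mul' {F f : ℂ → ℂ} (h : HasWeakDbar F f) {φ : ℂ → ℂ} (hφ : Continuous φ)
    (hc : HasCompactSupport φ) : Integrable (fun z => F z * φ z) :=
  (h.continuous.mul hφ).integrable_of_hasCompactSupport hc.mul_left

theorem of_contDiff {F : ℂ → ℂ} (hF : ContDiff ℝ ∞ F) : HasWeakDbar F (dbar F) where
  continuous := hF.continuous
  aestronglyMeasurable := (continuous_dbar (hF.of_le (by simp))).aestronglyMeasurable
  locallyBounded R := by
    obtain ⟨M, hM⟩ := (isCompact_closedBall (0 : ℂ) R).exists_bound_of_continuousOn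
      (continuous_dbar (hF.of_le (by simp))).continuousOn
    exact ⟨M, fun z hz => hM z (by simpa using hz)⟩
  integral_mul_dbar φ hφ hc := by
    have hF1 : ContDiff ℝ 1 F := hF.of_le (by simp)
    have hφ1 : ContDiff ℝ 1 φ := hφ.of_le (by simp)
    have h := integral_dbar_eq_zero (hF1.mul hφ1) hc.mul_left
    have h2 : ∀ z, dbar (fun w => F w * φ w) z = F z * dbar φ z + dbar F z * φ z := fun z => by
      rw [dbar_mul (hF1.differentiable (by simp) z) (hφ1.differentiable (by simp) z)]; ring
    change ∫ z, dbar (fun w => F w * φ w) z = 0 at h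
    simp only [h2] at h
    rw [integral_add] at h
    · exact eq_neg_of_add_eq_zero_left h
    · exact (hF.continuous.mul (continuous_dbar hφ1)).integrable_of_hasCompactSupport
        (hasCompactSupport_dbar hc).mul_left
    · exact ((continuous_dbar hF1).mul hφ.continuous).integrable_of_hasCompactSupport hc.mul_left

theorem add {F f G g : ℂ → ℂ} (hF : HasWeakDbar F f) (hG : HasWeakDbar G g) :
    HasWeakDbar (fun z => F z + G z) (fun z => f z + g z) where
  continuous := hF.continuous.add hG.continuous
  aestronglyMeasurable := hF.aestronglyMeasurable.add hG.aestronglyMeasurable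
  locallyBounded R := by
    obtain ⟨M, hM⟩ := hF.locallyBounded R
    obtain ⟨N, hN⟩ := hG.locallyBounded R
    exact ⟨M + N, fun z hz => (norm_add_le _ _).trans (add_le_add (hM z hz) (hN z hz))⟩
  integral_mul_dbar φ hφ hc := by
    have hφ1 : ContDiff ℝ 1 φ := hφ.of_le (by simp)
    simp only [add_mul]
    rw [integral_add (hF.integrable_mul' (continuous_dbar hφ1) (hasCompactSupport_dbar hc))
      (hG.integrable_mul' (continuous_dbar hφ1) (hasCompactSupport_dbar hc)),
      integral_add (hF.integrable_mul hφ.continuous hc) (hG.integrable_mul hφ.continuous hc),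
      hF.integral_mul_dbar φ hφ hc, hG.integral_mul_dbar φ hφ hc]
    ring

theorem const_mul {F f : ℂ → ℂ} (hF : HasWeakDbar F f) (c : ℂ) :
    HasWeakDbar (fun z => c * F z) (fun z => c * f z) where
  continuous := hF.continuous.const_mul c
  aestronglyMeasurable := hF.aestronglyMeasurable.const_mul c
  locallyBounded R := by
    obtain ⟨M, hM⟩ := hF.locallyBounded R
    exact ⟨‖c‖ * M, fun z hz => by
      rw [norm_mul]; exact mul_le_mul_of_nonneg_left (hM z hz) (norm_nonneg _)⟩
  integral_mul_dbar φ hφ hc := by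
    simp only [mul_assoc]
    rw [integral_const_mul, integral_const_mul, hF.integral_mul_dbar φ hφ hc, mul_neg]

theorem sub {F f G g : ℂ → ℂ} (hF : HasWeakDbar F f) (hG : HasWeakDbar G g) :
    HasWeakDbar (fun z => F z - G z) (fun z => f z - g z) := by
  simpa [sub_eq_add_neg] using hF.add (hG.const_mul (-1))

theorem congr {F f g : ℂ → ℂ} (hF : HasWeakDbar F f) (h : ∀ z, f z = g z) : HasWeakDbar F g := by
  rwa [← funext h]

/-- Mollification: `F` is the limit of smooth functions whose `∂/∂z̄` derivatives tend to `f`,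
with bounds that are local at the unit scale. -/
theorem exists_approx {F f : ℂ → ℂ} (h : HasWeakDbar F f) : ∃ G : ℕ → ℂ → ℂ,
    (∀ n, ContDiff ℝ ∞ (G n)) ∧
    (∀ x, Filter.Tendsto (fun n => G n x) Filter.atTop (nhds (F x))) ∧
    (∀ᵐ x, Filter.Tendsto (fun n => dbar (G n) x) Filter.atTop (nhds (f x))) ∧
    (∀ n x M, (∀ y ∈ Metric.ball x 1, ‖F y‖ ≤ M) → ‖G n x‖ ≤ M) ∧
    (∀ n x M, (∀ y ∈ Metric.ball x 1, ‖f y‖ ≤ M) → ‖dbar (G n) x‖ ≤ M) := by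
  let ρ : ℕ → ContDiffBump (0 : ℂ) := fun n =>
    ⟨1 / (n + 1) / 2, 1 / (n + 1), by positivity, half_lt_self (by positivity)⟩
  have hout : ∀ n, (ρ n).rOut = 1 / (n + 1) := fun n => rfl
  have hout1 : ∀ n, (ρ n).rOut ≤ 1 := fun n => by
    rw [hout, div_le_one (by positivity)]; linarith [(Nat.cast_nonneg n : (0 : ℝ) ≤ n)]
  have hlim : Filter.Tendsto (fun n => (ρ n).rOut) Filter.atTop (nhds 0) :=
    tendsto_one_div_add_atTop_nhds_zero_nat
  set k : ℕ → ℂ → ℝ := fun n => (ρ n).normed volume with hk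
  have hks : ∀ n, ContDiff ℝ ∞ (k n) := fun n => (ρ n).contDiff_normed
  have hkc : ∀ n, HasCompactSupport (k n) := fun n => (ρ n).hasCompactSupport_normed
  let conv : ℕ → (ℂ → ℂ) → ℂ → ℂ := fun n g => k n ⋆[ContinuousLinearMap.lsmul ℝ ℝ, volume] g
  have hFl : LocallyIntegrable F := h.continuous.locallyIntegrable
  -- Convolution commutes with the weak derivative.
  have hd : ∀ n x, dbar (conv n F) x = conv n f x := by
    intro n x
    have hk1 : ContDiff ℝ 1 (k n) := (hks n).of_le (by simp)
    have hfd := ((hkc n).hasFDerivAt_convolution_left (ContinuousLinearMap.lsmul ℝ ℝ) hk1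
      hFl x).fderiv
    have hex := (HasCompactSupport.convolutionExists_left (μ := volume)
      (ContinuousLinearMap.precompL ℂ (ContinuousLinearMap.lsmul ℝ ℝ : ℝ →L[ℝ] ℂ →L[ℝ] ℂ))
      ((hkc n).fderiv ℝ) (hk1.continuous_fderiv (by simp)) hFl) x
    have happ : ∀ v, fderiv ℝ (conv n F) x v = ∫ t, fderiv ℝ (k n) t v • F (x - t) := fun v => by
      rw [hfd, convolution, ContinuousLinearMap.integral_apply hex]
      simp [ContinuousLinearMap.precompL_apply]
    have hci : ∀ v, Integrable (fun t => fderiv ℝ (k n) t v • F (x - t)) := fun v => by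
      have := hex.apply_continuousLinearMap v
      simpa [ContinuousLinearMap.precompL_apply] using this
    set φ : ℂ → ℂ := fun t => (k n (x - t) : ℂ) with hφ
    have hφs : ContDiff ℝ ∞ φ :=
      Complex.ofRealCLM.contDiff.comp ((hks n).comp (contDiff_const.sub contDiff_id))
    have hφc : HasCompactSupport φ :=
      ((hkc n).comp_homeomorph (Homeomorph.subLeft x)).comp_left Complex.ofReal_zero
    have hφd : ∀ t v, fderiv ℝ φ t v = -((fderiv ℝ (k n) (x - t) v : ℝ) : ℂ) := by
      intro t v
      have h1 : HasFDerivAt (fun t : ℂ => x - t) (-ContinuousLinearMap.id ℝ ℂ) t :=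
        (hasFDerivAt_id t).const_sub x
      have h2 := ((hk1.differentiable (by simp)) (x - t)).hasFDerivAt.comp t h1
      have h3 : HasFDerivAt φ _ t := Complex.ofRealCLM.hasFDerivAt.comp t h2
      rw [h3.fderiv]; simp
    have hw := h.integral_mul_dbar φ hφs hφc
    have hL : ∫ t, F t * dbar φ t = -dbar (conv n F) x := by
      rw [dbar, happ, happ, ← integral_const_mul, ← integral_add (hci 1) ((hci _).const_mul _),
        ← integral_sub_left_eq_self _ volume x, div_eq_mul_inv, ← integral_mul_const,
        ← integral_neg]
      refine integral_congr_ae (Filter.Eventually.of_forall fun t => ?_)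
      simp only [dbar, hφd, sub_sub_cancel, Complex.real_smul]
      ring
    have hR : ∫ t, f t * φ t = conv n f x := by
      simp only [conv]
      rw [convolution_eq_swap]
      refine integral_congr_ae (Filter.Eventually.of_forall fun t => ?_)
      simp [hφ, mul_comm]
    rw [hL, hR] at hw
    exact neg_injective hw
  have hbd : ∀ g : ℂ → ℂ, AEStronglyMeasurable g volume → ∀ n x M,
      (∀ y ∈ Metric.ball x 1, ‖g y‖ ≤ M) → ‖conv n g x‖ ≤ M := by
    intro g hg n x M hM
    have hM0 : 0 ≤ M := (norm_nonneg _).trans (hM x (Metric.mem_ball_self one_pos))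
    have := dist_convolution_le (μ := volume) (g := g) (x₀ := x) (z₀ := 0) (f := k n) hM0
      (ρ n).support_normed_eq.subset (ρ n).nonneg_normed (ρ n).integral_normed hg
      (fun y hy => by
        rw [dist_zero_right]
        exact hM y (Metric.ball_subset_ball (hout1 n) hy))
    rwa [dist_zero_right] at this
  refine ⟨fun n => conv n F, fun n => (hkc n).contDiff_convolution_left _ (hks n) hFl, fun x =>
    ContDiffBump.convolution_tendsto_right_of_continuous hlim h.continuous x, ?_,
    hbd F h.continuous.aestronglyMeasurable, fun n x M hM => ?_⟩
  · simp only [hd]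
    refine ContDiffBump.ae_convolution_tendsto_right_of_locallyIntegrable (K := 2) hlim
      (Filter.Eventually.of_forall fun n => ?_) h.locallyIntegrable
    simp only [ρ]; linarith
  · rw [hd]; exact hbd f h.aestronglyMeasurable n x M hM

end HasWeakDbar

/-- Dominated convergence against a function supported in a ball. -/
theorem tendsto_integral_mul_of_bounded_on_ball {u : ℕ → ℂ → ℂ} {v k : ℂ → ℂ} {M R : ℝ}
    (hu : ∀ n, Continuous (u n)) (hb : ∀ n z, ‖z‖ ≤ R → ‖u n z‖ ≤ M)
    (hlim : ∀ᵐ z, Filter.Tendsto (fun n => u n z) Filter.atTop (nhds (v z)))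
    (hk : Integrable k) (hk0 : ∀ z, R < ‖z‖ → k z = 0) :
    Filter.Tendsto (fun n => ∫ z, u n z * k z) Filter.atTop (nhds (∫ z, v z * k z)) := by
  refine tendsto_integral_of_dominated_convergence (fun z => M * ‖k z‖)
    (fun n => (hu n).aestronglyMeasurable.mul hk.aestronglyMeasurable) (hk.norm.const_mul M)
    (fun n => Filter.Eventually.of_forall fun z => ?_) ?_
  · rw [norm_mul]
    rcases le_or_gt ‖z‖ R with hz | hz
    · exact mul_le_mul_of_nonneg_right (hb n z hz) (norm_nonneg _)
    · simp [hk0 z hz]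
  · filter_upwards [hlim] with z hz
    exact hz.mul_const _

namespace HasWeakDbar

theorem exists_bounds {F f : ℂ → ℂ} (h : HasWeakDbar F f) (R : ℝ) : ∃ M, ∀ x : ℂ, ‖x‖ ≤ R →
    ∀ y ∈ Metric.ball x 1, ‖F y‖ ≤ M ∧ ‖f y‖ ≤ M := by
  obtain ⟨M, hM⟩ := (isCompact_closedBall (0 : ℂ) (R + 1)).exists_bound_of_continuousOn
    h.continuous.continuousOn
  obtain ⟨N, hN⟩ := h.locallyBounded (R + 1)
  refine ⟨max M N, fun x hx y hy => ?_⟩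
  have hy' : ‖y‖ ≤ R + 1 := by
    have h1 : ‖y - x‖ < 1 := by simpa [dist_eq_norm] using hy
    have h2 := norm_add_le x (y - x)
    rw [add_sub_cancel] at h2
    linarith
  exact ⟨(hM y (by simpa using hy')).trans (le_max_left _ _), (hN y hy').trans (le_max_right _ _)⟩

/-- The Leibniz rule for weak `∂/∂z̄` derivatives of continuous functions. -/
theorem mul {F f G g : ℂ → ℂ} (hF : HasWeakDbar F f) (hG : HasWeakDbar G g) :
    HasWeakDbar (fun z => F z * G z) (fun z => F z * g z + G z * f z) where
  continuous := hF.continuous.mul hG.continuous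
  aestronglyMeasurable :=
    (hF.continuous.aestronglyMeasurable.mul hG.aestronglyMeasurable).add
      (hG.continuous.aestronglyMeasurable.mul hF.aestronglyMeasurable)
  locallyBounded R := by
    obtain ⟨M, hM⟩ := hF.exists_bounds R
    obtain ⟨N, hN⟩ := hG.exists_bounds R
    refine ⟨M * N + N * M, fun z hz => ?_⟩
    obtain ⟨h1, h2⟩ := hM z hz z (Metric.mem_ball_self one_pos)
    obtain ⟨h3, h4⟩ := hN z hz z (Metric.mem_ball_self one_pos)
    have hM0 := (norm_nonneg _).trans h1
    have hN0 := (norm_nonneg _).trans h3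
    refine (norm_add_le _ _).trans ?_
    rw [norm_mul, norm_mul]
    exact add_le_add (mul_le_mul h1 h4 (norm_nonneg _) hM0) (mul_le_mul h3 h2 (norm_nonneg _) hN0)
  integral_mul_dbar φ hφ hc := by
    obtain ⟨A, hAs, hAF, hAf, hAb, hAb'⟩ := hF.exists_approx
    have hφ1 : ContDiff ℝ 1 φ := hφ.of_le (by simp)
    obtain ⟨R, hR0, hR⟩ := (hc.isCompact.isBounded).exists_pos_norm_lt
    have hout : ∀ z : ℂ, R < ‖z‖ → z ∉ tsupport φ := fun z hz hz' => absurd (hR z hz') hz.not_gt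
    obtain ⟨M, hM⟩ := hF.exists_bounds R
    have hA1 : ∀ n, ContDiff ℝ 1 (A n) := fun n => (hAs n).of_le (by simp)
    -- Test the equation of `G` against `A n * φ`, where `A n` approximates `F`.
    have hstep : ∀ n, ∫ z, A n z * (G z * dbar φ z) =
        -((∫ z, A n z * (g z * φ z)) + ∫ z, dbar (A n) z * (G z * φ z)) := by
      intro n
      have h := hG.integral_mul_dbar (fun z => A n z * φ z) ((hAs n).mul hφ) hc.mul_left
      have h2 : ∀ z, G z * dbar (fun w => A n w * φ w) z =
          A n z * (G z * dbar φ z) + dbar (A n) z * (G z * φ z) := fun z => by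
        rw [dbar_mul ((hA1 n).differentiable (by simp) z) (hφ1.differentiable (by simp) z)]; ring
      simp only [h2] at h
      rw [integral_add] at h
      · have h3 : ∫ z, A n z * (g z * φ z) = ∫ z, g z * (A n z * φ z) :=
          integral_congr_ae (Filter.Eventually.of_forall fun z => by ring)
        rw [h3, eq_sub_of_add_eq h]; ring
      · exact ((hA1 n).continuous.mul (hG.continuous.mul
          (continuous_dbar hφ1))).integrable_of_hasCompactSupport
          ((hasCompactSupport_dbar hc).mul_left.mul_left)
      · exact ((continuous_dbar (hA1 n)).mul (hG.continuous.mul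
          hφ.continuous)).integrable_of_hasCompactSupport (hc.mul_left.mul_left)
    have hz : ∀ z, R < ‖z‖ → φ z = 0 := fun z hz => image_eq_zero_of_notMem_tsupport (hout z hz)
    have hz' : ∀ z, R < ‖z‖ → dbar φ z = 0 := fun z hz =>
      dbar_eq_zero_of_notMem_tsupport (hout z hz)
    have hb1 : ∀ n z, ‖z‖ ≤ R → ‖A n z‖ ≤ M := fun n z hz =>
      hAb n z M fun y hy => (hM z hz y hy).1
    have hb2 : ∀ n z, ‖z‖ ≤ R → ‖dbar (A n) z‖ ≤ M := fun n z hz =>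
      hAb' n z M fun y hy => (hM z hz y hy).2
    have hAF' := Filter.Eventually.of_forall (f := ae (volume : Measure ℂ)) hAF
    have l1 := tendsto_integral_mul_of_bounded_on_ball (fun n => (hA1 n).continuous) hb1 hAF'
      (hG.integrable_mul' (continuous_dbar hφ1) (hasCompactSupport_dbar hc))
      (fun z h => by rw [hz' z h, mul_zero])
    have l2 := tendsto_integral_mul_of_bounded_on_ball (fun n => (hA1 n).continuous) hb1 hAF'
      (hG.integrable_mul hφ.continuous hc) (fun z h => by rw [hz z h, mul_zero])
    have l3 := tendsto_integral_mul_of_bounded_on_ball (fun n => continuous_dbar (hA1 n)) hb2 hAf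
      (hG.integrable_mul' hφ.continuous hc) (fun z h => by rw [hz z h, mul_zero])
    simp only [hstep] at l1
    have key := tendsto_nhds_unique l1 (l2.add l3).neg
    have e1 : ∫ z, F z * G z * dbar φ z = ∫ z, F z * (G z * dbar φ z) :=
      integral_congr_ae (Filter.Eventually.of_forall fun z => by ring)
    have e2 : ∫ z, (F z * g z + G z * f z) * φ z =
        (∫ z, F z * (g z * φ z)) + ∫ z, f z * (G z * φ z) := by
      rw [← integral_add]
      · exact integral_congr_ae (Filter.Eventually.of_forall fun z => by ring)
      · have := hG.integrable_mul (hF.continuous.mul hφ.continuous) hc.mul_left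
        exact this.congr (Filter.Eventually.of_forall fun z => by simp only [Pi.mul_apply]; ring)
      · exact hF.integrable_mul (hG.continuous.mul hφ.continuous) hc.mul_left
    rw [e1, e2, key]

/-- The Cauchy–Pompeiu formula for weak derivatives. -/
theorem integral_mul_inv {F f : ℂ → ℂ} (h : HasWeakDbar F f) {R : ℝ}
    (hF0 : ∀ z, R < ‖z‖ → F z = 0) (hf0 : ∀ z, R < ‖z‖ → f z = 0) (a : ℂ) :
    ∫ z, f z * (z - a)⁻¹ = -Real.pi * F a := by
  obtain ⟨A, hAs, hAF, hAf, hAb, hAb'⟩ := h.exists_approx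
  have hA1 : ∀ n, ContDiff ℝ 1 (A n) := fun n => (hAs n).of_le (by simp)
  obtain ⟨M, hM⟩ := h.exists_bounds (R + 1)
  have hfar : ∀ x : ℂ, R + 1 < ‖x‖ → ∀ y ∈ Metric.ball x 1, R < ‖y‖ := by
    intro x hx y hy
    have h1 : ‖x - y‖ < 1 := by simpa [dist_eq_norm, norm_sub_rev] using hy
    have h2 := norm_add_le y (x - y)
    rw [add_sub_cancel] at h2
    linarith
  have hA0 : ∀ n z, R + 1 < ‖z‖ → A n z = 0 := fun n z hz =>
    norm_le_zero_iff.1 (hAb n z 0 fun y hy => by rw [hF0 y (hfar z hz y hy), norm_zero])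
  have hA0' : ∀ n z, R + 1 < ‖z‖ → dbar (A n) z = 0 := fun n z hz =>
    norm_le_zero_iff.1 (hAb' n z 0 fun y hy => by rw [hf0 y (hfar z hz y hy), norm_zero])
  set B := Metric.closedBall (0 : ℂ) (R + 1)
  have hBm : MeasurableSet B := Metric.isClosed_closedBall.measurableSet
  have hki : Integrable (B.indicator fun z => (z - a)⁻¹) := by
    rw [integrable_indicator_iff hBm]
    have := (integrableOn_inv_sub (Metric.isBounded_closedBall (x := (0 : ℂ)) (r := R + 1)) a).neg
    refine this.congr_fun (fun z _ => ?_) hBm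
    rw [Pi.neg_apply, ← inv_neg, neg_sub]
  have hB : ∀ z : ℂ, R + 1 < ‖z‖ → z ∉ B := fun z hz hz' =>
    hz.not_ge (by simpa [B] using hz')
  have l := tendsto_integral_mul_of_bounded_on_ball (R := R + 1) (M := M)
    (fun n => continuous_dbar (hA1 n))
    (fun n z hz => hAb' n z M fun y hy => (hM z hz y hy).2) hAf hki
    (fun z hz => Set.indicator_of_notMem (hB z hz) _)
  have hcut : ∀ u : ℂ → ℂ, (∀ z, R + 1 < ‖z‖ → u z = 0) →
      ∫ z, u z * B.indicator (fun z => (z - a)⁻¹) z = ∫ z, u z * (z - a)⁻¹ := by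
    intro u hu
    refine integral_congr_ae (Filter.Eventually.of_forall fun z => ?_)
    by_cases hz : z ∈ B
    · simp [Set.indicator_of_mem hz]
    · have : R + 1 < ‖z‖ := by simpa [B] using hz
      simp [hu z this]
  rw [hcut f fun z hz => hf0 z (by linarith)] at l
  have hcs : ∀ n, HasCompactSupport (A n) := fun n =>
    HasCompactSupport.intro (isCompact_closedBall (0 : ℂ) (R + 1)) fun z hz =>
      hA0 n z (by simpa using hz)
  simp only [hcut _ (hA0' _), integral_dbar_mul_inv (hA1 _) (hcs _) a] at l
  exact tendsto_nhds_unique l ((hAF a).const_mul _)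

/-- If `F` and `f` vanish off a bounded set, then test functions need not have compact support. -/
theorem integral_mul_dbar_of_contDiff {F f : ℂ → ℂ} (h : HasWeakDbar F f) {R : ℝ}
    (hF0 : ∀ z, R < ‖z‖ → F z = 0) (hf0 : ∀ z, R < ‖z‖ → f z = 0) {φ : ℂ → ℂ}
    (hφ : ContDiff ℝ ∞ φ) : ∫ z, F z * dbar φ z = -∫ z, f z * φ z := by
  let b : ContDiffBump (0 : ℂ) := ⟨|R| + 1, |R| + 2, by positivity, by linarith⟩
  have hb1 : ∀ z : ℂ, ‖z‖ ≤ R → ∀ᶠ w in nhds z, (b w : ℂ) * φ w = φ w := by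
    intro z hz
    have : Metric.ball (0 : ℂ) (|R| + 1) ∈ nhds z := by
      refine Metric.isOpen_ball.mem_nhds ?_
      rw [mem_ball_zero_iff]; linarith [le_abs_self R]
    filter_upwards [this] with w hw
    rw [b.one_of_mem_closedBall (Metric.ball_subset_closedBall hw), Complex.ofReal_one, one_mul]
  have hs : ContDiff ℝ ∞ (fun w => (b w : ℂ) * φ w) :=
    (Complex.ofRealCLM.contDiff.comp b.contDiff).mul hφ
  have hc : HasCompactSupport (fun w => (b w : ℂ) * φ w) :=
    (b.hasCompactSupport.comp_left Complex.ofReal_zero).mul_right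
  have key := h.integral_mul_dbar _ hs hc
  have e1 : ∀ z, F z * dbar (fun w => (b w : ℂ) * φ w) z = F z * dbar φ z := fun z => by
    rcases le_or_gt ‖z‖ R with hz | hz
    · rw [dbar, dbar, Filter.EventuallyEq.fderiv_eq (hb1 z hz)]
    · rw [hF0 z hz, zero_mul, zero_mul]
  have e2 : ∀ z, f z * ((b z : ℂ) * φ z) = f z * φ z := fun z => by
    rcases le_or_gt ‖z‖ R with hz | hz
    · rw [(hb1 z hz).self_of_nhds]
    · rw [hf0 z hz, zero_mul, zero_mul]
  simpa only [e1, e2] using key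

end HasWeakDbar

/-- The Cauchy transform solves `∂C/∂z̄ = χ_D`. -/
theorem hasWeakDbar_cauchyTransform {D : Set ℂ} (hm : MeasurableSet D)
    (hD : Bornology.IsBounded D) : HasWeakDbar (cauchyTransform D) (D.indicator 1) where
  continuous := continuous_cauchyTransform hD
  aestronglyMeasurable := (measurable_one.indicator hm).aestronglyMeasurable
  locallyBounded R := ⟨1, fun z _ => by
    by_cases hz : z ∈ D
    · simp [Set.indicator_of_mem hz]
    · simp [Set.indicator_of_notMem hz]⟩
  integral_mul_dbar φ hφ hc := by
    have hφ1 : ContDiff ℝ 1 φ := hφ.of_le (by simp)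
    have h := integral_mul_cauchyTransform (E := tsupport φ) hc.isCompact.isBounded hD
      (continuous_dbar hφ1)
    have hz : ∀ z, z ∉ tsupport φ → dbar φ z = 0 := fun z => dbar_eq_zero_of_notMem_tsupport
    have e1 : ∫ z in tsupport φ, dbar φ z * cauchyTransform D z =
        ∫ z, cauchyTransform D z * dbar φ z := by
      rw [setIntegral_eq_integral_of_forall_compl_eq_zero fun z h => by rw [hz z h, zero_mul]]
      exact integral_congr_ae (Filter.Eventually.of_forall fun z => mul_comm _ _)
    have e2 : ∀ ξ, ∫ z in tsupport φ, dbar φ z * (z - ξ)⁻¹ = -Real.pi * φ ξ := fun ξ => by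
      rw [setIntegral_eq_integral_of_forall_compl_eq_zero fun z h => by rw [hz z h, zero_mul],
        integral_dbar_mul_inv hφ1 hc]
    rw [e1] at h
    simp only [e2] at h
    rw [h, integral_const_mul, ← integral_indicator hm]
    have e3 : ∀ z, D.indicator (1 : ℂ → ℂ) z * φ z = D.indicator φ z := fun z => by
      by_cases hz : z ∈ D <;> simp [hz]
    simp only [e3]
    have hpi : (Real.pi : ℂ) ≠ 0 := by exact_mod_cast Real.pi_ne_zero
    field_simp

end WeakDbar

/-! ### Cauchy integrals over discs -/

/-- The integral of a function on the circle `|w| = ρ` in terms of a contour integral. -/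
theorem integral_circle_eq {ρ : ℝ} (hρ : ρ ≠ 0) (g : ℂ → ℂ) :
    ∫ θ in Set.Ioo (-Real.pi) Real.pi, g (ρ * Complex.exp (θ * Complex.I)) =
      (Complex.I)⁻¹ * ∮ w in C(0, ρ), w⁻¹ * g w := by
  have hper : Function.Periodic (fun θ : ℝ => g (ρ * Complex.exp (θ * Complex.I)))
      (2 * Real.pi) := fun θ => by
    simp only
    rw [Complex.ofReal_add, add_mul, Complex.exp_add]
    push_cast
    rw [Complex.exp_two_pi_mul_I, mul_one]
  rw [← integral_Ioc_eq_integral_Ioo, ← intervalIntegral.integral_of_le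
    (by linarith [Real.pi_pos]), circleIntegral]
  have h1 : ∀ θ : ℝ, deriv (circleMap 0 ρ) θ • ((circleMap 0 ρ θ)⁻¹ * g (circleMap 0 ρ θ)) =
      Complex.I * g (ρ * Complex.exp (θ * Complex.I)) := fun θ => by
    have h0 : circleMap 0 ρ θ ≠ 0 := circleMap_ne_center hρ
    rw [deriv_circleMap, smul_eq_mul]
    have h2 : circleMap 0 ρ θ = ρ * Complex.exp (θ * Complex.I) := by simp [circleMap]
    rw [← h2]
    field_simp
  simp only [h1]
  rw [intervalIntegral.integral_const_mul, ← mul_assoc, inv_mul_cancel₀ Complex.I_ne_zero, one_mul]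
  have := hper.intervalIntegral_add_eq (-Real.pi) 0
  rw [zero_add, show -Real.pi + 2 * Real.pi = Real.pi by ring] at this
  exact this

/-- On the circle `|w| = ρ` one has `conj w = ρ ^ 2 / w`, so that the conjugate of the
integrand is meromorphic with its only pole at `ρ ^ 2 / conj η`. -/
theorem integral_circle_conj_pow_mul_inv (n : ℕ) {ρ : ℝ} (hρ : 0 < ρ) {η : ℂ} (hη : ρ ≠ ‖η‖) :
    ∫ θ in Set.Ioo (-Real.pi) Real.pi,
        (starRingEnd ℂ) (ρ * Complex.exp (θ * Complex.I)) ^ n *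
          (ρ * Complex.exp (θ * Complex.I) - η)⁻¹ =
      if ρ < ‖η‖ then -2 * Real.pi * ρ ^ (2 * n) / η ^ (n + 1) else 0 := by
  have hρ0 : (ρ : ℂ) ≠ 0 := by exact_mod_cast hρ.ne'
  set η' := (starRingEnd ℂ) η with hη'
  have hn' : ‖η'‖ = ‖η‖ := RCLike.norm_conj η
  have hconj : ∫ θ in Set.Ioo (-Real.pi) Real.pi,
        (starRingEnd ℂ) (ρ * Complex.exp (θ * Complex.I)) ^ n *
          (ρ * Complex.exp (θ * Complex.I) - η)⁻¹ = (starRingEnd ℂ)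
      (∫ θ in Set.Ioo (-Real.pi) Real.pi, (ρ * Complex.exp (θ * Complex.I)) ^ n *
        ((starRingEnd ℂ) (ρ * Complex.exp (θ * Complex.I)) - η')⁻¹) := by
    rw [← integral_conj]
    simp [hη']
  have hcirc : (∮ w in C(0, ρ), w⁻¹ * (w ^ n * ((starRingEnd ℂ) w - η')⁻¹)) =
      ∮ w in C(0, ρ), w ^ n * ((ρ : ℂ) ^ 2 - η' * w)⁻¹ := by
    refine circleIntegral.integral_congr hρ.le fun w hw => ?_
    have hwn : ‖w‖ = ρ := by simpa using hw
    have hw0 : w ≠ 0 := by rw [← norm_pos_iff, hwn]; exact hρ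
    have h1 : w * ((starRingEnd ℂ) w - η') = (ρ : ℂ) ^ 2 - η' * w := by
      rw [mul_sub, Complex.mul_conj', hwn]; ring
    rw [← h1, mul_inv]; ring
  have hI := integral_circle_eq hρ.ne' (fun w : ℂ => w ^ n * ((starRingEnd ℂ) w - η')⁻¹)
  beta_reduce at hI
  rw [hconj, hI, hcirc]
  split_ifs with h
  · have hη0 : η' ≠ 0 := by
      rw [← norm_pos_iff, hn']; linarith
    set w₀ : ℂ := (ρ : ℂ) ^ 2 / η' with hw₀
    have hw₀b : w₀ ∈ Metric.ball (0 : ℂ) ρ := by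
      rw [mem_ball_zero_iff, hw₀, norm_div, norm_pow, Complex.norm_real,
        Real.norm_of_nonneg hρ.le, hn', div_lt_iff₀ (hρ.trans h)]
      nlinarith
    have hpow : DiffContOnCl ℂ (fun w : ℂ => w ^ n) (Metric.ball 0 ρ) :=
      (by fun_prop : Differentiable ℂ (fun w : ℂ => w ^ n)).diffContOnCl
    have hcau := hpow.circleIntegral_sub_inv_smul hw₀b
    have h2 : (∮ w in C(0, ρ), w ^ n * ((ρ : ℂ) ^ 2 - η' * w)⁻¹) =
        ∮ w in C(0, ρ), (-η'⁻¹) * ((w - w₀)⁻¹ • w ^ n) := by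
      refine circleIntegral.integral_congr hρ.le fun w hw => ?_
      have h3 : (ρ : ℂ) ^ 2 - η' * w = -η' * (w - w₀) := by rw [hw₀]; field_simp; ring
      simp only [h3, mul_inv, smul_eq_mul]
      rw [inv_neg]; ring
    rw [h2, circleIntegral.integral_const_mul, hcau]
    simp only [smul_eq_mul, map_mul, map_inv₀, map_neg, hw₀, map_pow, map_div₀,
      Complex.conj_ofReal, hη', Complex.conj_conj, Complex.conj_I, map_ofNat, div_pow, pow_mul]
    have hη00 : η ≠ 0 := by rw [← norm_pos_iff]; linarith
    have := Complex.I_ne_zero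
    field_simp
    ring
  · have hlt : ‖η‖ < ρ := lt_of_le_of_ne (not_lt.1 h) (Ne.symm hη)
    have hd : ∀ w ∈ Metric.closedBall (0 : ℂ) ρ, (ρ : ℂ) ^ 2 - η' * w ≠ 0 := by
      intro w hw h0
      have hw' : ‖w‖ ≤ ρ := by simpa using hw
      have h1 : ‖η' * w‖ = ρ ^ 2 := by
        rw [← sub_eq_zero.1 h0, norm_pow, Complex.norm_real, Real.norm_of_nonneg hρ.le]
      rw [norm_mul, hn'] at h1
      nlinarith [norm_nonneg η, norm_nonneg w]
    have hdo : DifferentiableOn ℂ (fun w : ℂ => w ^ n * ((ρ : ℂ) ^ 2 - η' * w)⁻¹)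
        (Metric.closedBall 0 ρ) := by
      intro w hw
      have := hd w hw
      exact (by fun_prop (disch := assumption) : DifferentiableAt ℂ
        (fun w : ℂ => w ^ n * ((ρ : ℂ) ^ 2 - η' * w)⁻¹) w).differentiableWithinAt
    rw [(hdo.diffContOnCl_ball subset_rfl).circleIntegral_eq_zero hρ.le, mul_zero, map_zero]

/-- The Cauchy integral of `conj w ^ n` over a disc centred at `0`, in one formula for points
inside and outside the disc (at `η = 0` both sides vanish). -/
theorem integral_ball_zero_conj_pow_mul_inv (n : ℕ) {R : ℝ} (hR : 0 < R) (η : ℂ) :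
    ∫ w in Metric.ball (0 : ℂ) R, (starRingEnd ℂ) w ^ n * (w - η)⁻¹ =
      -Real.pi * (min R ‖η‖) ^ (2 * n + 2) / ((n + 1) * η ^ (n + 1)) := by
  set B := Metric.ball (0 : ℂ) R with hB
  have hBm : MeasurableSet B := Metric.isOpen_ball.measurableSet
  set f : ℂ → ℂ := fun w => (starRingEnd ℂ) w ^ n * (w - η)⁻¹ with hf
  have hfm : Measurable f :=
    (Complex.continuous_conj.pow n).measurable.mul (measurable_id.sub_const η).inv
  have hfi : IntegrableOn f B := by
    have h1 := ((integrableOn_inv_sub (Metric.isBounded_closedBall (x := (0 : ℂ)) (r := R))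
      η).neg).continuousOn_mul (Complex.continuous_conj.pow n).continuousOn
      (isCompact_closedBall (0 : ℂ) R)
    refine IntegrableOn.mono_set (h1.congr_fun (fun w _ => ?_)
      Metric.isClosed_closedBall.measurableSet) Metric.ball_subset_closedBall
    simp only [hf, Pi.neg_apply]
    rw [← inv_neg, neg_sub]
    rfl
  set m := min R ‖η‖ with hm
  have hm0 : 0 ≤ m := le_min hR.le (norm_nonneg _)
  set c : ℂ := -2 * Real.pi / η ^ (n + 1) with hc
  rw [← integral_indicator hBm, integral_eq_integral_polar
    ((integrable_indicator_iff hBm).2 hfi) (hfm.indicator hBm)]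
  have hinner : ∀ᵐ r : ℝ ∂(volume.restrict (Set.Ioi 0)), ∫ θ in Set.Ioo (-Real.pi) Real.pi,
      (r : ℂ) * B.indicator f (r * Complex.exp (θ * Complex.I)) =
      (Set.Ioo 0 m).indicator (fun r : ℝ => c * ((r ^ (2 * n + 1) : ℝ) : ℂ)) r := by
    filter_upwards [ae_restrict_mem measurableSet_Ioi,
      ae_restrict_of_ae (Measure.ae_ne volume ‖η‖)] with r hr hrη
    have hr0 : 0 < r := hr
    have hnorm : ∀ θ : ℝ, ‖(r : ℂ) * Complex.exp (θ * Complex.I)‖ = r := fun θ => by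
      rw [norm_mul, Complex.norm_exp_ofReal_mul_I, mul_one, Complex.norm_real,
        Real.norm_of_nonneg hr0.le]
    by_cases hrR : r < R
    · have h1 : ∀ θ : ℝ, B.indicator f (r * Complex.exp (θ * Complex.I)) =
          (starRingEnd ℂ) (r * Complex.exp (θ * Complex.I)) ^ n *
            (r * Complex.exp (θ * Complex.I) - η)⁻¹ := fun θ =>
        Set.indicator_of_mem (by rw [hB, mem_ball_zero_iff, hnorm]; exact hrR) _
      simp only [h1]
      rw [integral_const_mul, integral_circle_conj_pow_mul_inv n hr0 hrη]
      by_cases hlt : r < ‖η‖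
      · rw [if_pos hlt, Set.indicator_of_mem (show r ∈ Set.Ioo 0 m from ⟨hr0, lt_min hrR hlt⟩), hc]
        push_cast; ring
      · rw [if_neg hlt, Set.indicator_of_notMem fun h => hlt (h.2.trans_le (min_le_right _ _)),
          mul_zero]
    · have h1 : ∀ θ : ℝ, B.indicator f (r * Complex.exp (θ * Complex.I)) = 0 := fun θ =>
        Set.indicator_of_notMem (by rw [hB, mem_ball_zero_iff, hnorm]; exact hrR) _
      simp only [h1, mul_zero, integral_zero]
      rw [Set.indicator_of_notMem fun h => hrR (h.2.trans_le (min_le_left _ _))]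
  rw [integral_congr_ae hinner, setIntegral_indicator measurableSet_Ioo,
    Set.inter_eq_right.2 Set.Ioo_subset_Ioi_self, integral_const_mul, integral_complex_ofReal,
    ← integral_Ioc_eq_integral_Ioo, ← intervalIntegral.integral_of_le hm0, integral_pow, hc]
  have hn : (n : ℂ) + 1 ≠ 0 := by exact_mod_cast n.succ_ne_zero
  rcases eq_or_ne η 0 with rfl | hη
  · simp [hm, hR.le]
  · push_cast
    have : (2 * (n : ℂ) + 1 + 1) = 2 * (n + 1) := by ring
    rw [this]
    field_simp
    ring

/-- The Cauchy integral of `conj (z - a) ^ n` over a disc. -/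
theorem integral_ball_conj_pow_mul_inv (n : ℕ) {R : ℝ} (hR : 0 < R) (a ξ : ℂ) :
    ∫ z in Metric.ball a R, (starRingEnd ℂ) (z - a) ^ n * (z - ξ)⁻¹ =
      -Real.pi * (min R ‖ξ - a‖) ^ (2 * n + 2) / ((n + 1) * (ξ - a) ^ (n + 1)) := by
  rw [← integral_ball_zero_conj_pow_mul_inv n hR (ξ - a)]
  have hpre : (fun z => z - a) ⁻¹' Metric.ball (0 : ℂ) R = Metric.ball a R := by
    ext z; simp [dist_eq_norm]
  have h := (measurePreserving_sub_right volume a).setIntegral_preimage_emb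
    (Homeomorph.subRight a).measurableEmbedding
    (fun w => (starRingEnd ℂ) w ^ n * (w - (ξ - a))⁻¹) (Metric.ball 0 R)
  rw [hpre] at h
  rw [← h]
  simp only [sub_sub_sub_cancel_right]

theorem integral_ball_conj_pow_mul_inv_of_mem (n : ℕ) {R : ℝ} (hR : 0 < R) {a ξ : ℂ}
    (hξ : ξ ∈ Metric.ball a R) :
    ∫ z in Metric.ball a R, (starRingEnd ℂ) (z - a) ^ n * (z - ξ)⁻¹ =
      -Real.pi / (n + 1) * (starRingEnd ℂ) (ξ - a) ^ (n + 1) := by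
  have h1 : ‖ξ - a‖ < R := by simpa [dist_eq_norm] using hξ
  rw [integral_ball_conj_pow_mul_inv n hR, min_eq_right h1.le]
  rcases eq_or_ne (ξ - a) 0 with h | h
  · simp [h]
  · have h2 : ((‖ξ - a‖ : ℝ) : ℂ) ^ (2 * n + 2) =
        (ξ - a) ^ (n + 1) * (starRingEnd ℂ) (ξ - a) ^ (n + 1) := by
      rw [← mul_pow, Complex.mul_conj', ← pow_mul]; ring_nf
    have hn : (n : ℂ) + 1 ≠ 0 := by exact_mod_cast n.succ_ne_zero
    rw [h2]
    field_simp

theorem integral_ball_conj_pow_mul_inv_of_notMem (n : ℕ) {R : ℝ} (hR : 0 < R) {a ξ : ℂ}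
    (hξ : ξ ∉ Metric.ball a R) :
    ∫ z in Metric.ball a R, (starRingEnd ℂ) (z - a) ^ n * (z - ξ)⁻¹ =
      -Real.pi * R ^ (2 * n + 2) / (n + 1) * ((ξ - a) ^ (n + 1))⁻¹ := by
  have h1 : R ≤ ‖ξ - a‖ := by simpa [dist_eq_norm] using hξ
  rw [integral_ball_conj_pow_mul_inv n hR, min_eq_left h1]
  rw [div_mul_eq_div_div, div_eq_mul_inv _ ((ξ - a) ^ (n + 1))]

/-- The Cauchy transform of a disc, inside the disc. -/
theorem cauchyTransform_ball_of_mem {R : ℝ} (hR : 0 < R) {a z : ℂ} (hz : z ∈ Metric.ball a R) :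
    cauchyTransform (Metric.ball a R) z = (starRingEnd ℂ) (z - a) := by
  have h := integral_ball_conj_pow_mul_inv_of_mem 0 hR hz
  have hpi : (Real.pi : ℂ) ≠ 0 := by exact_mod_cast Real.pi_ne_zero
  have h2 : ∫ ξ in Metric.ball a R, (z - ξ)⁻¹ = -∫ ξ in Metric.ball a R, (ξ - z)⁻¹ := by
    rw [← integral_neg]
    refine integral_congr_ae (Filter.Eventually.of_forall fun ξ => ?_)
    simp only
    rw [← inv_neg, neg_sub]
  simp only [pow_zero, one_mul] at h
  rw [cauchyTransform, h2, h]
  field_simp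
  simp

/-- The Cauchy transform of a disc, outside the disc. -/
theorem cauchyTransform_ball_of_notMem {R : ℝ} (hR : 0 < R) {a z : ℂ}
    (hz : z ∉ Metric.ball a R) : cauchyTransform (Metric.ball a R) z = R ^ 2 * (z - a)⁻¹ := by
  have h := integral_ball_conj_pow_mul_inv_of_notMem 0 hR hz
  have hpi : (Real.pi : ℂ) ≠ 0 := by exact_mod_cast Real.pi_ne_zero
  have h2 : ∫ ξ in Metric.ball a R, (z - ξ)⁻¹ = -∫ ξ in Metric.ball a R, (ξ - z)⁻¹ := by
    rw [← integral_neg]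
    refine integral_congr_ae (Filter.Eventually.of_forall fun ξ => ?_)
    simp only
    rw [← inv_neg, neg_sub]
  simp only [pow_zero, one_mul] at h
  rw [cauchyTransform, h2, h]
  simp; field_simp

/-- Rotation about `a` by a unit complex number. -/
noncomputable def rotateAbout (a : ℂ) (u : Circle) (z : ℂ) : ℂ := a + u * (z - a)

theorem rotateAbout_sub (a : ℂ) (u : Circle) (z : ℂ) : rotateAbout a u z - a = u * (z - a) := by
  rw [rotateAbout, add_sub_cancel_left]

theorem measurePreserving_rotateAbout (a : ℂ) (u : Circle) :
    MeasurePreserving (rotateAbout a u) := by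
  have h := (measurePreserving_add_left volume a).comp
    ((rotation u).measurePreserving.comp (measurePreserving_sub_right volume a))
  exact h

theorem rotateAbout_inv_rotateAbout (a : ℂ) (u : Circle) (z : ℂ) :
    rotateAbout a u⁻¹ (rotateAbout a u z) = z := by
  simp [rotateAbout]

theorem continuous_rotateAbout (a : ℂ) (u : Circle) : Continuous (rotateAbout a u) := by
  unfold rotateAbout; fun_prop

theorem measurableEmbedding_rotateAbout (a : ℂ) (u : Circle) :
    MeasurableEmbedding (rotateAbout a u) := by
  let e : ℂ ≃ₜ ℂ := ⟨⟨rotateAbout a u, rotateAbout a u⁻¹, rotateAbout_inv_rotateAbout a u,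
    fun z => by simpa using rotateAbout_inv_rotateAbout a u⁻¹ z⟩, continuous_rotateAbout a u,
    continuous_rotateAbout a u⁻¹⟩
  exact e.measurableEmbedding

/-- Powers of `conj (z - a)` have mean zero on discs centred at `a`. -/
theorem integral_ball_conj_pow {n : ℕ} (hn : n ≠ 0) (a : ℂ) (R : ℝ) :
    ∫ z in Metric.ball a R, (starRingEnd ℂ) (z - a) ^ n = 0 := by
  -- Rotating by `π / n` changes the sign of the integral.
  set u : Circle := Circle.exp (Real.pi / n) with hu
  have hpre : rotateAbout a u ⁻¹' Metric.ball a R = Metric.ball a R := by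
    ext z
    rw [Set.mem_preimage, Metric.mem_ball, Metric.mem_ball, dist_eq_norm, rotateAbout_sub, norm_mul,
      Circle.norm_coe, one_mul, dist_eq_norm]
  have h := (measurePreserving_rotateAbout a u).setIntegral_preimage_emb
    (measurableEmbedding_rotateAbout a u) (fun z => (starRingEnd ℂ) (z - a) ^ n) (Metric.ball a R)
  have hun : (starRingEnd ℂ) (u : ℂ) ^ n = -1 := by
    rw [← map_pow, hu, Circle.coe_exp, ← Complex.exp_nat_mul]
    have : (n : ℂ) * (((Real.pi / n : ℝ) : ℂ) * Complex.I) = Real.pi * Complex.I := by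
      have : (n : ℂ) ≠ 0 := by exact_mod_cast hn
      push_cast; field_simp
    rw [this, Complex.exp_pi_mul_I]; simp
  rw [hpre] at h
  simp only [rotateAbout_sub, map_mul, mul_pow, hun] at h
  rw [integral_const_mul] at h
  have h2 : (2 : ℂ) * ∫ z in Metric.ball a R, (starRingEnd ℂ) (z - a) ^ n = 0 := by
    linear_combination -h
  simpa using h2

/-! ### Holomorphy of Cauchy transforms -/

/-- The Cauchy transform of `D` is holomorphic off `D`. -/
theorem differentiableOn_cauchyTransform {D O : Set ℂ} (hD : Bornology.IsBounded D)
    (hm : MeasurableSet D) (hO : IsOpen O) (hdisj : Disjoint O D) :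
    DifferentiableOn ℂ (cauchyTransform D) O := by
  have hfin : IsFiniteMeasure (volume.restrict D) := ⟨by
    rw [Measure.restrict_apply_univ]; exact hD.measure_lt_top⟩
  intro z hz
  obtain ⟨ε, hε, hball⟩ := Metric.isOpen_iff.1 hO z hz
  have hfar : ∀ w ∈ Metric.ball z (ε / 2), ∀ ξ ∈ D, ε / 2 ≤ ‖w - ξ‖ := by
    intro w hw ξ hξ
    have h1 : ε ≤ dist ξ z := by
      by_contra hlt
      exact Set.disjoint_left.1 hdisj (hball (not_le.1 hlt)) hξ
    have h2 := dist_triangle ξ w z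
    rw [dist_comm ξ w, dist_eq_norm w ξ] at h2
    have h3 : dist w z < ε / 2 := hw
    linarith
  have hder := hasDerivAt_integral_of_dominated_loc_of_deriv_le
    (μ := volume.restrict D) (F := fun w ξ : ℂ => (w - ξ)⁻¹)
    (F' := fun w ξ : ℂ => -((w - ξ) ^ 2)⁻¹) (x₀ := z) (s := Metric.ball z (ε / 2))
    (bound := fun _ => ((ε / 2) ^ 2)⁻¹) (Metric.ball_mem_nhds z (by positivity))
    (Filter.Eventually.of_forall fun w =>
      ((measurable_const.sub measurable_id).inv).aestronglyMeasurable)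
    (integrableOn_inv_sub hD z)
    ((((measurable_const.sub measurable_id).pow_const 2).inv.neg).aestronglyMeasurable)
    (by
      filter_upwards [ae_restrict_mem hm] with ξ hξ w hw
      have := hfar w hw ξ hξ
      rw [norm_neg, norm_inv, norm_pow]
      gcongr)
    (integrable_const _)
    (by
      filter_upwards [ae_restrict_mem hm] with ξ hξ w hw
      have h1 := hfar w hw ξ hξ
      have h2 : w - ξ ≠ 0 := by rw [← norm_pos_iff]; linarith
      refine HasDerivAt.congr_deriv (((hasDerivAt_id w).sub_const ξ).inv h2) ?_
      simp [neg_div])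
  exact ((hder.2.const_mul _).differentiableAt).differentiableWithinAt

theorem cauchyTransform_union {A B : Set ℂ} (hA : Bornology.IsBounded A)
    (hB : Bornology.IsBounded B) (hBm : MeasurableSet B) (hd : Disjoint A B) (z : ℂ) :
    cauchyTransform (A ∪ B) z = cauchyTransform A z + cauchyTransform B z := by
  simp only [cauchyTransform]
  rw [setIntegral_union hd hBm (integrableOn_inv_sub hA z) (integrableOn_inv_sub hB z)]
  ring

theorem cauchyTransform_diff_add {A B : Set ℂ} (hA : Bornology.IsBounded A)
    (hBm : MeasurableSet B) (hBA : B ⊆ A) (z : ℂ) :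
    cauchyTransform A z = cauchyTransform (A \ B) z + cauchyTransform B z := by
  rw [← cauchyTransform_union (hA.subset Set.sdiff_subset) (hA.subset hBA) hBm
    Set.disjoint_sdiff_left, Set.sdiff_union_of_subset hBA]

/-- In `D` the Cauchy transform differs from `conj z` by a holomorphic function. -/
theorem differentiableOn_cauchyTransform_sub_conj {D : Set ℂ} (hD : Bornology.IsBounded D)
    (hDo : IsOpen D) :
    DifferentiableOn ℂ (fun z => cauchyTransform D z - (starRingEnd ℂ) z) D := by
  intro z hz
  obtain ⟨ε, hε, hball⟩ := Metric.isOpen_iff.1 hDo z hz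
  have hd : DifferentiableOn ℂ (cauchyTransform (D \ Metric.ball z ε)) (Metric.ball z ε) :=
    differentiableOn_cauchyTransform (hD.subset Set.sdiff_subset)
      (hDo.measurableSet.diff Metric.isOpen_ball.measurableSet) Metric.isOpen_ball
      Set.disjoint_sdiff_right
  have hnhd := Metric.ball_mem_nhds z hε
  have h1 := ((hd z (Metric.mem_ball_self hε)).differentiableAt hnhd).sub_const
    ((starRingEnd ℂ) z)
  refine (h1.congr_of_eventuallyEq ?_).differentiableWithinAt
  filter_upwards [hnhd] with w hw
  rw [cauchyTransform_diff_add hD Metric.isOpen_ball.measurableSet hball,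
    cauchyTransform_ball_of_mem hε hw, map_sub]
  ring

/-! ### Domains on which a circular flow is tangential are discs -/

section CircularFlow

open scoped ContDiff

theorem fderiv_comp_rotateAbout {g : ℂ → ℝ} (hgd : Differentiable ℝ g) (a : ℂ) (u : Circle)
    (z v : ℂ) : fderiv ℝ (fun w => g (rotateAbout a u w)) z v =
      fderiv ℝ g (rotateAbout a u z) (u * v) := by
  have h1 : HasFDerivAt (rotateAbout a u)
      (((u : ℂ) • ContinuousLinearMap.id ℂ ℂ).restrictScalars ℝ) z := by
    have : HasFDerivAt (rotateAbout a u) ((u : ℂ) • ContinuousLinearMap.id ℂ ℂ) z :=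
      (((hasFDerivAt_id (𝕜 := ℂ) z).sub_const a).const_smul (u : ℂ)).const_add a
    exact this.restrictScalars ℝ
  have h2 : HasFDerivAt (fun w => g (rotateAbout a u w)) _ z :=
    (hgd (rotateAbout a u z)).hasFDerivAt.comp z h1
  rw [h2.fderiv]
  rfl

/-- The angular derivative of a rotated function. -/
theorem hasDerivAt_comp_rotateAbout_exp {g : ℂ → ℝ} (hgd : Differentiable ℝ g) (a z : ℂ) (t : ℝ) :
    HasDerivAt (fun t : ℝ => g (rotateAbout a (Circle.exp (-t)) z))
      (-fderiv ℝ (fun w => g (rotateAbout a (Circle.exp (-t)) w)) z (Complex.I * (z - a))) t := by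
  have h1 : HasDerivAt (fun t : ℝ => rotateAbout a (Circle.exp (-t)) z)
      (-(Circle.exp (-t) * (Complex.I * (z - a)))) t := by
    have h2 : HasDerivAt (fun t : ℝ => Complex.exp (((-t : ℝ) : ℂ) * Complex.I))
        (Complex.exp (((-t : ℝ) : ℂ) * Complex.I) * (-1 * Complex.I)) t := by
      have h3 : HasDerivAt (fun t : ℝ => ((-t : ℝ) : ℂ)) (-1) t := by
        simpa using (hasDerivAt_neg t).ofReal_comp
      exact (h3.mul_const Complex.I).cexp
    have h4 := (h2.mul_const (z - a)).const_add a
    simp only [rotateAbout, Circle.coe_exp]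
    refine h4.congr_deriv ?_
    ring
  have h5 := (hgd (rotateAbout a (Circle.exp (-t)) z)).hasFDerivAt.comp_hasDerivAt t h1
  refine h5.congr_deriv ?_
  rw [fderiv_comp_rotateAbout hgd, map_neg]

/-- If `D` carries no flux of the circular field `q(|z - a|) i (z - a)`, then integrals over `D`
with the weight `q(|z - a|)` do not change when the integrand is rotated about `a`. -/
theorem integral_comp_rotateAbout_eq {D : Set ℂ} (hb : Bornology.IsBounded D) (hm : MeasurableSet D)
    {a : ℂ} {q : ℝ → ℝ} (hq : Continuous q)
    (hid : ∀ g : ℂ → ℝ, ContDiff ℝ ∞ g → HasCompactSupport g →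
      ∫ z in D, q ‖z - a‖ * fderiv ℝ g z (Complex.I * (z - a)) = 0)
    {g : ℂ → ℝ} (hg : ContDiff ℝ ∞ g) (hgc : HasCompactSupport g) (t : ℝ) :
    ∫ z in D, q ‖z - a‖ * g (rotateAbout a (Circle.exp (-t)) z) = ∫ z in D, q ‖z - a‖ * g z := by
  have hfin : IsFiniteMeasure (volume.restrict D) := ⟨by
    rw [Measure.restrict_apply_univ]; exact hb.measure_lt_top⟩
  have hg1 : ContDiff ℝ 1 g := hg.of_le (by simp)
  have hgd : Differentiable ℝ g := hg1.differentiable (by simp)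
  have hrs : ∀ t : ℝ, ContDiff ℝ ∞ (rotateAbout a (Circle.exp (-t))) := fun t =>
    contDiff_const.add (contDiff_const.mul (contDiff_id.sub contDiff_const))
  have hgs : ∀ t : ℝ, ContDiff ℝ ∞ (fun z => g (rotateAbout a (Circle.exp (-t)) z)) := fun t =>
    hg.comp (hrs t)
  have hgcs : ∀ t : ℝ, HasCompactSupport (fun z => g (rotateAbout a (Circle.exp (-t)) z)) := by
    intro t
    let e : ℂ ≃ₜ ℂ := ⟨⟨rotateAbout a (Circle.exp (-t)), rotateAbout a (Circle.exp (-t))⁻¹,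
      rotateAbout_inv_rotateAbout a _,
      fun z => by simpa using rotateAbout_inv_rotateAbout a (Circle.exp (-t))⁻¹ z⟩,
      continuous_rotateAbout a _, continuous_rotateAbout a _⟩
    exact hgc.comp_homeomorph e
  have hqc : Continuous fun z : ℂ => q ‖z - a‖ := by fun_prop
  set K := closure D with hK
  have hKc : IsCompact K := hb.isCompact_closure
  obtain ⟨M, hM⟩ := hKc.exists_bound_of_continuousOn hqc.continuousOn
  obtain ⟨N, hN⟩ := hKc.exists_bound_of_continuousOn
    (by fun_prop : Continuous fun z : ℂ => z - a).continuousOn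
  obtain ⟨C, hC⟩ := (hgc.fderiv ℝ).exists_bound_of_continuous (hg1.continuous_fderiv (by simp))
  have hder : ∀ t : ℝ, HasDerivAt
      (fun t : ℝ => ∫ z in D, q ‖z - a‖ * g (rotateAbout a (Circle.exp (-t)) z)) 0 t := by
    intro t
    have h := hasDerivAt_integral_of_dominated_loc_of_deriv_le
      (μ := volume.restrict D) (x₀ := t) (s := Set.univ)
      (F := fun t z => q ‖z - a‖ * g (rotateAbout a (Circle.exp (-t)) z))
      (F' := fun t z => q ‖z - a‖ * -fderiv ℝ (fun w => g (rotateAbout a (Circle.exp (-t)) w)) z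
        (Complex.I * (z - a)))
      (bound := fun _ => M * (C * N)) Filter.univ_mem
      (Filter.Eventually.of_forall fun t =>
        (hqc.mul (hgs t).continuous).aestronglyMeasurable)
      (((hqc.mul (hgs t).continuous).continuousOn.integrableOn_compact hKc).mono_set
        subset_closure)
      (hqc.mul ((((hgs t).of_le (by simp) : ContDiff ℝ 1 _).continuous_fderiv
        (by simp)).clm_apply (by fun_prop)).neg).aestronglyMeasurable
      (by
        filter_upwards [ae_restrict_mem hm] with z hz t _
        have hzK : z ∈ K := subset_closure hz
        rw [norm_mul, norm_neg, fderiv_comp_rotateAbout hgd]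
        refine mul_le_mul (hM z hzK) ?_ (norm_nonneg _) ((norm_nonneg _).trans (hM z hzK))
        refine (ContinuousLinearMap.le_opNorm _ _).trans ?_
        refine mul_le_mul (hC _) ?_ (norm_nonneg _) ((norm_nonneg _).trans (hC 0))
        rw [norm_mul, norm_mul, Circle.norm_coe, Complex.norm_I, one_mul, one_mul]
        exact hN z hzK)
      (integrable_const _)
      (Filter.Eventually.of_forall fun z t _ =>
        (hasDerivAt_comp_rotateAbout_exp hgd a z t).const_mul _)
    refine h.2.congr_deriv ?_
    simp only [mul_neg]
    rw [integral_neg, hid _ (hgs t) (hgcs t), neg_zero]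
  have hconst := is_const_of_deriv_eq_zero (fun t => (hder t).differentiableAt)
    (fun t => (hder t).deriv) t 0
  simp only [neg_zero, Circle.exp_zero] at hconst
  rw [hconst]
  simp [rotateAbout]

/-- A Jordan domain `D ∋ a` whose boundary is tangent, in the weak sense, to the circular field
`q(|z - a|) i (z - a)` is a disc centred at `a`: a circle through an exterior point cannot meet
`D`, since rotation would carry a bump function from the exterior into `D`. -/
theorem IsC1JordanDomain.eq_ball_of_tangent_circular {D : Set ℂ} (hD : IsC1JordanDomain D) {a : ℂ}
    (ha : a ∈ D) {q : ℝ → ℝ} (hq : Continuous q) {ρc : ℝ}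
    (hzero : ∀ z ∉ D, q ‖z - a‖ = 0 → ‖z - a‖ = ρc)
    (hid : ∀ g : ℂ → ℝ, ContDiff ℝ ∞ g → HasCompactSupport g →
      ∫ z in D, q ‖z - a‖ * fderiv ℝ g z (Complex.I * (z - a)) = 0) :
    ∃ R > 0, D = Metric.ball a R := by
  have hm : MeasurableSet D := hD.isOpen.measurableSet
  set U := (closure D)ᶜ with hU
  have hUo : IsOpen U := isClosed_closure.isOpen_compl
  have hUD : ∀ z ∈ U, z ∉ D := fun z hz hz' => hz (subset_closure hz')
  have hqc : Continuous fun z : ℂ => q ‖z - a‖ := by fun_prop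
  have hmiss : ∀ p ∈ U, q ‖p - a‖ ≠ 0 → ∀ z ∈ D, ‖z - a‖ ≠ ‖p - a‖ := by
    intro p hp hqp z₁ hz₁ heq
    have hpa : p - a ≠ 0 := fun h => hUD p hp (by rwa [sub_eq_zero.1 h])
    obtain ⟨t, ht⟩ : ∃ t : ℝ, (Circle.exp t : ℂ) * (p - a) = z₁ - a := by
      refine ⟨Complex.arg ((z₁ - a) / (p - a)), ?_⟩
      have h1 := Complex.norm_mul_exp_arg_mul_I ((z₁ - a) / (p - a))
      rw [norm_div, heq, div_self (norm_ne_zero_iff.2 hpa), Complex.ofReal_one, one_mul] at h1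
      rw [Circle.coe_exp, h1, div_mul_cancel₀ _ hpa]
    have hrz : rotateAbout a (Circle.exp (-t)) z₁ = p := by
      rw [rotateAbout, ← ht, ← mul_assoc, ← Circle.coe_mul, ← Circle.exp_add, neg_add_cancel,
        Circle.exp_zero]; simp
    -- A bump function near `p` on whose support `q` has a constant sign.
    have hsgn : ∀ᶠ z in nhds p, 0 < q ‖p - a‖ * q ‖z - a‖ := by
      have hc : Continuous fun z : ℂ => q ‖p - a‖ * q ‖z - a‖ := by fun_prop
      exact hc.continuousAt.eventually (lt_mem_nhds (mul_self_pos.2 hqp))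
    obtain ⟨ε, hε, hball⟩ := Metric.mem_nhds_iff.1 (Filter.inter_mem (hUo.mem_nhds hp) hsgn)
    let g : ContDiffBump p := ⟨ε / 2, ε, by positivity, half_lt_self hε⟩
    have hg0 : ∀ z ∉ Metric.ball p ε, g z = 0 := fun z hz => by
      have h : z ∉ Function.support (g : ℂ → ℝ) := by rw [g.support_eq]; exact hz
      simpa using h
    have hgp : ∀ z ∈ Metric.ball p ε, 0 < g z := fun z hz => g.pos_of_mem_ball hz
    have hI := integral_comp_rotateAbout_eq hD.isBounded hm hq hid g.contDiff g.hasCompactSupport t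
    have h0 : ∫ z in D, q ‖z - a‖ * g z = 0 := by
      refine setIntegral_eq_zero_of_forall_eq_zero fun z hz => ?_
      rw [hg0 z fun h => hUD z (hball h).1 hz, mul_zero]
    rw [h0] at hI
    have hrn : ∀ z, ‖rotateAbout a (Circle.exp (-t)) z - a‖ = ‖z - a‖ := fun z => by
      rw [rotateAbout_sub, norm_mul, Circle.norm_coe, one_mul]
    set h : ℂ → ℝ := fun z =>
      q ‖p - a‖ * (q ‖z - a‖ * g (rotateAbout a (Circle.exp (-t)) z)) with hh
    have hpos : ∀ z, rotateAbout a (Circle.exp (-t)) z ∈ Metric.ball p ε → 0 < h z := by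
      intro z hz
      have h1 : 0 < q ‖p - a‖ * q ‖rotateAbout a (Circle.exp (-t)) z - a‖ := (hball hz).2
      rw [hrn] at h1
      simp only [hh]
      rw [← mul_assoc]
      exact mul_pos h1 (hgp _ hz)
    have hnn : ∀ z, 0 ≤ h z := by
      intro z
      by_cases hz : rotateAbout a (Circle.exp (-t)) z ∈ Metric.ball p ε
      · exact (hpos z hz).le
      · simp only [hh]
        rw [hg0 _ hz, mul_zero, mul_zero]
    have hhc : Continuous h := by
      have := continuous_rotateAbout a (Circle.exp (-t))
      have := g.continuous
      simp only [hh]; fun_prop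
    have hint : IntegrableOn h D :=
      (hhc.continuousOn.integrableOn_compact hD.isBounded.isCompact_closure).mono_set
        subset_closure
    have hz0 : ∫ z in D, h z = 0 := by
      simp only [hh]; rw [integral_const_mul, hI, mul_zero]
    have hppos : 0 < ∫ z in D, h z := by
      rw [setIntegral_pos_iff_support_of_nonneg_ae (Filter.Eventually.of_forall hnn) hint]
      have hsub : rotateAbout a (Circle.exp (-t)) ⁻¹' Metric.ball p ε ∩ D ⊆
          Function.support h ∩ D := fun z hz => ⟨(hpos z hz.1).ne', hz.2⟩
      refine lt_of_lt_of_le ?_ (measure_mono hsub)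
      refine IsOpen.measure_pos volume ((Metric.isOpen_ball.preimage
        (continuous_rotateAbout a _)).inter hD.isOpen) ⟨z₁, ?_, hz₁⟩
      rw [Set.mem_preimage, hrz]
      exact Metric.mem_ball_self hε
    exact hppos.ne' hz0
  have hconn : IsPreconnected D := hD.simplyConnected.isPathConnected.isConnected.isPreconnected
  have hle : ∀ p ∈ U, q ‖p - a‖ ≠ 0 → ∀ z ∈ D, ‖z - a‖ ≤ ‖p - a‖ := by
    intro p hp hqp z hz
    by_contra hlt
    have hc : ContinuousOn (fun z : ℂ => ‖z - a‖) D := by fun_prop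
    obtain ⟨w, hw, hwe⟩ := hconn.intermediate_value ha hz hc
      (show ‖p - a‖ ∈ Set.Icc ‖a - a‖ ‖z - a‖ from ⟨by simp, (not_le.1 hlt).le⟩)
    exact hmiss p hp hqp w hw hwe
  -- Exterior points on the exceptional circle are limits of exterior points off it.
  have hle' : ∀ p ∈ U, ∀ z ∈ D, ‖z - a‖ ≤ ‖p - a‖ := by
    intro p hp z hz
    have hpa : 0 < ‖p - a‖ :=
      norm_pos_iff.2 fun h => hUD p hp (by rwa [sub_eq_zero.1 h])
    have hc : Continuous fun t : ℝ => a + (1 + t) * (p - a) := by fun_prop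
    have hT : Filter.Tendsto (fun t : ℝ => a + (1 + t) * (p - a)) (nhdsWithin 0 (Set.Ioi 0))
        (nhds p) := by
      simpa using (hc.tendsto 0).mono_left nhdsWithin_le_nhds
    have hne : ∀ᶠ t in nhdsWithin (0 : ℝ) (Set.Ioi 0), t ≠ ρc / ‖p - a‖ - 1 := by
      rcases eq_or_ne (0 : ℝ) (ρc / ‖p - a‖ - 1) with h | h
      · rw [← h]
        filter_upwards [self_mem_nhdsWithin] with t ht using (Set.mem_Ioi.1 ht).ne'
      · exact (continuousAt_id.eventually_ne h).filter_mono nhdsWithin_le_nhds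
    have hlim : Filter.Tendsto (fun t : ℝ => ‖a + (1 + t) * (p - a) - a‖)
        (nhdsWithin 0 (Set.Ioi 0)) (nhds ‖p - a‖) :=
      ((by fun_prop : Continuous fun w : ℂ => ‖w - a‖).tendsto p).comp hT
    refine ge_of_tendsto hlim ?_
    filter_upwards [hne, hT (hUo.mem_nhds hp), self_mem_nhdsWithin] with t ht htU htp
    refine hle _ htU (fun h0 => ht ?_) z hz
    have h1 := hzero _ (hUD _ htU) h0
    have h2 : ‖a + (1 + t) * (p - a) - a‖ = (1 + t) * ‖p - a‖ := by
      have : (1 : ℂ) + t = ((1 + t : ℝ) : ℂ) := by push_cast; ring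
      rw [add_sub_cancel_left, norm_mul, this, Complex.norm_real, Real.norm_of_nonneg]
      linarith [Set.mem_Ioi.1 htp]
    rw [h2] at h1
    rw [eq_sub_iff_add_eq, eq_div_iff hpa.ne', ← h1]; ring
  have hfr : ∀ p ∈ frontier D, ∀ z ∈ closure D, ‖z - a‖ ≤ ‖p - a‖ := by
    intro p hp z hz
    have hpU : p ∈ closure U := by
      rw [← hD.frontier_exterior] at hp
      exact frontier_subset_closure hp
    have hcl1 : IsClosed {p : ℂ | ∀ z ∈ D, ‖z - a‖ ≤ ‖p - a‖} := by
      simp only [Set.ofPred_forall]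
      exact isClosed_biInter fun z _ => isClosed_le (by fun_prop) (by fun_prop)
    have h1 := hcl1.closure_subset_iff.2 hle' hpU
    have hcl2 : IsClosed {z : ℂ | ‖z - a‖ ≤ ‖p - a‖} := isClosed_le (by fun_prop) (by fun_prop)
    exact hcl2.closure_subset_iff.2 h1 hz
  obtain ⟨p₀, hp₀⟩ : (frontier D).Nonempty := by
    obtain ⟨γ, -, -, -, -, h⟩ := hD.boundary
    rw [← h]; exact Set.range_nonempty γ
  have hp0a : 0 < ‖p₀ - a‖ := by
    refine norm_pos_iff.2 fun h => hp₀.2 ?_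
    rw [hD.isOpen.interior_eq, sub_eq_zero.1 h]; exact ha
  refine ⟨‖p₀ - a‖, hp0a, eq_ball_of_frontier_subset_sphere hD.isOpen hD.isBounded ⟨a, ha⟩ hp0a ?_⟩
  intro p hp
  rw [mem_sphere_iff_norm]
  exact le_antisymm (hfr p₀ hp₀ p (frontier_subset_closure hp))
    (hfr p hp p₀ (frontier_subset_closure hp₀))

end CircularFlow

/-! ### Rotating patches are bounded by streamlines of the relative flow -/

section RelativeFlow

open scoped ContDiff Manifold

/-- The field `Q` for which `(i / 2) conj Q` is the velocity `u - iΩ(z - c)` of the two-patch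
relative to the frame that rotates about `c` with angular velocity `Ω`. -/
noncomputable def relField (D₁ D₂ : Set ℂ) (α Ω : ℝ) (c z : ℂ) : ℂ :=
  cauchyTransform D₁ z + (α - 1) * cauchyTransform D₂ z - 2 * Ω * (starRingEnd ℂ) (z - c)

/-- The field `(i / 2) conj Q` is weakly divergence free and tangential to the boundary of `D`: its
pairing over `D` with every gradient vanishes. -/
def IsWeaklyTangent (D : Set ℂ) (Q : ℂ → ℂ) : Prop :=
  ∀ f : ℂ → ℝ, ContDiff ℝ ∞ f →
    ∫ z in D, fderiv ℝ f z (Complex.I / 2 * (starRingEnd ℂ) (Q z)) = 0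

theorem exists_cutoff {K O : Set ℂ} (hK : IsCompact K) (hO : IsOpen O) (hKO : K ⊆ O) :
    ∃ χ : ℂ → ℝ, ContDiff ℝ ∞ χ ∧ HasCompactSupport χ ∧ tsupport χ ⊆ O ∧ ∀ x ∈ K, χ x = 1 := by
  obtain ⟨L, hL, hKL, hLO⟩ := exists_compact_between hK hO hKO
  obtain ⟨χ, hχ, -, hs, h1⟩ := exists_contMDiff_support_eq_eq_one_iff (n := (⊤ : ℕ∞)) 𝓘(ℝ, ℂ)
    (isOpen_interior (s := L)) hK.isClosed hKL
  have ht : tsupport χ ⊆ L := by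
    rw [tsupport, hs]
    exact closure_minimal interior_subset hL.isClosed
  exact ⟨χ, hχ.contDiff, hL.of_isClosed_subset (isClosed_tsupport χ) ht, ht.trans hLO,
    fun x hx => (h1 x).1 hx⟩

theorem velocity_twoPatch {D₁ D₂ : Set ℂ} (hb₁ : Bornology.IsBounded D₁) (hm₁ : MeasurableSet D₁)
    (hb₂ : Bornology.IsBounded D₂) (hm₂ : MeasurableSet D₂) (α : ℝ) (z : ℂ) :
    velocity (twoPatch D₁ D₂ α) z = Complex.I / 2 *
      (starRingEnd ℂ) (cauchyTransform D₁ z + (α - 1) * cauchyTransform D₂ z) := by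
  have h1 : ∀ ξ, (twoPatch D₁ D₂ α ξ : ℂ) / (starRingEnd ℂ) (z - ξ) =
      (starRingEnd ℂ) (D₁.indicator (fun ξ => (z - ξ)⁻¹) ξ +
        (α - 1) * D₂.indicator (fun ξ => (z - ξ)⁻¹) ξ) := by
    intro ξ
    by_cases h : ξ ∈ D₁ <;> by_cases h' : ξ ∈ D₂ <;>
      simp [twoPatch, h, h', div_eq_mul_inv]
    all_goals try ring
  have hpi : (Real.pi : ℂ) ≠ 0 := by exact_mod_cast Real.pi_ne_zero
  rw [velocity]
  simp only [h1]
  rw [integral_conj, integral_add ((integrable_indicator_iff hm₁).2 (integrableOn_inv_sub hb₁ z))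
    (((integrable_indicator_iff hm₂).2 (integrableOn_inv_sub hb₂ z)).const_mul _),
    integral_const_mul, integral_indicator hm₁, integral_indicator hm₂]
  simp only [cauchyTransform, map_add, map_mul, map_inv₀, Complex.conj_ofReal, map_sub, map_one]
  field_simp

theorem relVelocity_eq {D₁ D₂ : Set ℂ} (hb₁ : Bornology.IsBounded D₁) (hm₁ : MeasurableSet D₁)
    (hb₂ : Bornology.IsBounded D₂) (hm₂ : MeasurableSet D₂) (α Ω : ℝ) (c z : ℂ) :
    velocity (twoPatch D₁ D₂ α) z - Complex.I * Ω * (z - c) =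
      Complex.I / 2 * (starRingEnd ℂ) (relField D₁ D₂ α Ω c z) := by
  rw [velocity_twoPatch hb₁ hm₁ hb₂ hm₂, relField]
  simp only [map_sub, map_add, map_mul, Complex.conj_conj, Complex.conj_ofReal, map_one, map_ofNat]
  ring

theorem velocity_congr_ae {vort vort' : ℂ → ℝ} (h : vort =ᵐ[volume] vort') :
    velocity vort = velocity vort' := by
  funext z
  rw [velocity, velocity]
  congr 1
  refine integral_congr_ae ?_
  filter_upwards [h] with ξ hξ
  rw [hξ]

/-- The velocity field of a rotated vorticity is the rotated velocity field. -/
theorem velocity_comp_rotateAbout (vort : ℂ → ℝ) (c : ℂ) (v : Circle) (z : ℂ) :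
    velocity (fun ξ => vort (rotateAbout c v ξ)) z =
      (v : ℂ)⁻¹ * velocity vort (rotateAbout c v z) := by
  have h := (measurePreserving_rotateAbout c v).integral_comp (measurableEmbedding_rotateAbout c v)
    (fun ξ => (vort ξ : ℂ) / (starRingEnd ℂ) (rotateAbout c v z - ξ))
  have hv : (v : ℂ) ≠ 0 := Circle.coe_ne_zero v
  have h2 : ∀ ξ, (vort (rotateAbout c v ξ) : ℂ) / (starRingEnd ℂ) (z - ξ) = (v : ℂ)⁻¹ *
      ((vort (rotateAbout c v ξ) : ℂ) /
        (starRingEnd ℂ) (rotateAbout c v z - rotateAbout c v ξ)) := by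
    intro ξ
    have h3 : rotateAbout c v z - rotateAbout c v ξ = v * (z - ξ) := by
      simp only [rotateAbout]; ring
    rw [h3, map_mul, ← Circle.coe_inv_eq_conj, Circle.coe_inv]
    field_simp
  rw [velocity, velocity, ← h]
  simp only [h2]
  rw [integral_const_mul]
  ring

/-- The derivative along `(1, v)` of a test function that is transported by the rotation. -/
theorem fderiv_mul_comp_rotateAbout {η : ℝ → ℝ} {f : ℂ → ℝ} (hη : ContDiff ℝ ∞ η)
    (hf : ContDiff ℝ ∞ f) (c : ℂ) (Ω : ℝ) :
    ContDiff ℝ ∞ (fun p : ℝ × ℂ => η p.1 * f (rotateAbout c (Circle.exp (-(Ω * p.1))) p.2)) ∧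
    ∀ (t : ℝ) (z v : ℂ),
      fderiv ℝ (fun p : ℝ × ℂ => η p.1 * f (rotateAbout c (Circle.exp (-(Ω * p.1))) p.2)) (t, z)
        (1, v) = deriv η t * f (rotateAbout c (Circle.exp (-(Ω * t))) z) +
          η t * fderiv ℝ f (rotateAbout c (Circle.exp (-(Ω * t))) z)
            (Circle.exp (-(Ω * t)) * v -
              Complex.I * Ω * (rotateAbout c (Circle.exp (-(Ω * t))) z - c)) := by
  have hr : ContDiff ℝ ∞ (fun p : ℝ × ℂ => rotateAbout c (Circle.exp (-(Ω * p.1))) p.2) := by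
    simp only [rotateAbout, Circle.coe_exp]
    refine contDiff_const.add (ContDiff.mul ?_ (contDiff_snd.sub contDiff_const))
    refine ContDiff.cexp (ContDiff.mul ?_ contDiff_const)
    exact Complex.ofRealCLM.contDiff.comp (contDiff_const.mul contDiff_fst).neg
  have hs : ContDiff ℝ ∞
      (fun p : ℝ × ℂ => η p.1 * f (rotateAbout c (Circle.exp (-(Ω * p.1))) p.2)) :=
    (hη.comp contDiff_fst).mul (hf.comp hr)
  refine ⟨hs, fun t z v => ?_⟩
  have hline := ((hs.differentiable (by simp)) (t, z)).hasFDerivAt.hasLineDerivAt (1, v)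
  unfold HasLineDerivAt at hline
  have he : HasDerivAt (fun s : ℝ => Complex.exp (((-(Ω * (t + s)) : ℝ) : ℂ) * Complex.I))
      (Complex.exp (((-(Ω * t) : ℝ) : ℂ) * Complex.I) * (((-Ω : ℝ) : ℂ) * Complex.I)) 0 := by
    have h1 : HasDerivAt (fun s : ℝ => ((-(Ω * (t + s)) : ℝ) : ℂ)) ((-Ω : ℝ) : ℂ) 0 := by
      have h2 : HasDerivAt (fun s : ℝ => -(Ω * (t + s))) (-Ω) 0 := by
        exact HasDerivAt.congr_deriv (((hasDerivAt_id (0:ℝ)).const_add t).const_mul Ω).neg (by simp)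
      exact h2.ofReal_comp
    have h3 := (h1.mul_const Complex.I).cexp
    simpa using h3
  have hz : HasDerivAt (fun s : ℝ => z + s * v - c) v 0 := by
    have h1 : HasDerivAt (fun s : ℝ => (s : ℂ) * v) v 0 := by
      simpa using (Complex.ofRealCLM.hasDerivAt (x := (0 : ℝ))).mul_const v
    exact (h1.const_add z).sub_const c
  have hrot : HasDerivAt (fun s : ℝ => rotateAbout c (Circle.exp (-(Ω * (t + s)))) (z + s * v))
      (Circle.exp (-(Ω * t)) * v -
        Complex.I * Ω * (rotateAbout c (Circle.exp (-(Ω * t))) z - c)) 0 := by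
    have h1 := (he.mul hz).const_add c
    simp only [rotateAbout, Circle.coe_exp]
    refine h1.congr_deriv ?_
    simp
    ring
  have hf' : HasFDerivAt f (fderiv ℝ f (rotateAbout c (Circle.exp (-(Ω * t))) z))
      (rotateAbout c (Circle.exp (-(Ω * (t + (0 : ℝ))))) (z + ((0 : ℝ) : ℂ) * v)) := by
    simpa using ((hf.differentiable (by simp)) _).hasFDerivAt
  have hη' : HasDerivAt (fun s : ℝ => η (t + s)) (deriv η t) 0 := by
    have h1 : HasDerivAt η (deriv η t) (t + 0) := by
      simpa using ((hη.differentiable (by simp)) t).hasDerivAt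
    simpa using h1.comp_const_add t 0
  have hprod := hη'.mul (hf'.comp_hasDerivAt (0 : ℝ) hrot)
  have huniq := hline.unique (hprod.congr_of_eventuallyEq (Filter.Eventually.of_forall fun s => by
    simp))
  rw [huniq]
  simp

/-- A uniformly rotating vorticity is a weak stationary solution in the rotating frame. -/
theorem integral_relVelocity_eq_zero {ω₀ : ℂ → ℝ} {vort : ℝ → ℂ → ℝ}
    (hvort : IsVorticitySolution ω₀ vort)
    {c : ℂ} {Ω : ℝ} (hrot : ∀ t : ℝ, 0 ≤ t →
      vort t =ᵐ[volume] fun z => ω₀ (c + Complex.exp (-(Complex.I * Ω * t)) * (z - c)))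
    (hloc : LocallyIntegrable ω₀) (hu : Continuous (velocity ω₀)) {f : ℂ → ℝ}
    (hf : ContDiff ℝ ∞ f) (hfc : HasCompactSupport f) :
    ∫ z, ω₀ z * fderiv ℝ f z (velocity ω₀ z - Complex.I * Ω * (z - c)) = 0 := by
  -- The test function is `η(t) f`, with `f` carried along by the rotation, and `η` a bump supported
  -- in positive times, so that the initial datum does not contribute.
  let η : ContDiffBump (2 : ℝ) := ⟨1 / 2, 1, by norm_num, by norm_num⟩
  have hη0 : ∀ t : ℝ, t ∉ Set.Ioo (1 : ℝ) 3 → η t = 0 := fun t ht => by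
    have h : t ∉ Function.support (η : ℝ → ℝ) := by
      rw [η.support_eq, Real.ball_eq_Ioo]
      norm_num [η] at ht ⊢
      exact ht
    simpa using h
  set r : ℝ → ℂ → ℂ := fun t => rotateAbout c (Circle.exp (-(Ω * t))) with hr
  have hrot' : ∀ t : ℝ, 0 ≤ t → vort t =ᵐ[volume] fun z => ω₀ (r t z) := by
    intro t ht
    filter_upwards [hrot t ht] with z hz
    rw [hz, hr]
    simp only [rotateAbout, Circle.coe_exp]
    congr 5
    push_cast; ring
  obtain ⟨hφs, hφd⟩ := fderiv_mul_comp_rotateAbout η.contDiff hf c Ω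
  have hφc : HasCompactSupport
      (fun p : ℝ × ℂ => η p.1 * f (rotateAbout c (Circle.exp (-(Ω * p.1))) p.2)) := by
    obtain ⟨R, hR⟩ := hfc.isCompact.isBounded.subset_closedBall c
    refine HasCompactSupport.intro (isCompact_Icc.prod (isCompact_closedBall c R) :
      IsCompact (Set.Icc (1 : ℝ) 3 ×ˢ Metric.closedBall c R)) ?_
    rintro ⟨t, z⟩ hp
    simp only [Set.mem_prod, not_and_or] at hp
    rcases hp with ht | hz
    · rw [hη0 t fun h => ht (Set.Ioo_subset_Icc_self h), zero_mul]
    · have : rotateAbout c (Circle.exp (-(Ω * t))) z ∉ tsupport f := fun h => hz (by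
        have h2 := hR h
        rwa [Metric.mem_closedBall, dist_eq_norm, rotateAbout_sub, norm_mul, Circle.norm_coe,
          one_mul, ← dist_eq_norm] at h2)
      rw [image_eq_zero_of_notMem_tsupport this, mul_zero]
  have hweak := hvort.weak _ hφs hφc
  set V : ℂ → ℂ := fun z => velocity ω₀ z - Complex.I * Ω * (z - c) with hV
  have hVc : Continuous V := by simp only [hV]; fun_prop
  set I₀ := ∫ z, ω₀ z * f z with hI₀
  set I₁ := ∫ z, ω₀ z * fderiv ℝ f z (V z) with hI₁
  have hf1 : ContDiff ℝ 1 f := hf.of_le (by simp)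
  have hint0 : Integrable (fun z => ω₀ z * f z) :=
    hloc.integrable_smul_right_of_hasCompactSupport hf.continuous hfc
  have hint1 : Integrable (fun z => ω₀ z * fderiv ℝ f z (V z)) := by
    refine hloc.integrable_smul_right_of_hasCompactSupport
      ((hf1.continuous_fderiv (by simp)).clm_apply hVc) ?_
    exact HasCompactSupport.intro hfc fun z hz => by
      rw [fderiv_of_notMem_tsupport ℝ hz]; simp
  -- Undoing the rotation in the space variable leaves integrals that do not depend on `t`.
  have hinner : ∀ t ∈ Set.Ioi (0 : ℝ), ∫ z : ℂ, vort t z *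
      fderiv ℝ (fun p : ℝ × ℂ => η p.1 * f (rotateAbout c (Circle.exp (-(Ω * p.1))) p.2)) (t, z)
        (1, velocity (vort t) z) = deriv η t * I₀ + η t * I₁ := by
    intro t ht
    have hvel : ∀ z, (Circle.exp (-(Ω * t)) : ℂ) * velocity (vort t) z = velocity ω₀ (r t z) := by
      intro z
      rw [velocity_congr_ae (hrot' t (le_of_lt ht)), velocity_comp_rotateAbout, ← mul_assoc,
        mul_inv_cancel₀ (Circle.coe_ne_zero _), one_mul]
    have h1 : ∫ z : ℂ, vort t z *
      fderiv ℝ (fun p : ℝ × ℂ => η p.1 * f (rotateAbout c (Circle.exp (-(Ω * p.1))) p.2)) (t, z)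
        (1, velocity (vort t) z) =
        ∫ z : ℂ, (fun w => deriv η t * (ω₀ w * f w) +
          η t * (ω₀ w * fderiv ℝ f w (V w))) (r t z) := by
      refine integral_congr_ae ?_
      filter_upwards [hrot' t (le_of_lt ht)] with z hz
      rw [hφd, hvel, hz]
      simp only [hV, hr]
      ring
    rw [h1, (measurePreserving_rotateAbout c _).integral_comp (measurableEmbedding_rotateAbout c _)
      (fun w => deriv η t * (ω₀ w * f w) + η t * (ω₀ w * fderiv ℝ f w (V w))),
      integral_add (hint0.const_mul _) (hint1.const_mul _), integral_const_mul, integral_const_mul]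
  have h0 : ∫ z : ℂ, ω₀ z * (η 0 * f (rotateAbout c (Circle.exp (-(Ω * 0))) z)) = 0 := by
    rw [hη0 0 (by simp)]; simp
  have hηs : ContDiff ℝ 1 (η : ℝ → ℝ) := η.contDiff
  have hder : ∫ t in Set.Ioi (0 : ℝ), deriv η t = 0 := by
    rw [η.hasCompactSupport.integral_Ioi_deriv_eq hηs 0, hη0 0 (by simp), neg_zero]
  have hηpos : 0 < ∫ t in Set.Ioi (0 : ℝ), η t := by
    rw [setIntegral_eq_integral_of_forall_compl_eq_zero (s := Set.Ioi (0 : ℝ))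
      fun t ht => hη0 t fun h => ht (Set.mem_Ioi.2 (lt_trans one_pos h.1))]
    exact η.integral_pos
  beta_reduce at hweak
  rw [setIntegral_congr_fun measurableSet_Ioi hinner, h0, add_zero, integral_add,
    integral_mul_const, integral_mul_const, hder, zero_mul, zero_add] at hweak
  · exact (mul_eq_zero.1 hweak).resolve_left hηpos.ne'
  · exact (((hηs.continuous_deriv (by simp)).integrable_of_hasCompactSupport
      η.hasCompactSupport.deriv).mul_const _).integrableOn
  · exact ((η.continuous.integrable_of_hasCompactSupport
      η.hasCompactSupport).mul_const _).integrableOn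

theorem dbar_conj_sub (c z : ℂ) : dbar (fun w => (starRingEnd ℂ) (w - c)) z = 1 := by
  have h : HasFDerivAt (fun w : ℂ => (starRingEnd ℂ) (w - c))
      Complex.conjCLE.toContinuousLinearMap z :=
    Complex.conjCLE.hasFDerivAt.comp z ((hasFDerivAt_id (𝕜 := ℝ) z).sub_const c)
  rw [dbar, h.fderiv]
  simp

theorem contDiff_conj_sub (c : ℂ) : ContDiff ℝ ∞ (fun w : ℂ => (starRingEnd ℂ) (w - c)) :=
  Complex.conjCLE.contDiff.comp (contDiff_id.sub contDiff_const)

theorem continuous_relField {D₁ D₂ : Set ℂ} (hb₁ : Bornology.IsBounded D₁)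
    (hb₂ : Bornology.IsBounded D₂) (α Ω : ℝ) (c : ℂ) : Continuous (relField D₁ D₂ α Ω c) :=
  ((continuous_cauchyTransform hb₁).add (continuous_const.mul (continuous_cauchyTransform hb₂))).sub
    (continuous_const.mul (contDiff_conj_sub c).continuous)

/-- The weak `∂/∂z̄` derivative of the relative field is real. -/
theorem hasWeakDbar_relField {D₁ D₂ : Set ℂ} (hb₁ : Bornology.IsBounded D₁)
    (hm₁ : MeasurableSet D₁) (hb₂ : Bornology.IsBounded D₂) (hm₂ : MeasurableSet D₂) (α Ω : ℝ)
    (c : ℂ) :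
    HasWeakDbar (relField D₁ D₂ α Ω c) (fun z => ((twoPatch D₁ D₂ α z - 2 * Ω : ℝ) : ℂ)) := by
  refine (((hasWeakDbar_cauchyTransform hm₁ hb₁).add
    ((hasWeakDbar_cauchyTransform hm₂ hb₂).const_mul (α - 1))).sub
    ((HasWeakDbar.of_contDiff (contDiff_conj_sub c)).const_mul (2 * Ω))).congr fun z => ?_
  rw [dbar_conj_sub]
  by_cases h : z ∈ D₁ <;> by_cases h' : z ∈ D₂ <;> simp [twoPatch, h, h']

/-- The derivative of a real function along `(i / 2) conj q`, in terms of `∂/∂z̄`. -/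
theorem fderiv_apply_eq_im_dbar_mul {f : ℂ → ℝ} {z : ℂ} (hf : DifferentiableAt ℝ f z) (q : ℂ) :
    fderiv ℝ f z (Complex.I / 2 * (starRingEnd ℂ) q) =
      (q * dbar (fun w => (f w : ℂ)) z).im := by
  have h1 : HasFDerivAt (fun w => (f w : ℂ)) (Complex.ofRealCLM.comp (fderiv ℝ f z)) z :=
    Complex.ofRealCLM.hasFDerivAt.comp z hf.hasFDerivAt
  have h2 : Complex.I / 2 * (starRingEnd ℂ) q = (q.im / 2) • (1 : ℂ) + (q.re / 2) • Complex.I := by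
    apply Complex.ext <;> simp <;> ring
  rw [dbar, h1.fderiv, h2, map_add, map_smul, map_smul]
  simp [Complex.mul_im]
  ring

/-- A field with real weak `∂/∂z̄` derivative is, after conjugation and rotation by a right angle,
weakly divergence free. -/
theorem HasWeakDbar.integral_fderiv_eq_zero {Q : ℂ → ℂ} {q : ℂ → ℝ}
    (h : HasWeakDbar Q (fun z => (q z : ℂ))) {f : ℂ → ℝ} (hf : ContDiff ℝ ∞ f)
    (hfc : HasCompactSupport f) :
    ∫ z, fderiv ℝ f z (Complex.I / 2 * (starRingEnd ℂ) (Q z)) = 0 := by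
  have hF : ContDiff ℝ ∞ (fun w => (f w : ℂ)) := Complex.ofRealCLM.contDiff.comp hf
  have hFc : HasCompactSupport (fun w => (f w : ℂ)) := hfc.comp_left Complex.ofReal_zero
  have h1 := h.integral_mul_dbar _ hF hFc
  have hint := h.integrable_mul' (continuous_dbar (hF.of_le (by simp))) (hasCompactSupport_dbar hFc)
  simp only [fderiv_apply_eq_im_dbar_mul (hf.differentiable (by simp) _)]
  have h2 := integral_im hint
  simp only [RCLike.im_to_complex] at h2
  rw [h2, h1]
  have h3 : ∀ z, (q z : ℂ) * (f z : ℂ) = ((q z * f z : ℝ) : ℂ) := fun z => by push_cast; rfl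
  simp only [h3]
  rw [integral_complex_ofReal]
  simp

theorem integral_twoPatch_mul {D₁ D₂ : Set ℂ} (hm₁ : MeasurableSet D₁) (hm₂ : MeasurableSet D₂)
    (α : ℝ) {h : ℂ → ℝ} (hh : Integrable h) :
    ∫ z, twoPatch D₁ D₂ α z * h z = (∫ z in D₁, h z) + (α - 1) * ∫ z in D₂, h z := by
  rw [← integral_indicator hm₁, ← integral_indicator hm₂, ← integral_const_mul,
    ← integral_add (hh.indicator hm₁) ((hh.indicator hm₂).const_mul _)]
  refine integral_congr_ae (Filter.Eventually.of_forall fun z => ?_)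
  by_cases h : z ∈ D₁ <;> by_cases h' : z ∈ D₂ <;> simp [twoPatch, h, h']
  ring

theorem locallyIntegrable_twoPatch {D₁ D₂ : Set ℂ} (hb₁ : Bornology.IsBounded D₁)
    (hm₁ : MeasurableSet D₁) (hb₂ : Bornology.IsBounded D₂) (hm₂ : MeasurableSet D₂) (α : ℝ) :
    LocallyIntegrable (twoPatch D₁ D₂ α) := by
  have h : ∀ {D : Set ℂ}, Bornology.IsBounded D → MeasurableSet D →
      Integrable (D.indicator (1 : ℂ → ℝ)) := fun {D} hb hm =>
    (integrable_indicator_iff hm).2 (integrableOn_const hb.measure_lt_top.ne)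
  exact ((h hb₁ hm₁).add ((h hb₂ hm₂).const_mul (α - 1))).locallyIntegrable

/-- The boundaries of both patches are, in the weak sense, streamlines of the relative flow. -/
theorem isWeaklyTangent_relField {D₁ D₂ : Set ℂ} (hb₁ : Bornology.IsBounded D₁) (ho₁ : IsOpen D₁)
    (hb₂ : Bornology.IsBounded D₂) (ho₂ : IsOpen D₂) (hsub : closure D₂ ⊆ D₁) {α : ℝ} (hα : α ≠ 1)
    {vort : ℝ → ℂ → ℝ} (hvort : IsVorticitySolution (twoPatch D₁ D₂ α) vort) {c : ℂ} {Ω : ℝ}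
    (hrot : ∀ t : ℝ, 0 ≤ t → vort t =ᵐ[volume] fun z =>
      twoPatch D₁ D₂ α (c + Complex.exp (-(Complex.I * Ω * t)) * (z - c))) :
    IsWeaklyTangent D₁ (relField D₁ D₂ α Ω c) ∧ IsWeaklyTangent D₂ (relField D₁ D₂ α Ω c) := by
  have hm₁ := ho₁.measurableSet
  have hm₂ := ho₂.measurableSet
  have hQc := continuous_relField hb₁ hb₂ α Ω c
  set Q := relField D₁ D₂ α Ω c with hQ
  have hvc : Continuous (velocity (twoPatch D₁ D₂ α)) := by
    rw [funext (velocity_twoPatch hb₁ hm₁ hb₂ hm₂ α)]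
    exact continuous_const.mul (Complex.continuous_conj.comp ((continuous_cauchyTransform hb₁).add
      (continuous_const.mul (continuous_cauchyTransform hb₂))))
  have hbal : ∀ g : ℂ → ℝ, ContDiff ℝ ∞ g → HasCompactSupport g →
      (∫ z in D₁, fderiv ℝ g z (Complex.I / 2 * (starRingEnd ℂ) (Q z))) +
        (α - 1) * ∫ z in D₂, fderiv ℝ g z (Complex.I / 2 * (starRingEnd ℂ) (Q z)) = 0 := by
    intro g hg hgc
    have h := integral_relVelocity_eq_zero hvort hrot
      (locallyIntegrable_twoPatch hb₁ hm₁ hb₂ hm₂ α) hvc hg hgc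
    simp only [relVelocity_eq hb₁ hm₁ hb₂ hm₂] at h
    rwa [integral_twoPatch_mul hm₁ hm₂] at h
    refine Continuous.integrable_of_hasCompactSupport
      (((hg.of_le (by simp : (1 : ℕ∞ω) ≤ ∞)).continuous_fderiv (by simp)).clm_apply
        (continuous_const.mul (Complex.continuous_conj.comp hQc))) ?_
    exact HasCompactSupport.intro hgc fun z hz => by
      rw [fderiv_of_notMem_tsupport ℝ hz]; simp
  have hcut : ∀ {D : Set ℂ} {χ f : ℂ → ℝ}, IsOpen D → (∀ x ∈ closure D, χ x = 1) →
      ∫ z in D, fderiv ℝ (fun w => χ w * f w) z (Complex.I / 2 * (starRingEnd ℂ) (Q z)) =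
        ∫ z in D, fderiv ℝ f z (Complex.I / 2 * (starRingEnd ℂ) (Q z)) := by
    intro D χ f ho hχ
    refine setIntegral_congr_fun ho.measurableSet fun z hz => ?_
    have : (fun w => χ w * f w) =ᶠ[nhds z] f := by
      filter_upwards [ho.mem_nhds hz] with w hw
      rw [hχ w (subset_closure hw), one_mul]
    simp only [this.fderiv_eq]
  -- A cutoff to `D₁` leaves `f` unchanged on `D₂`, and makes the integral over `D₁` an integral
  -- over the plane, which vanishes because the flow is divergence free.
  have h₂ : IsWeaklyTangent D₂ Q := by
    intro f hf
    obtain ⟨χ, hχ, hχc, hχs, hχ1⟩ := exists_cutoff hb₂.isCompact_closure ho₁ hsub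
    have h1 := hbal _ (hχ.mul hf) hχc.mul_right
    have h2 : ∫ z in D₁, fderiv ℝ (fun w => χ w * f w) z
        (Complex.I / 2 * (starRingEnd ℂ) (Q z)) = 0 := by
      rw [setIntegral_eq_integral_of_forall_compl_eq_zero]
      · exact (hasWeakDbar_relField hb₁ hm₁ hb₂ hm₂ α Ω c).integral_fderiv_eq_zero (hχ.mul hf)
          hχc.mul_right
      · intro z hz
        rw [fderiv_of_notMem_tsupport ℝ fun h => hz (hχs (tsupport_mul_subset_left h))]
        simp
    rw [h2, zero_add, hcut ho₂ hχ1] at h1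
    exact (mul_eq_zero.1 h1).resolve_left (sub_ne_zero.2 hα)
  refine ⟨fun f hf => ?_, h₂⟩
  obtain ⟨χ, hχ, hχc, -, hχ1⟩ := exists_cutoff hb₁.isCompact_closure isOpen_univ
    (Set.subset_univ _)
  have h1 := hbal _ (hχ.mul hf) hχc.mul_right
  rwa [hcut ho₁ hχ1, h₂ _ (hχ.mul hf), mul_zero, add_zero] at h1

theorem contDiff_monomial (a : ℂ) (j k : ℕ) :
    ContDiff ℝ ∞ (fun z : ℂ => (z - a) ^ j * (starRingEnd ℂ) (z - a) ^ k) :=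
  ((contDiff_id.sub contDiff_const).pow j).mul ((contDiff_conj_sub a).pow k)

theorem fderiv_monomial (a : ℂ) (j k : ℕ) (z v : ℂ) :
    fderiv ℝ (fun z : ℂ => (z - a) ^ j * (starRingEnd ℂ) (z - a) ^ k) z v =
      j * (z - a) ^ (j - 1) * v * (starRingEnd ℂ) (z - a) ^ k +
        k * (z - a) ^ j * (starRingEnd ℂ) (z - a) ^ (k - 1) * (starRingEnd ℂ) v := by
  have h1 : HasFDerivAt (fun w : ℂ => w - a) (ContinuousLinearMap.id ℝ ℂ) z :=
    (hasFDerivAt_id (𝕜 := ℝ) z).sub_const a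
  have h2 : HasFDerivAt (fun w : ℂ => (starRingEnd ℂ) (w - a))
      Complex.conjCLE.toContinuousLinearMap z := Complex.conjCLE.hasFDerivAt.comp z h1
  have h3 := (h1.pow j).mul (h2.pow k)
  have h4 : fderiv ℝ (fun z : ℂ => (z - a) ^ j * (starRingEnd ℂ) (z - a) ^ k) z = _ := h3.fderiv
  rw [h4]
  simp
  ring

theorem dbar_monomial (a : ℂ) (j k : ℕ) (z : ℂ) :
    dbar (fun z : ℂ => (z - a) ^ j * (starRingEnd ℂ) (z - a) ^ k) z =
      k * (z - a) ^ j * (starRingEnd ℂ) (z - a) ^ (k - 1) := by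
  rw [dbar, fderiv_monomial, fderiv_monomial, map_one, Complex.conj_I]
  linear_combination (j * (z - a) ^ (j - 1) * (starRingEnd ℂ) (z - a) ^ k -
    k * (z - a) ^ j * (starRingEnd ℂ) (z - a) ^ (k - 1)) / 2 * Complex.I_sq

/-- Weak tangency tested with the monomials in `z - a` and its conjugate. -/
theorem IsWeaklyTangent.integral_monomial {D : Set ℂ} {Q : ℂ → ℂ} (h : IsWeaklyTangent D Q)
    (hb : Bornology.IsBounded D) (hQ : Continuous Q) (a : ℂ) (j k : ℕ) :
    ∫ z in D, (k * (z - a) ^ j * (starRingEnd ℂ) (z - a) ^ (k - 1) * Q z -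
      j * (z - a) ^ (j - 1) * (starRingEnd ℂ) (z - a) ^ k * (starRingEnd ℂ) (Q z)) = 0 := by
  set F : ℂ → ℂ := fun z => (z - a) ^ j * (starRingEnd ℂ) (z - a) ^ k with hF
  have hFs : ContDiff ℝ ∞ F := contDiff_monomial a j k
  have hV : Continuous (fun z => Complex.I / 2 * (starRingEnd ℂ) (Q z)) :=
    continuous_const.mul (Complex.continuous_conj.comp hQ)
  have hre : ContDiff ℝ ∞ (fun z => (F z).re) := Complex.reCLM.contDiff.comp hFs
  have him : ContDiff ℝ ∞ (fun z => (F z).im) := Complex.imCLM.contDiff.comp hFs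
  have hd : ∀ z, HasFDerivAt F (fderiv ℝ F z) z := fun z =>
    (hFs.differentiable (by simp) z).hasFDerivAt
  have hdre : ∀ z v, fderiv ℝ (fun z => (F z).re) z v = (fderiv ℝ F z v).re := fun z v => by
    have h1 : HasFDerivAt (fun z => (F z).re) (Complex.reCLM.comp (fderiv ℝ F z)) z :=
      Complex.reCLM.hasFDerivAt.comp z (hd z)
    rw [h1.fderiv]; rfl
  have hdim : ∀ z v, fderiv ℝ (fun z => (F z).im) z v = (fderiv ℝ F z v).im := fun z v => by
    have h1 : HasFDerivAt (fun z => (F z).im) (Complex.imCLM.comp (fderiv ℝ F z)) z :=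
      Complex.imCLM.hasFDerivAt.comp z (hd z)
    rw [h1.fderiv]; rfl
  have hint : IntegrableOn (fun z => fderiv ℝ F z (Complex.I / 2 * (starRingEnd ℂ) (Q z))) D :=
    (((hFs.of_le (by simp : (1 : ℕ∞ω) ≤ ∞)).continuous_fderiv (by simp)).clm_apply
      hV).continuousOn.integrableOn_compact hb.isCompact_closure |>.mono_set subset_closure
  have hzero : ∫ z in D, fderiv ℝ F z (Complex.I / 2 * (starRingEnd ℂ) (Q z)) = 0 := by
    have h1 := integral_re hint
    have h2 := integral_im hint
    have h3 := h _ hre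
    have h4 := h _ him
    simp only [hdre] at h3
    simp only [hdim] at h4
    simp only [RCLike.re_to_complex, RCLike.im_to_complex] at h1 h2
    apply Complex.ext
    · rw [← h1, h3]; rfl
    · rw [← h2, h4]; rfl
  have h5 : ∀ z, k * (z - a) ^ j * (starRingEnd ℂ) (z - a) ^ (k - 1) * Q z -
      j * (z - a) ^ (j - 1) * (starRingEnd ℂ) (z - a) ^ k * (starRingEnd ℂ) (Q z) =
      2 * Complex.I * fderiv ℝ F z (Complex.I / 2 * (starRingEnd ℂ) (Q z)) := by
    intro z
    rw [hF, fderiv_monomial]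
    simp only [map_mul, map_div₀, Complex.conj_I, map_ofNat, Complex.conj_conj]
    linear_combination (k * (z - a) ^ j * (starRingEnd ℂ) (z - a) ^ (k - 1) * Q z -
      j * (z - a) ^ (j - 1) * (starRingEnd ℂ) (z - a) ^ k * (starRingEnd ℂ) (Q z)) * Complex.I_sq
  simp only [h5]
  rw [integral_const_mul, hzero, mul_zero]

end RelativeFlow

/-! ### A discal inner patch -/

section InnerDisc

open scoped ContDiff

/-- Termwise integration of a geometric series with uniformly small ratio. -/
theorem hasSum_integral_mul_pow {A : Set ℂ} (hm : MeasurableSet A) {u v : ℂ → ℂ}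
    (hu : Measurable u) (hv : IntegrableOn v A) {ρ : ℝ} (hρ0 : 0 ≤ ρ) (hρ : ρ < 1)
    (hb : ∀ ξ ∈ A, ‖u ξ‖ ≤ ρ) :
    HasSum (fun n : ℕ => ∫ ξ in A, v ξ * u ξ ^ n) (∫ ξ in A, v ξ * (1 - u ξ)⁻¹) := by
  have hle : ∀ n : ℕ, ∀ ξ ∈ A, ‖v ξ * u ξ ^ n‖ ≤ ρ ^ n * ‖v ξ‖ := fun n ξ hξ => by
    rw [norm_mul, norm_pow, mul_comm]
    exact mul_le_mul_of_nonneg_right (pow_le_pow_left₀ (norm_nonneg _) (hb ξ hξ) n) (norm_nonneg _)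
  have hint : ∀ n : ℕ, IntegrableOn (fun ξ => v ξ * u ξ ^ n) A := fun n => by
    refine Integrable.mono' (hv.norm.const_mul (ρ ^ n))
      (hv.aestronglyMeasurable.mul (hu.pow_const n).aestronglyMeasurable) ?_
    filter_upwards [ae_restrict_mem hm] with ξ hξ using hle n ξ hξ
  have hsum : Summable fun n : ℕ => ∫ ξ in A, ‖v ξ * u ξ ^ n‖ := by
    refine Summable.of_nonneg_of_le (fun n => integral_nonneg fun _ => norm_nonneg _) (fun n => ?_)
      ((summable_geometric_of_lt_one hρ0 hρ).mul_right (∫ ξ in A, ‖v ξ‖))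
    rw [← integral_const_mul]
    exact setIntegral_mono_on (hint n).norm (hv.norm.const_mul _) hm (hle n)
  have h := hasSum_integral_of_summable_integral_norm hint hsum
  rwa [setIntegral_congr_fun hm fun ξ hξ => ?_] at h
  rw [tsum_mul_left, tsum_geometric_of_norm_lt_one ((hb ξ hξ).trans_lt hρ)]

/-- The expansion of the Cauchy transform in a disc disjoint from the domain. -/
theorem hasSum_cauchyTransform_of_ball {A : Set ℂ} (hA : Bornology.IsBounded A)
    (hm : MeasurableSet A) {a z : ℂ} {r : ℝ} (hz : z ∈ Metric.ball a r)
    (hd : ∀ ξ ∈ A, ξ ∉ Metric.ball a r) :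
    HasSum (fun n : ℕ => -(Real.pi : ℂ)⁻¹ * (z - a) ^ n * ∫ ξ in A, ((ξ - a) ^ (n + 1))⁻¹)
      (cauchyTransform A z) := by
  rw [Metric.mem_ball, dist_eq_norm] at hz
  have hr : 0 < r := (norm_nonneg _).trans_lt hz
  have hd' : ∀ ξ ∈ A, r ≤ ‖ξ - a‖ := fun ξ hξ => by
    simpa [Metric.mem_ball, dist_eq_norm] using hd ξ hξ
  have h := hasSum_integral_mul_pow hm (u := fun ξ => (z - a) * (ξ - a)⁻¹)
    (v := fun ξ => (a - ξ)⁻¹) (by fun_prop) (integrableOn_inv_sub hA a)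
    (ρ := ‖z - a‖ / r) (by positivity) ((div_lt_one hr).2 hz) (fun ξ hξ => by
      rw [norm_mul, norm_inv, div_eq_mul_inv]
      exact mul_le_mul_of_nonneg_left (inv_anti₀ hr (hd' ξ hξ)) (norm_nonneg _))
  have h2 := h.mul_left (Real.pi : ℂ)⁻¹
  have e1 : ∫ ξ in A, (a - ξ)⁻¹ * (1 - (z - a) * (ξ - a)⁻¹)⁻¹ = ∫ ξ in A, (z - ξ)⁻¹ := by
    refine setIntegral_congr_fun hm fun ξ hξ => ?_
    have h3 : ξ - a ≠ 0 := norm_pos_iff.1 (hr.trans_le (hd' ξ hξ))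
    rw [← mul_inv]
    congr 1
    field_simp
    ring
  rw [e1] at h2
  suffices e2 : ∀ n : ℕ, (Real.pi : ℂ)⁻¹ * (∫ ξ in A, (a - ξ)⁻¹ * ((z - a) * (ξ - a)⁻¹) ^ n) =
      -(Real.pi : ℂ)⁻¹ * (z - a) ^ n * ∫ ξ in A, ((ξ - a) ^ (n + 1))⁻¹ by
    simp only [e2] at h2
    exact h2
  intro n
  rw [← integral_const_mul, ← integral_const_mul]
  refine setIntegral_congr_fun hm fun ξ hξ => ?_
  have h3 : ξ - a ≠ 0 := norm_pos_iff.1 (hr.trans_le (hd' ξ hξ))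
  rw [← neg_sub ξ a, mul_pow, inv_pow]
  field_simp
  ring

/-- The expansion of the Cauchy transform at infinity. -/
theorem hasSum_cauchyTransform_of_lt {A : Set ℂ} (hm : MeasurableSet A) {a z : ℂ} {r : ℝ}
    (hr : 0 ≤ r) (hz : r < ‖z - a‖) (hd : A ⊆ Metric.closedBall a r) :
    HasSum (fun n : ℕ => (Real.pi : ℂ)⁻¹ * ((z - a) ^ (n + 1))⁻¹ * ∫ ξ in A, (ξ - a) ^ n)
      (cauchyTransform A z) := by
  have hA : Bornology.IsBounded A := Metric.isBounded_closedBall.subset hd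
  have hz0 : 0 < ‖z - a‖ := hr.trans_lt hz
  have h3 : z - a ≠ 0 := norm_pos_iff.1 hz0
  have h := hasSum_integral_mul_pow hm (u := fun ξ => (z - a)⁻¹ * (ξ - a))
    (v := fun _ => (z - a)⁻¹) (by fun_prop) (integrableOn_const hA.measure_lt_top.ne)
    (ρ := r / ‖z - a‖) (by positivity) ((div_lt_one hz0).2 hz) (fun ξ hξ => by
      rw [norm_mul, norm_inv, div_eq_inv_mul]
      have : ‖ξ - a‖ ≤ r := by simpa [dist_eq_norm] using hd hξ
      gcongr)
  have h2 := h.mul_left (Real.pi : ℂ)⁻¹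
  have e1 : ∫ ξ in A, (z - a)⁻¹ * (1 - (z - a)⁻¹ * (ξ - a))⁻¹ = ∫ ξ in A, (z - ξ)⁻¹ := by
    refine setIntegral_congr_fun hm fun ξ hξ => ?_
    rw [← mul_inv]
    congr 1
    field_simp
    ring
  rw [e1] at h2
  suffices e2 : ∀ n : ℕ, (Real.pi : ℂ)⁻¹ * (∫ ξ in A, (z - a)⁻¹ * ((z - a)⁻¹ * (ξ - a)) ^ n) =
      (Real.pi : ℂ)⁻¹ * ((z - a) ^ (n + 1))⁻¹ * ∫ ξ in A, (ξ - a) ^ n by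
    simp only [e2] at h2
    exact h2
  intro n
  rw [mul_assoc]
  congr 1
  rw [← integral_const_mul]
  refine setIntegral_congr_fun hm fun ξ hξ => ?_
  rw [mul_pow, ← mul_assoc, inv_pow, ← mul_inv, ← pow_succ']

/-- If the inner patch is a disc, then the relative field is circular about its centre, and so the
outer patch is a concentric disc. -/
theorem IsC1JordanDomain.eq_ball_of_isWeaklyTangent_of_ball {D₁ : Set ℂ} (hD : IsC1JordanDomain D₁)
    {a : ℂ} {r : ℝ} (hr : 0 < r) (hsub : Metric.ball a r ⊆ D₁) {α : ℝ} (hα : α ≠ 1) {Ω : ℝ} {c : ℂ}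
    (h₁ : IsWeaklyTangent D₁ (relField D₁ (Metric.ball a r) α Ω c))
    (h₂ : IsWeaklyTangent (Metric.ball a r) (relField D₁ (Metric.ball a r) α Ω c)) :
    ∃ R > 0, D₁ = Metric.ball a R := by
  have hb := hD.isBounded
  have hm := hD.isOpen.measurableSet
  have hmB : MeasurableSet (Metric.ball a r) := Metric.isOpen_ball.measurableSet
  have hbB : Bornology.IsBounded (Metric.ball a r) := Metric.isBounded_ball
  have haD : a ∈ D₁ := hsub (Metric.mem_ball_self hr)
  have hpi : (Real.pi : ℂ) ≠ 0 := by exact_mod_cast Real.pi_ne_zero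
  have hr' : (r : ℂ) ≠ 0 := by exact_mod_cast hr.ne'
  have hQc := continuous_relField hb hbB α Ω c
  set B := Metric.ball a r with hB
  set A := D₁ \ B with hA
  set κ : ℂ := 2 * Ω * (starRingEnd ℂ) (a - c) with hκ
  have hbA : Bornology.IsBounded A := hb.subset Set.sdiff_subset
  have hmA : MeasurableSet A := hm.diff hmB
  have hcc : ∀ z, (starRingEnd ℂ) (z - c) = (starRingEnd ℂ) (z - a) + (starRingEnd ℂ) (a - c) :=
    fun z => by rw [← map_add]; congr 1; ring
  have hQB : ∀ z ∈ B, relField D₁ B α Ω c z =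
      cauchyTransform A z + ((α - 2 * Ω) * (starRingEnd ℂ) (z - a) - κ) := fun z hz => by
    rw [relField, cauchyTransform_diff_add hb hmB hsub z, cauchyTransform_ball_of_mem hr hz, hcc,
      hκ]
    ring
  -- The pairing with the gradient of `conj (z - a) ^ (n + 1)` over the inner disc.
  have hmom : ∀ n : ℕ, ∫ ξ in A, ((ξ - a) ^ (n + 1))⁻¹ =
      if n = 0 then -Real.pi * κ else 0 := by
    intro n
    have h1 := h₂.integral_monomial hbB hQc a 0 (n + 1)
    have h2 : ∫ z in B, (starRingEnd ℂ) (z - a) ^ n * cauchyTransform A z =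
        κ * ∫ z in B, (starRingEnd ℂ) (z - a) ^ n := by
      have hc1 : Continuous fun z => (starRingEnd ℂ) (z - a) := (contDiff_conj_sub a).continuous
      have hi : ∀ {f : ℂ → ℂ}, Continuous f → IntegrableOn f B := fun hf =>
        (hf.continuousOn.integrableOn_compact (isCompact_closedBall a r)).mono_set
          Metric.ball_subset_closedBall
      have hcA := continuous_cauchyTransform hbA
      have h3 : ∫ z in B, ((starRingEnd ℂ) (z - a) ^ n * cauchyTransform A z +
          ((α - 2 * Ω) * (starRingEnd ℂ) (z - a) ^ (n + 1) -
            κ * (starRingEnd ℂ) (z - a) ^ n)) = 0 := by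
        have h4 := congrArg (fun w => (n + 1 : ℂ)⁻¹ * w) h1
        simp only [mul_zero] at h4
        rw [← integral_const_mul] at h4
        rw [← h4]
        refine setIntegral_congr_fun hmB fun z hz => ?_
        have : (n + 1 : ℂ) ≠ 0 := by exact_mod_cast n.succ_ne_zero
        simp only [hQB z hz]
        push_cast
        simp only [pow_zero, mul_one, zero_mul, sub_zero]
        field_simp
        ring
      rw [integral_add (hi (by fun_prop)) (hi (by fun_prop)), integral_sub (hi (by fun_prop))
        (hi (by fun_prop)), integral_const_mul, integral_const_mul,
        integral_ball_conj_pow n.succ_ne_zero, mul_zero, zero_sub] at h3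
      linear_combination h3
    rw [integral_mul_cauchyTransform hbB hbA (h := fun z => (starRingEnd ℂ) (z - a) ^ n)
      ((contDiff_conj_sub a).continuous.pow n),
      setIntegral_congr_fun hmA fun ξ hξ => integral_ball_conj_pow_mul_inv_of_notMem n hr hξ.2,
      integral_const_mul] at h2
    have hn : (n + 1 : ℂ) ≠ 0 := by exact_mod_cast n.succ_ne_zero
    split_ifs with h0
    · subst h0
      have h5 : ∫ z in B, (starRingEnd ℂ) (z - a) ^ 0 = Real.pi * r ^ 2 := by
        simp [Measure.real, hB, Complex.volume_ball, hr.le, mul_comm]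
      rw [h5] at h2
      simp only [mul_zero, zero_add, pow_one, Nat.cast_zero, div_one] at h2 ⊢
      field_simp at h2
      simp only [one_div] at h2
      linear_combination -h2
    · rw [integral_ball_conj_pow h0, mul_zero] at h2
      simpa [hpi, hr', hn] using h2
  have hCA : ∀ z ∈ B, cauchyTransform A z = κ := fun z hz => by
    refine (hasSum_cauchyTransform_of_ball hbA hmA hz fun ξ hξ => hξ.2).unique ?_
    simp only [hmom]
    convert hasSum_ite_eq 0 κ using 2 with n
    split_ifs with h
    · subst h; field_simp
    · simp
  have hC₁ : ∀ z ∈ D₁, cauchyTransform D₁ z - (starRingEnd ℂ) z = κ - (starRingEnd ℂ) a := by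
    have han := (differentiableOn_cauchyTransform_sub_conj hb hD.isOpen).analyticOnNhd hD.isOpen
    refine han.eqOn_of_preconnected_of_eventuallyEq analyticOnNhd_const
      hD.simplyConnected.isPathConnected.isConnected.isPreconnected haD ?_
    filter_upwards [Metric.ball_mem_nhds a hr] with z hz
    rw [cauchyTransform_diff_add hb hmB hsub z, cauchyTransform_ball_of_mem hr hz, hCA z hz,
      map_sub]
    ring
  -- The maximum with `r` unites the formulas for the Cauchy transform of the disc inside and
  -- outside of it.
  set q : ℝ → ℝ := fun ρ => (1 - 2 * Ω) + (α - 1) * (r ^ 2 / max r ρ ^ 2) with hq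
  have hmax : ∀ ρ, max r ρ ^ 2 ≠ 0 := fun ρ => (pow_pos (lt_max_of_lt_left hr) 2).ne'
  have hQ : ∀ z ∈ D₁, relField D₁ B α Ω c z = q ‖z - a‖ * (starRingEnd ℂ) (z - a) := by
    intro z hz
    have hCB : cauchyTransform B z =
        ((r ^ 2 / max r ‖z - a‖ ^ 2 : ℝ) : ℂ) * (starRingEnd ℂ) (z - a) := by
      by_cases hzB : z ∈ B
      · have : ‖z - a‖ ≤ r := by
          have := hzB; rw [hB, Metric.mem_ball, dist_eq_norm] at this; exact this.le
        rw [cauchyTransform_ball_of_mem hr hzB, max_eq_left this, div_self (pow_ne_zero 2 hr.ne')]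
        simp
      · have h1 : r ≤ ‖z - a‖ := by
          have := hzB; rw [hB, Metric.mem_ball, dist_eq_norm, not_lt] at this; exact this
        have h2 : z - a ≠ 0 := norm_pos_iff.1 (hr.trans_le h1)
        rw [cauchyTransform_ball_of_notMem hr hzB, max_eq_right h1]
        push_cast
        rw [← Complex.mul_conj']
        have h3 : (starRingEnd ℂ) (z - a) ≠ 0 := (map_ne_zero _).2 h2
        field_simp
    have h1 := hC₁ z hz
    rw [relField, hCB, hcc]
    have h2 : cauchyTransform D₁ z = (starRingEnd ℂ) (z - a) + κ := by
      rw [map_sub]; linear_combination h1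
    rw [h2, hκ, hq]
    push_cast
    ring
  refine hD.eq_ball_of_tangent_circular haD (q := q)
    (ρc := Real.sqrt ((α - 1) * r ^ 2 / (2 * Ω - 1))) ?_ ?_ ?_
  · exact continuous_const.add (continuous_const.mul (continuous_const.div
      ((continuous_const.max continuous_id).pow 2) hmax))
  · intro z hz h0
    have h1 : r ≤ ‖z - a‖ := by
      have : z ∉ B := fun h => hz (hsub h)
      rwa [hB, Metric.mem_ball, dist_eq_norm, not_lt] at this
    have hpos : 0 < ‖z - a‖ := hr.trans_le h1
    simp only [hq, max_eq_right h1] at h0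
    have hα' : α - 1 ≠ 0 := sub_ne_zero.2 hα
    have h2 : (2 * Ω - 1) * ‖z - a‖ ^ 2 = (α - 1) * r ^ 2 := by
      field_simp at h0
      linarith
    have h3 : 2 * Ω - 1 ≠ 0 := fun h => by
      rw [h, zero_mul] at h2
      exact mul_ne_zero hα' (pow_ne_zero 2 hr.ne') h2.symm
    rw [← h2, mul_div_cancel_left₀ _ h3, Real.sqrt_sq hpos.le]
  · intro g hg _
    have h1 := h₁ g hg
    have h2 : ∀ z ∈ D₁, fderiv ℝ g z (Complex.I / 2 * (starRingEnd ℂ) (relField D₁ B α Ω c z)) =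
        2⁻¹ * (q ‖z - a‖ * fderiv ℝ g z (Complex.I * (z - a))) := by
      intro z hz
      have : Complex.I / 2 * (starRingEnd ℂ) (relField D₁ B α Ω c z) =
          (2⁻¹ * q ‖z - a‖ : ℝ) • (Complex.I * (z - a)) := by
        rw [hQ z hz, map_mul, Complex.conj_conj, Complex.conj_ofReal, Complex.real_smul]
        push_cast
        ring
      rw [this, map_smul, smul_eq_mul, mul_assoc]
    rw [setIntegral_congr_fun hm h2, integral_const_mul] at h1
    simpa using h1

end InnerDisc

/-! ### Cauchy transforms with two terms at infinity -/

section TwoTerms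

open scoped ContDiff

theorem HasWeakDbar.pow {F f : ℂ → ℂ} (h : HasWeakDbar F f) (k : ℕ) :
    HasWeakDbar (fun z => F z ^ (k + 1)) (fun z => (k + 1) * F z ^ k * f z) := by
  induction k with
  | zero => simpa using h
  | succ k ih =>
    have h1 := ih.mul h
    simp only [← pow_succ] at h1
    refine h1.congr fun z => ?_
    push_cast
    ring

section Moments

variable {D : Set ℂ} {a p₀ p₁ : ℂ}

/-- The function `(z - a)² C_D(z) - (p₀ (z - a) + p₁)`. That it vanishes off `D` means that the
Cauchy transform of `D` is `p₀ / (z - a) + p₁ / (z - a)²` there; on `D` it measures the deviation of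
the Cauchy transform from that sum. -/
noncomputable def schwarzDefect (D : Set ℂ) (a p₀ p₁ z : ℂ) : ℂ :=
  (z - a) ^ 2 * cauchyTransform D z - (p₀ * (z - a) + p₁)

theorem hasWeakDbar_schwarzDefect (hm : MeasurableSet D) (hb : Bornology.IsBounded D)
    (a p₀ p₁ : ℂ) :
    HasWeakDbar (schwarzDefect D a p₀ p₁) (D.indicator fun z => (z - a) ^ 2) := by
  have hc : ∀ (f : ℂ → ℂ), ContDiff ℝ ∞ f → Differentiable ℂ f → HasWeakDbar f (fun _ => 0) :=
    fun f hf hd => (HasWeakDbar.of_contDiff hf).congr fun z =>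
      dbar_eq_zero_of_differentiableAt (hd z)
  have h1 := hc (fun z => (z - a) ^ 2) (by fun_prop) (by fun_prop)
  have h2 := hc (fun z => p₀ * (z - a) + p₁) (by fun_prop) (by fun_prop)
  refine ((h1.mul (hasWeakDbar_cauchyTransform hm hb)).sub h2).congr fun z => ?_
  by_cases h : z ∈ D <;> simp [h]

/-- If `(z - a)² C_D(z) = p₀ (z - a) + p₁` off `D`, then with `K` the difference of the two sides
and `B = (z - a)² conj (z - a)` the function `B ^ (k + 1) - (B - K) ^ (k + 1)` vanishes off `D`, and
its `∂/∂z̄` derivative is a monomial on `D`. -/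
theorem hasWeakDbar_pow_sub_pow (hm : MeasurableSet D) (hb : Bornology.IsBounded D)
    (h : ∀ z ∉ D, schwarzDefect D a p₀ p₁ z = 0) (k : ℕ) :
    HasWeakDbar (fun z => ((z - a) ^ 2 * (starRingEnd ℂ) (z - a) ^ 1) ^ (k + 1) -
        ((z - a) ^ 2 * (starRingEnd ℂ) (z - a) ^ 1 - schwarzDefect D a p₀ p₁ z) ^ (k + 1))
      (D.indicator fun z => (k + 1) * ((z - a) ^ (2 * k + 2) * (starRingEnd ℂ) (z - a) ^ k)) := by
  have hB := (HasWeakDbar.of_contDiff (contDiff_monomial a 2 1)).congr (dbar_monomial a 2 1)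
  refine ((hB.pow k).sub ((hB.sub (hasWeakDbar_schwarzDefect hm hb a p₀ p₁)).pow k)).congr
    fun z => ?_
  by_cases hz : z ∈ D
  · simp [hz, -map_sub]
    rw [mul_pow, ← pow_mul]
    ring
  · simp [hz, h z hz]

/-- The pairing of `hasWeakDbar_pow_sub_pow` with the holomorphic function `(z - a) ^ i`. -/
theorem integral_monomial_eq_zero (hm : MeasurableSet D) (hb : Bornology.IsBounded D)
    (h : ∀ z ∉ D, schwarzDefect D a p₀ p₁ z = 0) (k i : ℕ) :
    ∫ z in D, (z - a) ^ (2 * k + 2 + i) * (starRingEnd ℂ) (z - a) ^ k = 0 := by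
  obtain ⟨R, hR⟩ := hb.subset_closedBall 0
  have hout : ∀ z : ℂ, R < ‖z‖ → z ∉ D := fun z hz hzD => by
    have := hR hzD
    rw [mem_closedBall_zero_iff] at this
    exact absurd hz this.not_gt
  have h1 := (hasWeakDbar_pow_sub_pow hm hb h k).integral_mul_dbar_of_contDiff (R := R)
    (fun z hz => by rw [h z (hout z hz)]; simp) (fun z hz => by simp [hout z hz])
    (φ := fun z => (z - a) ^ i) (by fun_prop)
  have h2 : ∀ z, dbar (fun z : ℂ => (z - a) ^ i) z = 0 := fun z =>
    dbar_eq_zero_of_differentiableAt (by fun_prop)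
  simp only [h2, mul_zero, integral_zero] at h1
  have h3 : ∀ z, D.indicator (fun z => (k + 1) * ((z - a) ^ (2 * k + 2) *
      (starRingEnd ℂ) (z - a) ^ k)) z * (z - a) ^ i = (k + 1) * D.indicator (fun z =>
        (z - a) ^ (2 * k + 2 + i) * (starRingEnd ℂ) (z - a) ^ k) z := fun z => by
    by_cases hz : z ∈ D
    · simp [hz]; ring
    · simp [hz]
  simp only [h3] at h1
  rw [integral_const_mul, integral_indicator hm, zero_eq_neg] at h1
  exact (mul_eq_zero.1 h1).resolve_left (by exact_mod_cast k.succ_ne_zero)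

/-- The lowest moment that does not vanish, from the Cauchy–Pompeiu formula at `a`. -/
theorem integral_monomial_five_two (hm : MeasurableSet D) (hb : Bornology.IsBounded D)
    (h : ∀ z ∉ D, schwarzDefect D a p₀ p₁ z = 0) :
    ∫ z in D, (z - a) ^ 5 * (starRingEnd ℂ) (z - a) ^ 2 = Real.pi / 3 * p₁ ^ 3 := by
  obtain ⟨R, hR⟩ := hb.subset_closedBall 0
  have hout : ∀ z : ℂ, R < ‖z‖ → z ∉ D := fun z hz hzD => by
    have := hR hzD
    rw [mem_closedBall_zero_iff] at this
    exact absurd hz this.not_gt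
  have h1 := (hasWeakDbar_pow_sub_pow hm hb h 2).integral_mul_inv (R := R)
    (fun z hz => by rw [h z (hout z hz)]; simp) (fun z hz => by simp [hout z hz]) a
  have h3 : ∀ z, D.indicator (fun z => (((2 : ℕ) : ℂ) + 1) * ((z - a) ^ (2 * 2 + 2) *
      (starRingEnd ℂ) (z - a) ^ 2)) z * (z - a)⁻¹ = 3 * D.indicator (fun z =>
        (z - a) ^ 5 * (starRingEnd ℂ) (z - a) ^ 2) z := fun z => by
    by_cases hz : z ∈ D
    · by_cases hza : z - a = 0
      · simp [hza]
      · simp [hz]; field_simp; ring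
    · simp [hz]
  simp only [h3] at h1
  rw [integral_const_mul, integral_indicator hm] at h1
  simp only [schwarzDefect, sub_self] at h1
  linear_combination h1 / 3

theorem integral_schwarzDefect_mul_dbar (hm : MeasurableSet D) (hb : Bornology.IsBounded D)
    (h : ∀ z ∉ D, schwarzDefect D a p₀ p₁ z = 0) {φ : ℂ → ℂ} (hφ : ContDiff ℝ ∞ φ) :
    ∫ z in D, schwarzDefect D a p₀ p₁ z * dbar φ z = -∫ z in D, (z - a) ^ 2 * φ z := by
  obtain ⟨R, hR⟩ := hb.subset_closedBall 0
  have hout : ∀ z : ℂ, R < ‖z‖ → z ∉ D := fun z hz hzD => by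
    have := hR hzD
    rw [mem_closedBall_zero_iff] at this
    exact absurd hz this.not_gt
  have h1 := (hasWeakDbar_schwarzDefect hm hb a p₀ p₁).integral_mul_dbar_of_contDiff (R := R)
    (fun z hz => h z (hout z hz)) (fun z hz => by simp [hout z hz]) hφ
  rw [setIntegral_eq_integral_of_forall_compl_eq_zero fun z hz => by rw [h z hz, zero_mul], h1,
    ← integral_indicator hm]
  congr 2
  funext z
  by_cases hz : z ∈ D <;> simp [hz]

end Moments

/-- If the complex moments of order at least two vanish, the Cauchy transform off `D` is the sum of
its first two terms at infinity. -/
theorem IsC1JordanDomain.schwarzDefect_eq_zero {D : Set ℂ} (hD : IsC1JordanDomain D) {a : ℂ}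
    (h : ∀ n : ℕ, 2 ≤ n → ∫ ξ in D, (ξ - a) ^ n = 0) :
    ∀ z ∉ D, schwarzDefect D a ((Real.pi : ℂ)⁻¹ * ∫ ξ in D, (ξ - a) ^ 0)
      ((Real.pi : ℂ)⁻¹ * ∫ ξ in D, (ξ - a) ^ 1) z = 0 := by
  set p₀ := (Real.pi : ℂ)⁻¹ * ∫ ξ in D, (ξ - a) ^ 0 with hp₀
  set p₁ := (Real.pi : ℂ)⁻¹ * ∫ ξ in D, (ξ - a) ^ 1 with hp₁
  have hb := hD.isBounded
  have hm := hD.isOpen.measurableSet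
  have hK := hasWeakDbar_schwarzDefect hm hb a p₀ p₁
  obtain ⟨r, hr⟩ := hb.subset_closedBall a
  have hr' : D ⊆ Metric.closedBall a (max r 0) :=
    hr.trans (Metric.closedBall_subset_closedBall (le_max_left _ _))
  have hfar : ∀ z, max r 0 < ‖z - a‖ → schwarzDefect D a p₀ p₁ z = 0 := by
    intro z hz
    have hz0 : z - a ≠ 0 := norm_pos_iff.1 ((le_max_right _ _).trans_lt hz)
    have h1 := hasSum_cauchyTransform_of_lt hm (le_max_right r 0) hz hr'
    have h2 := hasSum_sum_of_ne_finset_zero (L := SummationFilter.unconditional ℕ)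
      (s := Finset.range 2)
      (f := fun n : ℕ => (Real.pi : ℂ)⁻¹ * ((z - a) ^ (n + 1))⁻¹ * ∫ ξ in D, (ξ - a) ^ n)
      (fun n hn => by
        rw [h n (by simpa [Nat.lt_iff_add_one_le] using hn), mul_zero])
    rw [schwarzDefect, h1.unique h2, Finset.sum_range_succ, Finset.sum_range_one, hp₀, hp₁]
    field_simp
    ring
  have hUo : IsOpen (closure D)ᶜ := isClosed_closure.isOpen_compl
  have hhol : DifferentiableOn ℂ (schwarzDefect D a p₀ p₁) (closure D)ᶜ := by
    refine DifferentiableOn.sub (DifferentiableOn.mul (by fun_prop)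
      (differentiableOn_cauchyTransform hb hm hUo ?_)) (by fun_prop)
    exact (Set.disjoint_compl_left_iff_subset.2 subset_closure)
  have hclosure : Metric.closedBall a (max r 0) ⊇ closure D :=
    closure_minimal hr' Metric.isClosed_closedBall
  have hU : ∀ z ∈ (closure D)ᶜ, schwarzDefect D a p₀ p₁ z = 0 := by
    have hz₀ : ∀ z, max r 0 < ‖z - a‖ → z ∈ (closure D)ᶜ := fun z hz hzD => by
      have := hclosure hzD
      rw [Metric.mem_closedBall, dist_eq_norm] at this
      exact absurd hz this.not_gt
    set z₀ : ℂ := a + ((max r 0 + 1 : ℝ) : ℂ) with hz₀d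
    have hz₀n : max r 0 < ‖z₀ - a‖ := by
      rw [hz₀d, add_sub_cancel_left, Complex.norm_real, Real.norm_eq_abs]
      exact (lt_add_one _).trans_le (le_abs_self _)
    refine (hhol.analyticOnNhd hUo).eqOn_of_preconnected_of_eventuallyEq analyticOnNhd_const
      hD.isPreconnected_exterior (hz₀ z₀ hz₀n) ?_
    have ho : IsOpen {z : ℂ | max r 0 < ‖z - a‖} := isOpen_lt (by fun_prop) (by fun_prop)
    filter_upwards [ho.mem_nhds hz₀n] with z hz using hfar z hz
  -- The complement of `D` is the closure of the exterior, as the exterior has the same boundary.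
  have hcl : closure (closure D)ᶜ ⊆ {z | schwarzDefect D a p₀ p₁ z = 0} :=
    closure_minimal hU (isClosed_eq hK.continuous continuous_const)
  intro z hz
  refine hcl ?_
  by_cases hzc : z ∈ closure D
  · have : z ∈ frontier (closure D)ᶜ := by
      rw [hD.frontier_exterior, hD.isOpen.frontier_eq]
      exact ⟨hzc, hz⟩
    exact frontier_subset_closure this
  · exact subset_closure hzc

end TwoTerms

/-! ### A discal outer patch -/

section OuterDisc

open scoped ContDiff

theorem continuous_schwarzDefect {D : Set ℂ} (hb : Bornology.IsBounded D) (a p₀ p₁ : ℂ) :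
    Continuous (schwarzDefect D a p₀ p₁) := by
  have := continuous_cauchyTransform hb
  unfold schwarzDefect
  fun_prop

/-- The moment identities for the inner patch when the outer patch is a disc. -/
theorem moments_of_isWeaklyTangent_ball {D : Set ℂ} (hb : Bornology.IsBounded D)
    (hm : MeasurableSet D) {a : ℂ} {R : ℝ} (hR : 0 < R) (hsub : D ⊆ Metric.ball a R) {α : ℝ}
    (hα : α ≠ 1) {Ω : ℝ} {c : ℂ}
    (h : IsWeaklyTangent (Metric.ball a R) (relField (Metric.ball a R) D α Ω c)) :
    (∀ n : ℕ, 2 ≤ n → ∫ ξ in D, (ξ - a) ^ n = 0) ∧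
      -((α - 1) * (starRingEnd ℂ) (∫ ξ in D, (ξ - a) ^ 1)) =
        2 * Ω * (starRingEnd ℂ) (a - c) * (Real.pi * R ^ 2) := by
  have hmB : MeasurableSet (Metric.ball a R) := Metric.isOpen_ball.measurableSet
  have hbB : Bornology.IsBounded (Metric.ball a R) := Metric.isBounded_ball
  have hpi : (Real.pi : ℂ) ≠ 0 := by exact_mod_cast Real.pi_ne_zero
  have hα' : (α - 1 : ℂ) ≠ 0 := by exact_mod_cast sub_ne_zero.2 hα
  have hQc := continuous_relField hbB hb α Ω c
  set B := Metric.ball a R with hB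
  set κ : ℂ := 2 * Ω * (starRingEnd ℂ) (a - c) with hκ
  have hcc : ∀ z, (starRingEnd ℂ) (z - c) = (starRingEnd ℂ) (z - a) + (starRingEnd ℂ) (a - c) :=
    fun z => by rw [← map_add]; congr 1; ring
  have hQB : ∀ z ∈ B, relField B D α Ω c z =
      (α - 1) * cauchyTransform D z + ((1 - 2 * Ω) * (starRingEnd ℂ) (z - a) - κ) := fun z hz => by
    rw [relField, cauchyTransform_ball_of_mem hR hz, hcc, hκ]
    ring
  -- The pairing with the gradient of `conj (z - a) ^ (n + 1)` over the outer disc.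
  have hmom : ∀ n : ℕ, -((α - 1) / (n + 1) * (starRingEnd ℂ) (∫ ξ in D, (ξ - a) ^ (n + 1))) =
      κ * ∫ z in B, (starRingEnd ℂ) (z - a) ^ n := by
    intro n
    have hn : (n + 1 : ℂ) ≠ 0 := by exact_mod_cast n.succ_ne_zero
    have h1 := h.integral_monomial hbB hQc a 0 (n + 1)
    have hc1 : Continuous fun z => (starRingEnd ℂ) (z - a) := (contDiff_conj_sub a).continuous
    have hi : ∀ {f : ℂ → ℂ}, Continuous f → IntegrableOn f B := fun hf =>
      (hf.continuousOn.integrableOn_compact (isCompact_closedBall a R)).mono_set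
        Metric.ball_subset_closedBall
    have hcA := continuous_cauchyTransform hb
    have h3 : ∫ z in B, ((α - 1) * ((starRingEnd ℂ) (z - a) ^ n * cauchyTransform D z) +
        ((1 - 2 * Ω) * (starRingEnd ℂ) (z - a) ^ (n + 1) -
          κ * (starRingEnd ℂ) (z - a) ^ n)) = 0 := by
      have h4 := congrArg (fun w => (n + 1 : ℂ)⁻¹ * w) h1
      simp only [mul_zero] at h4
      rw [← integral_const_mul] at h4
      rw [← h4]
      refine setIntegral_congr_fun hmB fun z hz => ?_
      simp only [hQB z hz]
      push_cast
      simp only [pow_zero, mul_one, zero_mul, sub_zero]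
      field_simp
      ring
    rw [integral_add (hi (by fun_prop)) (hi (by fun_prop)), integral_sub (hi (by fun_prop))
      (hi (by fun_prop)), integral_const_mul, integral_const_mul, integral_const_mul,
      integral_ball_conj_pow n.succ_ne_zero, mul_zero, zero_sub,
      integral_mul_cauchyTransform hbB hb (h := fun z => (starRingEnd ℂ) (z - a) ^ n) (hc1.pow n),
      setIntegral_congr_fun hm fun ξ hξ => integral_ball_conj_pow_mul_inv_of_mem n hR (hsub hξ),
      integral_const_mul] at h3
    have h5 : (starRingEnd ℂ) (∫ ξ in D, (ξ - a) ^ (n + 1)) =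
        ∫ ξ in D, (starRingEnd ℂ) (ξ - a) ^ (n + 1) := by
      rw [← integral_conj]
      simp only [map_pow]
    rw [h5]
    field_simp at h3 ⊢
    linear_combination h3
  refine ⟨fun n hn => ?_, ?_⟩
  · obtain ⟨k, rfl⟩ : ∃ k, n = k + 1 := ⟨n - 1, by omega⟩
    have hk : (k + 1 : ℂ) ≠ 0 := by exact_mod_cast k.succ_ne_zero
    have h1 := hmom k
    rw [integral_ball_conj_pow (by omega), mul_zero, neg_eq_zero] at h1
    exact (map_eq_zero _).1 ((mul_eq_zero.1 h1).resolve_left (div_ne_zero hα' hk))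
  · have h1 := hmom 0
    have h5 : ∫ z in B, (starRingEnd ℂ) (z - a) ^ 0 = Real.pi * R ^ 2 := by
      simp [Measure.real, hB, Complex.volume_ball, hR.le, mul_comm]
    rw [h5] at h1
    simpa using h1

/-- If the outer patch is a disc about `a`, the field `Q` has on the inner patch `D` the form in
`hQ`, with `p₁` the first moment of `D` about `a` up to a factor. The first moment then vanishes: in
the pairing of `Q` with the gradient of `(z - a)⁶ conj (z - a)²` all terms are zero except for
`-6 β p₁ ∫_D (z - a)⁵ conj (z - a)²`, which is a nonzero multiple of `p₁⁴`. -/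
theorem firstMoment_eq_zero {D : Set ℂ} (hb : Bornology.IsBounded D) (hm : MeasurableSet D) {a : ℂ}
    {Q : ℂ → ℂ} (hQc : Continuous Q) (h : IsWeaklyTangent D Q) {p₀ p₁ : ℂ}
    (hdef : ∀ z ∉ D, schwarzDefect D a p₀ p₁ z = 0) {s t β : ℝ} (hβ : β ≠ 0)
    {μ : ℝ}
    (hQ : ∀ z ∈ D, (z - a) ^ 2 * Q z = s * ((z - a) ^ 2 * (starRingEnd ℂ) (z - a)) +
      μ * (z - a) + t * p₁ + β * (starRingEnd ℂ) p₁ * (z - a) ^ 2 +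
      t * schwarzDefect D a p₀ p₁ z) : p₁ = 0 := by
  have hi : ∀ {f : ℂ → ℂ}, Continuous f → IntegrableOn f D := fun hf =>
    (hf.continuousOn.integrableOn_compact hb.isCompact_closure).mono_set subset_closure
  have hc1 : Continuous fun z => (starRingEnd ℂ) (z - a) := (contDiff_conj_sub a).continuous
  have hKc := continuous_schwarzDefect hb a p₀ p₁
  set K := schwarzDefect D a p₀ p₁ with hK
  have hX := integral_monomial_eq_zero hm hb hdef
  have hK1 : ∫ z in D, (z - a) ^ 4 * (starRingEnd ℂ) (z - a) ^ 1 * K z = 0 := by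
    have h1 := integral_schwarzDefect_mul_dbar hm hb hdef (contDiff_monomial a 4 2)
    have h2 := hX 2 0
    simp only [dbar_monomial] at h1
    have e1 : ∀ z, (z - a) ^ 2 * ((z - a) ^ 4 * (starRingEnd ℂ) (z - a) ^ 2) =
      (z - a) ^ (2 * 2 + 2 + 0) * (starRingEnd ℂ) (z - a) ^ 2 := fun z => by ring
    have e2 : ∀ z, schwarzDefect D a p₀ p₁ z * (((2 : ℕ) : ℂ) * (z - a) ^ 4 *
      (starRingEnd ℂ) (z - a) ^ (2 - 1)) =
      2 * ((z - a) ^ 4 * (starRingEnd ℂ) (z - a) ^ 1 * K z) := fun z => by rw [hK]; push_cast; ring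
    simp only [e1, e2] at h1
    rw [h2, integral_const_mul, neg_zero] at h1
    exact (mul_eq_zero.1 h1).resolve_left two_ne_zero
  have hK2 : ∫ z in D, (z - a) ^ 5 * (starRingEnd ℂ) (K z) = 0 := by
    have h1 := congrArg (starRingEnd ℂ)
      (integral_schwarzDefect_mul_dbar hm hb hdef (contDiff_monomial a 0 6))
    have h2 := hX 2 0
    simp only [dbar_monomial] at h1
    rw [map_neg, ← integral_conj, ← integral_conj] at h1
    have e1 : ∀ z, (starRingEnd ℂ) ((z - a) ^ 2 * ((z - a) ^ 0 * (starRingEnd ℂ) (z - a) ^ 6)) =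
      (z - a) ^ (2 * 2 + 2 + 0) * (starRingEnd ℂ) (z - a) ^ 2 := fun z => by
        simp only [map_mul, map_pow, Complex.conj_conj]; ring
    have e2 : ∀ z, (starRingEnd ℂ) (schwarzDefect D a p₀ p₁ z * (((6 : ℕ) : ℂ) * (z - a) ^ 0 *
      (starRingEnd ℂ) (z - a) ^ (6 - 1))) =
      6 * ((z - a) ^ 5 * (starRingEnd ℂ) (K z)) := fun z => by
        rw [hK]
        simp only [map_mul, map_pow, Complex.conj_conj, map_natCast]
        push_cast; ring
    simp only [e1, e2] at h1
    rw [h2, integral_const_mul, neg_zero] at h1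
    exact (mul_eq_zero.1 h1).resolve_left (by norm_num)
  have h1 := h.integral_monomial hb hQc a 6 2
  have e : ∀ z ∈ D, ((2 : ℕ) : ℂ) * (z - a) ^ 6 * (starRingEnd ℂ) (z - a) ^ (2 - 1) * Q z -
      ((6 : ℕ) : ℂ) * (z - a) ^ (6 - 1) * (starRingEnd ℂ) (z - a) ^ 2 * (starRingEnd ℂ) (Q z) =
      (-4 * s) * ((z - a) ^ (2 * 2 + 2 + 0) * (starRingEnd ℂ) (z - a) ^ 2) +
      (-4 * μ) * ((z - a) ^ (2 * 1 + 2 + 1) * (starRingEnd ℂ) (z - a) ^ 1) +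
      (2 * t * p₁) * ((z - a) ^ (2 * 1 + 2 + 0) * (starRingEnd ℂ) (z - a) ^ 1) +
      (2 * β * (starRingEnd ℂ) p₁) * ((z - a) ^ (2 * 1 + 2 + 2) * (starRingEnd ℂ) (z - a) ^ 1) +
      (-6 * t * (starRingEnd ℂ) p₁) *
        ((z - a) ^ (2 * 0 + 2 + 3) * (starRingEnd ℂ) (z - a) ^ 0) +
      (2 * t) * ((z - a) ^ 4 * (starRingEnd ℂ) (z - a) ^ 1 * K z) +
      (-6 * t) * ((z - a) ^ 5 * (starRingEnd ℂ) (K z)) +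
      (-6 * β * p₁) * ((z - a) ^ 5 * (starRingEnd ℂ) (z - a) ^ 2) := by
    intro z hz
    have q1 := hQ z hz
    have q2 := congrArg (starRingEnd ℂ) q1
    simp only [map_mul, map_add, map_pow, Complex.conj_conj, Complex.conj_ofReal] at q2
    push_cast
    linear_combination 2 * (z - a) ^ 4 * (starRingEnd ℂ) (z - a) * q1 - 6 * (z - a) ^ 5 * q2
  rw [setIntegral_congr_fun hm e] at h1
  rw [integral_add (hi (by fun_prop)) (hi (by fun_prop)), integral_add (hi (by fun_prop))
    (hi (by fun_prop)), integral_add (hi (by fun_prop)) (hi (by fun_prop)),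
    integral_add (hi (by fun_prop)) (hi (by fun_prop)), integral_add (hi (by fun_prop))
    (hi (by fun_prop)), integral_add (hi (by fun_prop)) (hi (by fun_prop)),
    integral_add (hi (by fun_prop)) (hi (by fun_prop))] at h1
  simp only [integral_const_mul] at h1
  rw [hX 2 0, hX 1 1, hX 1 0, hX 1 2, hX 0 3, hK1, hK2, integral_monomial_five_two hm hb hdef] at h1
  simp only [mul_zero, zero_add] at h1
  have hpi : (Real.pi : ℂ) ≠ 0 := by exact_mod_cast Real.pi_ne_zero
  have hβ' : (β : ℂ) ≠ 0 := by exact_mod_cast hβ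
  by_contra hp
  have : -6 * (β : ℂ) * p₁ * (Real.pi / 3 * p₁ ^ 3) ≠ 0 := by
    simp [hβ', hp, hpi]
  exact this h1

/-- With vanishing first moment, `(z - a) C_D` is constant off `D`, which forces `a ∈ D`. -/
theorem mem_of_schwarzDefect_eq_zero {D : Set ℂ} (hD : IsC1JordanDomain D) {a p₀ : ℂ} (hp₀ : p₀ ≠ 0)
    (h : ∀ z ∉ D, schwarzDefect D a p₀ 0 z = 0) : a ∈ D := by
  by_contra ha
  have hUo : IsOpen (closure D)ᶜ := isClosed_closure.isOpen_compl
  have hcl : IsClosed {z | (z - a) * cauchyTransform D z = p₀} :=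
    isClosed_eq ((continuous_id.sub continuous_const).mul
      (continuous_cauchyTransform hD.isBounded)) continuous_const
  have h1 : (closure D)ᶜ ∩ {a}ᶜ ⊆ {z | (z - a) * cauchyTransform D z = p₀} := by
    rintro z ⟨hz, hza⟩
    have h2 := h z fun h => hz (subset_closure h)
    have h3 : z - a ≠ 0 := sub_ne_zero.2 hza
    rw [schwarzDefect, add_zero] at h2
    exact mul_left_cancel₀ h3 (by linear_combination h2)
  have h2 : (closure D)ᶜ ⊆ {z | (z - a) * cauchyTransform D z = p₀} :=
    ((dense_compl_singleton a).open_subset_closure_inter hUo).trans (closure_minimal h1 hcl)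
  have h3 : a ∈ closure (closure D)ᶜ := by
    by_cases hac : a ∈ closure D
    · have : a ∈ frontier (closure D)ᶜ := by
        rw [hD.frontier_exterior, hD.isOpen.frontier_eq]
        exact ⟨hac, ha⟩
      exact frontier_subset_closure this
    · exact subset_closure hac
  have h4 := closure_minimal h2 hcl h3
  simp only [Set.mem_ofPred_eq, sub_self, zero_mul] at h4
  exact hp₀ h4.symm

/-- With vanishing first moment the relative field is circular up to a term that vanishes off `D`,
so that `D` is a disc. -/
theorem IsC1JordanDomain.eq_ball_of_schwarzDefect {D : Set ℂ} (hD : IsC1JordanDomain D) {a : ℂ}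
    {Q : ℂ → ℂ} (h : IsWeaklyTangent D Q) {p₀ : ℝ} (hp₀ : p₀ ≠ 0)
    (hdef : ∀ z ∉ D, schwarzDefect D a p₀ 0 z = 0) {s t : ℝ} (ht : t ≠ 0)
    (hQ : ∀ z ∈ D, (z - a) ^ 2 * Q z = s * ((z - a) ^ 2 * (starRingEnd ℂ) (z - a)) +
      (t * p₀) * (z - a) + t * schwarzDefect D a p₀ 0 z) : ∃ R > 0, D = Metric.ball a R := by
  have ha : a ∈ D := mem_of_schwarzDefect_eq_zero hD (by exact_mod_cast hp₀) hdef
  have hb := hD.isBounded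
  have hm := hD.isOpen.measurableSet
  have hi : ∀ {E : Type} [NormedAddCommGroup E] {f : ℂ → E}, Continuous f → IntegrableOn f D :=
    fun hf =>
    (hf.continuousOn.integrableOn_compact hb.isCompact_closure).mono_set subset_closure
  refine hD.eq_ball_of_tangent_circular ha (q := fun ρ => s * ρ ^ 4 + t * p₀ * ρ ^ 2)
    (ρc := Real.sqrt (-(t * p₀) / s)) (by fun_prop) ?_ ?_
  · intro z hz h0
    have hpos : 0 < ‖z - a‖ := norm_pos_iff.2 (sub_ne_zero.2 fun h => hz (h ▸ ha))
    have h2 : s * ‖z - a‖ ^ 2 = -(t * p₀) := by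
      have h3 : ‖z - a‖ ^ 2 * (s * ‖z - a‖ ^ 2 + t * p₀) = 0 := by linear_combination h0
      linarith [(mul_eq_zero.1 h3).resolve_left (pow_ne_zero 2 hpos.ne')]
    have h3 : s ≠ 0 := fun h => by
      rw [h, zero_mul] at h2
      exact neg_ne_zero.2 (mul_ne_zero ht hp₀) h2.symm
    rw [← h2, mul_div_cancel_left₀ _ h3, Real.sqrt_sq hpos.le]
  · intro g hg hgc
    -- With the test function `|z - a|⁴ g = (z - a)² (conj (z - a)² g)` the field enters only as
    -- `(z - a)² Q`, and the defect is paired with `∂/∂z̄` of `φ = conj (z - a)² g`. That pairing is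
    -- `-∫ |z - a|⁴ g`, so it has no imaginary part.
    have hnorm : ContDiff ℝ ∞ (fun z : ℂ => (‖z - a‖ ^ 2) ^ 2) :=
      ((contDiff_id.sub contDiff_const).norm_sq ℝ).pow 2
    have hf := hnorm.mul hg
    have hgC : ContDiff ℝ ∞ (fun w => (g w : ℂ)) := Complex.ofRealCLM.contDiff.comp hg
    have hφ : ContDiff ℝ ∞ (fun w => (starRingEnd ℂ) (w - a) ^ 2 * (g w : ℂ)) :=
      ((contDiff_conj_sub a).pow 2).mul hgC
    have hφd : Differentiable ℝ (fun w => (starRingEnd ℂ) (w - a) ^ 2 * (g w : ℂ)) :=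
      hφ.differentiable (by simp)
    have hfac : (fun w => (((‖w - a‖ ^ 2) ^ 2 * g w : ℝ) : ℂ)) =
        fun w => (w - a) ^ 2 * ((starRingEnd ℂ) (w - a) ^ 2 * (g w : ℂ)) := by
      funext w
      push_cast
      rw [← Complex.mul_conj']
      ring
    have hd1 : ∀ z, dbar (fun w => (((‖w - a‖ ^ 2) ^ 2 * g w : ℝ) : ℂ)) z =
        (z - a) ^ 2 * dbar (fun w => (starRingEnd ℂ) (w - a) ^ 2 * (g w : ℂ)) z := fun z => by
      rw [hfac, dbar_mul (by fun_prop) (hφd z),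
        dbar_eq_zero_of_differentiableAt (f := fun w => (w - a) ^ 2) (by fun_prop), mul_zero,
        add_zero]
    have hd2 : ∀ z, dbar (fun w => (starRingEnd ℂ) (w - a) ^ 2 * (g w : ℂ)) z =
        (starRingEnd ℂ) (z - a) ^ 2 * dbar (fun w => (g w : ℂ)) z +
          g z * (2 * (starRingEnd ℂ) (z - a)) := fun z => by
      have h1 := dbar_monomial a 0 2 z
      simp only [pow_zero, one_mul, mul_one] at h1
      rw [dbar_mul (((contDiff_conj_sub a).pow 2).differentiable (by simp) z)
        (hgC.differentiable (by simp) z), h1]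
      push_cast
      ring
    have h1 := h _ hf
    have hK := integral_schwarzDefect_mul_dbar hm hb hdef hφ
    have hKr : (∫ z in D, schwarzDefect D a p₀ 0 z *
        dbar (fun w => (starRingEnd ℂ) (w - a) ^ 2 * (g w : ℂ)) z).im = 0 := by
      have e : ∀ z, (z - a) ^ 2 * ((starRingEnd ℂ) (z - a) ^ 2 * (g z : ℂ)) =
          (((‖z - a‖ ^ 2) ^ 2 * g z : ℝ) : ℂ) := fun z => (congrFun hfac z).symm
      rw [hK]
      simp only [e]
      rw [integral_complex_ofReal]
      simp
    have hKi : ∫ z in D, (schwarzDefect D a p₀ 0 z *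
        dbar (fun w => (starRingEnd ℂ) (w - a) ^ 2 * (g w : ℂ)) z).im = 0 := by
      have h2 := integral_im (hi ((continuous_schwarzDefect hb a p₀ 0).mul
        (continuous_dbar (hφ.of_le (by simp)))))
      simp only [RCLike.im_to_complex] at h2
      exact h2.trans hKr
    have e : ∀ z ∈ D, fderiv ℝ (fun w => (‖w - a‖ ^ 2) ^ 2 * g w) z
        (Complex.I / 2 * (starRingEnd ℂ) (Q z)) =
        2⁻¹ * ((s * ‖z - a‖ ^ 4 + t * p₀ * ‖z - a‖ ^ 2) * fderiv ℝ g z (Complex.I * (z - a))) +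
        t * (schwarzDefect D a p₀ 0 z *
          dbar (fun w => (starRingEnd ℂ) (w - a) ^ 2 * (g w : ℂ)) z).im := by
      intro z hz
      have hgd := hg.differentiable (by simp) z
      have h2 : fderiv ℝ g z (Complex.I * (z - a)) =
          2 * ((starRingEnd ℂ) (z - a) * dbar (fun w => (g w : ℂ)) z).im := by
        rw [← fderiv_apply_eq_im_dbar_mul hgd, Complex.conj_conj]
        have : Complex.I * (z - a) = (2 : ℝ) • (Complex.I / 2 * (z - a)) := by
          rw [Complex.real_smul]; push_cast; ring
        rw [this, map_smul, smul_eq_mul]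
      rw [fderiv_apply_eq_im_dbar_mul (hf.differentiable (by simp) z), h2, hd1]
      have h3 : Q z * ((z - a) ^ 2 * dbar (fun w => (starRingEnd ℂ) (w - a) ^ 2 * (g w : ℂ)) z) =
          ((s * ‖z - a‖ ^ 4 + t * p₀ * ‖z - a‖ ^ 2 : ℝ) : ℂ) *
            ((starRingEnd ℂ) (z - a) * dbar (fun w => (g w : ℂ)) z) +
          ((2 * (s * ‖z - a‖ ^ 4 + t * p₀ * ‖z - a‖ ^ 2) * g z : ℝ) : ℂ) +
          t * (schwarzDefect D a p₀ 0 z *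
            dbar (fun w => (starRingEnd ℂ) (w - a) ^ 2 * (g w : ℂ)) z) := by
        have h4 : ((‖z - a‖ : ℝ) : ℂ) ^ 4 = ((z - a) * (starRingEnd ℂ) (z - a)) ^ 2 := by
          rw [Complex.mul_conj']; ring
        push_cast
        rw [h4, ← Complex.mul_conj']
        have h5 := hQ z hz
        have h6 := hd2 z
        linear_combination dbar (fun w => (starRingEnd ℂ) (w - a) ^ 2 * (g w : ℂ)) z * h5 +
          (s * ((z - a) ^ 2 * (starRingEnd ℂ) (z - a)) + (t * p₀) * (z - a)) * h6
      rw [h3, Complex.add_im, Complex.add_im, Complex.im_ofReal_mul, Complex.im_ofReal_mul,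
        Complex.ofReal_im]
      ring
    have hc1 := continuous_schwarzDefect hb a p₀ 0
    have hc2 := continuous_dbar (hφ.of_le (by simp : (1 : ℕ∞ω) ≤ ∞))
    have hc3 : Continuous fun z => fderiv ℝ g z (Complex.I * (z - a)) :=
      ((hg.of_le (by simp : (1 : ℕ∞ω) ≤ ∞)).continuous_fderiv (by simp)).clm_apply (by fun_prop)
    rw [setIntegral_congr_fun hm e, integral_add, integral_const_mul, integral_const_mul, hKi,
      mul_zero, add_zero] at h1
    · simpa using h1
    · exact hi (by fun_prop)
    · exact hi (continuous_const.mul (Complex.continuous_im.comp (hc1.mul hc2)))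

/-- If the outer patch is a disc, then the inner patch is a concentric disc. -/
theorem IsC1JordanDomain.eq_ball_of_isWeaklyTangent_in_ball {D : Set ℂ} (hD : IsC1JordanDomain D)
    {a : ℂ} {R : ℝ} (hR : 0 < R) (hsub : D ⊆ Metric.ball a R) {α : ℝ} (hα : α ≠ 1) {Ω : ℝ} {c : ℂ}
    (h₁ : IsWeaklyTangent (Metric.ball a R) (relField (Metric.ball a R) D α Ω c))
    (h₂ : IsWeaklyTangent D (relField (Metric.ball a R) D α Ω c)) :
    ∃ r > 0, D = Metric.ball a r := by
  have hb := hD.isBounded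
  have hm := hD.isOpen.measurableSet
  have hQc := continuous_relField Metric.isBounded_ball hb (D₁ := Metric.ball a R) α Ω c
  have hα' : α - 1 ≠ 0 := sub_ne_zero.2 hα
  have hpi : (Real.pi : ℂ) ≠ 0 := by exact_mod_cast Real.pi_ne_zero
  have hR' : (R : ℂ) ≠ 0 := by exact_mod_cast hR.ne'
  obtain ⟨hmom, hfirst⟩ := moments_of_isWeaklyTangent_ball hb hm hR hsub hα h₁
  have hdef := hD.schwarzDefect_eq_zero hmom
  have hp0 : (Real.pi : ℂ)⁻¹ * ∫ ξ in D, (ξ - a) ^ 0 =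
      ((Real.pi⁻¹ * volume.real D : ℝ) : ℂ) := by simp
  have hp0' : Real.pi⁻¹ * volume.real D ≠ 0 := by
    refine mul_ne_zero (inv_ne_zero Real.pi_ne_zero) ?_
    rw [Measure.real, ENNReal.toReal_ne_zero]
    exact ⟨(hD.isOpen.measure_pos volume hD.simplyConnected.nonempty).ne', hb.measure_lt_top.ne⟩
  set p₁ := (Real.pi : ℂ)⁻¹ * ∫ ξ in D, (ξ - a) ^ 1 with hp₁
  set p₀ := Real.pi⁻¹ * volume.real D with hp₀
  rw [hp0] at hdef
  have hQ : ∀ z ∈ D, (z - a) ^ 2 * relField (Metric.ball a R) D α Ω c z =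
      ((1 - 2 * Ω : ℝ) : ℂ) * ((z - a) ^ 2 * (starRingEnd ℂ) (z - a)) +
      (((α - 1) * p₀ : ℝ) : ℂ) * (z - a) + ((α - 1 : ℝ) : ℂ) * p₁ +
      (((α - 1) / R ^ 2 : ℝ) : ℂ) * (starRingEnd ℂ) p₁ * (z - a) ^ 2 +
      ((α - 1 : ℝ) : ℂ) * schwarzDefect D a p₀ p₁ z := by
    intro z hz
    have hcc : (starRingEnd ℂ) (z - c) = (starRingEnd ℂ) (z - a) + (starRingEnd ℂ) (a - c) := by
      rw [← map_add]; congr 1; ring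
    have h3 : ((α - 1) / R ^ 2 : ℂ) * (starRingEnd ℂ) p₁ = -(2 * Ω * (starRingEnd ℂ) (a - c)) := by
      rw [hp₁, map_mul, map_inv₀, Complex.conj_ofReal]
      field_simp
      simp only [pow_one] at hfirst ⊢
      linear_combination -hfirst
    rw [relField, cauchyTransform_ball_of_mem hR (hsub hz), hcc, schwarzDefect]
    push_cast
    linear_combination -(z - a) ^ 2 * h3
  have hp₁0 : p₁ = 0 := firstMoment_eq_zero hb hm hQc h₂ hdef
    (div_ne_zero hα' (pow_ne_zero 2 hR.ne')) hQ
  rw [hp₁0] at hdef hQ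
  refine hD.eq_ball_of_schwarzDefect h₂ hp0' hdef hα' (s := 1 - 2 * Ω) fun z hz => ?_
  rw [hQ z hz]
  simp

end OuterDisc

/-! ### Concentric discs -/

theorem IsC1JordanDomain.eq_ball_of_isCircle {D : Set ℂ} (hD : IsC1JordanDomain D)
    (h : IsCircle (frontier D)) : ∃ (a : ℂ) (r : ℝ), 0 < r ∧ D = Metric.ball a r := by
  obtain ⟨a, r, hr, h⟩ := h
  exact ⟨a, r, hr, eq_ball_of_frontier_subset_sphere hD.isOpen hD.isBounded
    hD.simplyConnected.nonempty hr h.subset⟩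

theorem lt_of_closure_ball_subset_ball {a : ℂ} {r R : ℝ} (hr : 0 < r)
    (h : closure (Metric.ball a r) ⊆ Metric.ball a R) : r < R := by
  have h1 : a + (r : ℂ) ∈ closure (Metric.ball a r) := by
    rw [closure_ball a hr.ne', Metric.mem_closedBall, dist_eq_norm, add_sub_cancel_left,
      Complex.norm_real, Real.norm_of_nonneg hr.le]
  have h2 := h h1
  rwa [Metric.mem_ball, dist_eq_norm, add_sub_cancel_left, Complex.norm_real,
    Real.norm_of_nonneg hr.le] at h2

theorem theorem1 (D₁ D₂ : Set ℂ) (hD₁ : IsC1JordanDomain D₁) (hD₂ : IsC1JordanDomain D₂)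
    (hsub : closure D₂ ⊆ D₁) (α : ℝ) (hα : α ≠ 1) (ω : ℝ → ℂ → ℝ)
    (hω : IsVorticitySolution (twoPatch D₁ D₂ α) ω)
    (hrot : RotatesUniformly (twoPatch D₁ D₂ α) ω)
    (hcircle : IsCircle (frontier D₁) ∨ IsCircle (frontier D₂)) :
    ∃ (z₀ : ℂ) (r₁ r₂ : ℝ), 0 < r₂ ∧ r₂ < r₁ ∧
      frontier D₁ = Metric.sphere z₀ r₁ ∧ frontier D₂ = Metric.sphere z₀ r₂ ∧
      D₁ \ closure D₂ = {z : ℂ | r₂ < dist z z₀ ∧ dist z z₀ < r₁} := by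
  obtain ⟨c, Ω, hrot⟩ := hrot
  obtain ⟨h₁, h₂⟩ := isWeaklyTangent_relField hD₁.isBounded hD₁.isOpen hD₂.isBounded hD₂.isOpen
    hsub hα hω hrot
  have hsub' : D₂ ⊆ D₁ := subset_closure.trans hsub
  obtain ⟨a, r₁, r₂, hr₁, hr₂, rfl, rfl⟩ : ∃ (a : ℂ) (r₁ r₂ : ℝ), 0 < r₁ ∧ 0 < r₂ ∧
      D₁ = Metric.ball a r₁ ∧ D₂ = Metric.ball a r₂ := by
    rcases hcircle with h | h
    · obtain ⟨a, R, hR, rfl⟩ := hD₁.eq_ball_of_isCircle h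
      obtain ⟨r, hr, rfl⟩ := hD₂.eq_ball_of_isWeaklyTangent_in_ball hR hsub' hα h₁ h₂
      exact ⟨a, R, r, hR, hr, rfl, rfl⟩
    · obtain ⟨a, r, hr, rfl⟩ := hD₂.eq_ball_of_isCircle h
      obtain ⟨R, hR, rfl⟩ := hD₁.eq_ball_of_isWeaklyTangent_of_ball hr hsub' hα h₁ h₂
      exact ⟨a, R, r, hR, hr, rfl, rfl⟩
  refine ⟨a, r₁, r₂, hr₂, lt_of_closure_ball_subset_ball hr₂ hsub, frontier_ball a hr₁.ne',
    frontier_ball a hr₂.ne', ?_⟩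
  ext z
  rw [closure_ball a hr₂.ne', Set.mem_sdiff, Metric.mem_ball, Metric.mem_closedBall, not_le,
    and_comm]
  rfl
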